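/- Let $G=\mathrm{PSL}_2(\mathbb R)$ with its quotient topology and Borel $\sigma$-algebra. For $\theta,t\in\mathbb R$ let $k_\theta$ and $a_t$ be the images in $G$ of $\begin{pmatrix}\cos\theta&-\sin\theta\\ \sin\theta&\cos\theta\end{pmatrix}$ and $\begin{pmatrix}e^{t/2}&0\\0&e^{-t/2}\end{pmatrix}$, let $K=\{k_\theta:\theta\in\mathbb R\}$, and let $m_K$ be the Haar probability measure on $K$. For $r,\epsilon>0$ let $$\alpha_{r,\epsilon}=\frac{\int_r^{r+\epsilon}\sinh(t)\,\delta_{a_t}\,dt}{\int_r^{r+\epsilon}\sinh(t)\,dt}.$$ **Theorem.** Let $\nu,\lambda\ll m_K$ be Borel probability measures on $K$ with densities $\frac{d\nu}{dm_K},\frac{d\lambda}{dm_K}\in L^\infty(K,m_K)$, and let $\epsilon>0$. Then $\tau_r=\nu*\alpha_{r,\epsilon}*\lambda$, $r>0$, is a good averaging family on $G$. Here "good averaging family" means the following. Every $\tau_r$ ($r>0$) is a compactly supported probability measure on $G$, and $r\mapsto\int F\,d\tau_r$ is continuous on $(0,\infty)$ for every continuous $F:G\to\mathbb R$. Moreover,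 consider measurable actions of $G$ on standard Borel probability spaces $(X,\mu)$ that preserve $\mu$. For measurable $f:X\to\mathbb C$ write $\tau_r(f)(x)=\int_G f(g^{-1}x)\,d\tau_r(g)$, $\mathcal M[f]=\sup_{r>0}\tau_r(|f|)$, let $\mathbb E[f|G]$ be the conditional expectation of $f$ on the $\sigma$-algebra of $G$-invariant measurable sets, and let $\|f\|_{L\log L}=\int_X|f|\log(\max(|f|,1))\,d\mu$ and $L\log L=\{f:\|f\|_{L\log L}<\infty\}$. Then: 1. For every $1<p<\infty$ there is a constant $C_p$, the same for all such actions, such that for every $f\in L^p(X,\mu)$ the function $\mathcal M[f]$ is $\mu$-measurable and $\|\mathcal M[f]\|_p\le C_p\|f\|_p$. For every $f\in L^p(X,\mu)$, $\tau_r(f)$ lies in $L^p(X,\mu)$ for all $r>0$ and $\|\tau_r(f)-\mathbb E[f|G]\|_p\to0$ as $r\to\infty$. Also, for almost every $x$, the integrals $\tau_r(f)(x)$, $r>0$, converge absolutely and $\tau_r(f)(x)\to\mathbb E[f|G](x)$ as $r\to\infty$. 2. There is a constant $C$, the same for all such actions, such that for every $f\in L\log L$ the function $\mathcal M[f]$ is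 $\mu$-measurable and $\|\mathcal M[f]\|_1\le C\,(1+\|f\|_{L\log L})$. For every $f\in L\log L$, $\tau_r(f)$ lies in $L^1(X,\mu)$ for all $r>0$ and $\|\tau_r(f)-\mathbb E[f|G]\|_1\to0$ as $r\to\infty$. Also, for almost every $x$, the integrals $\tau_r(f)(x)$, $r>0$, converge absolutely and $\tau_r(f)(x)\to\mathbb E[f|G](x)$ as $r\to\infty$. -/

import Mathlib

open MeasureTheory Filter Topology Set
open scoped ENNReal NNReal MatrixGroups

universe u

noncomputable section

/-! ### Averaging operators and maximal functions for a group action -/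

section Action

variable {G : Type} [Group G] {X : Type u} [MeasurableSpace X] [MulAction G X]

variable (G X) in
/-- The σ-algebra of `G`-invariant measurable subsets of `X`. -/
@[reducible]
def invariantSigmaAlgebra : MeasurableSpace X :=
  ⨅ g : G, MeasurableSpace.invariants (fun x : X => g • x)

variable (G X) in
/-- It is a sub-σ-algebra of the given one, so that conditional expectations on it make sense. -/
theorem invariantSigmaAlgebra_le : invariantSigmaAlgebra G X ≤ ‹MeasurableSpace X› :=
  (iInf_le _ (1 : G)).trans (MeasurableSpace.invariants_le _)

variable (G X) in
theorem measurableSet_invariantSigmaAlgebra {s : Set X} :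
    MeasurableSet[invariantSigmaAlgebra G X] s ↔
      MeasurableSet s ∧ ∀ g : G, (fun x : X => g • x) ⁻¹' s = s := by
  simp only [MeasurableSpace.measurableSet_iInf, MeasurableSpace.measurableSet_invariants]
  exact ⟨fun h => ⟨(h 1).1, fun g => (h g).2⟩, fun h g => ⟨h.1, h.2 g⟩⟩

variable (G) in
/-- The ergodic mean `E[f | G]`: the conditional expectation of `f` on the σ-algebra of
`G`-invariant measurable sets. -/
def ergodicMean (μ : Measure X) (f : X → ℂ) : X → ℂ :=
  condExp (invariantSigmaAlgebra G X) μ f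

variable [MeasurableSpace G]

/-- The averaging operator `ν(f)(x) = ∫ f(g⁻¹ x) dν(g)`. -/
def averagingOp (ν : Measure G) (f : X → ℂ) (x : X) : ℂ :=
  ∫ g, f (g⁻¹ • x) ∂ν

/-- The maximal function `M_τ[f](x) = sup_{r > 0} τ_r(|f|)(x)`, with values in `[0, ∞]`. -/
def maximalFun (τ : ℝ → Measure G) (f : X → ℂ) (x : X) : ℝ≥0∞ :=
  ⨆ r : Ioi (0 : ℝ), ∫⁻ g, ‖f (g⁻¹ • x)‖ₑ ∂(τ r)

/-- `ν(f)` converges in `L^q`-norm to `E[f | G]` along the family `τ_r`, as `r → ∞`. -/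
def ConvergesInMean (τ : ℝ → Measure G) (μ : Measure X) (q : ℝ≥0∞) (f : X → ℂ) : Prop :=
  (∀ r : ℝ, 0 < r → MemLp (averagingOp (τ r) f) q μ) ∧
  Tendsto (fun r : ℝ => eLpNorm (averagingOp (τ r) f - ergodicMean G μ f) q μ) atTop (𝓝 0)

/-- For almost every `x` the averages `τ_r(f)(x)` are defined by absolutely convergent integrals
and converge to `E[f | G](x)`, as `r → ∞`. -/
def ConvergesPointwise (τ : ℝ → Measure G) (μ : Measure X) (f : X → ℂ) : Prop :=
  ∀ᵐ x ∂μ, (∀ r : ℝ, 0 < r → Integrable (fun g : G => f (g⁻¹ • x)) (τ r)) ∧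
    Tendsto (fun r : ℝ => averagingOp (τ r) f x) atTop (𝓝 (ergodicMean G μ f x))

end Action

/-- The functional `∫ |f| log(max(|f|, 1)) dμ`. -/
def logSize {X : Type u} [MeasurableSpace X] (μ : Measure X) (f : X → ℂ) : ℝ≥0∞ :=
  ∫⁻ x, ENNReal.ofReal (‖f x‖ * Real.log (max ‖f x‖ 1)) ∂μ

/-- Membership in `L log L`. -/
def MemLLogL {X : Type u} [MeasurableSpace X] (μ : Measure X) (f : X → ℂ) : Prop :=
  AEStronglyMeasurable f μ ∧ logSize μ f < ∞

/-! ### Good averaging families -/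

section Families

variable {G : Type} [Group G] [MeasurableSpace G]

/-- `τ_r`, `r > 0`, is a family of compactly supported probability measures that is continuous
against continuous functions. -/
structure IsAveragingFamily [TopologicalSpace G] (τ : ℝ → Measure G) : Prop where
  isProbabilityMeasure : ∀ r : ℝ, 0 < r → IsProbabilityMeasure (τ r)
  compactSupport : ∀ r : ℝ, 0 < r → ∃ S : Set G, IsCompact S ∧ τ r Sᶜ = 0
  continuous : ∀ F : G → ℝ, Continuous F → ContinuousOn (fun r : ℝ => ∫ g, F g ∂(τ r)) (Ioi 0)

/-- The strong-type `(p, p)` maximal inequality, with a constant that does not depend on the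
probability-measure-preserving action. -/
def StrongMaximalLp (τ : ℝ → Measure G) (p : ℝ≥0∞) : Prop :=
  ∃ C : ℝ≥0, ∀ (X : Type u) [MeasurableSpace X] [StandardBorelSpace X] [MulAction G X]
    [MeasurableSMul₂ G X] (μ : Measure X) [IsProbabilityMeasure μ] [SMulInvariantMeasure G X μ]
    (f : X → ℂ), MemLp f p μ →
      AEMeasurable (maximalFun τ f) μ ∧ eLpNorm (maximalFun τ f) p μ ≤ C * eLpNorm f p μ

/-- The `L log L` maximal inequality, with a constant that does not depend on the
probability-measure-preserving action. The summand `1` is the total mass of `μ`; it cannot be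
omitted, since `logSize μ f = 0` as soon as `|f| ≤ 1`. -/
def StrongMaximalLLogL (τ : ℝ → Measure G) : Prop :=
  ∃ C : ℝ≥0, ∀ (X : Type u) [MeasurableSpace X] [StandardBorelSpace X] [MulAction G X]
    [MeasurableSMul₂ G X] (μ : Measure X) [IsProbabilityMeasure μ] [SMulInvariantMeasure G X μ]
    (f : X → ℂ), MemLLogL μ f →
      AEMeasurable (maximalFun τ f) μ ∧ ∫⁻ x, maximalFun τ f x ∂μ ≤ C * (1 + logSize μ f)

/-- Mean ergodic in `L^p`. -/
def MeanErgodicLp (τ : ℝ → Measure G) (p : ℝ≥0∞) : Prop :=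
  ∀ (X : Type u) [MeasurableSpace X] [StandardBorelSpace X] [MulAction G X]
    [MeasurableSMul₂ G X] (μ : Measure X) [IsProbabilityMeasure μ] [SMulInvariantMeasure G X μ]
    (f : X → ℂ), MemLp f p μ → ConvergesInMean τ μ p f

/-- Mean ergodic in `L log L`: convergence is in `L¹`-norm. -/
def MeanErgodicLLogL (τ : ℝ → Measure G) : Prop :=
  ∀ (X : Type u) [MeasurableSpace X] [StandardBorelSpace X] [MulAction G X]
    [MeasurableSMul₂ G X] (μ : Measure X) [IsProbabilityMeasure μ] [SMulInvariantMeasure G X μ]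
    (f : X → ℂ), MemLLogL μ f → ConvergesInMean τ μ 1 f

/-- Pointwise ergodic in `L^p`. -/
def PointwiseErgodicLp (τ : ℝ → Measure G) (p : ℝ≥0∞) : Prop :=
  ∀ (X : Type u) [MeasurableSpace X] [StandardBorelSpace X] [MulAction G X]
    [MeasurableSMul₂ G X] (μ : Measure X) [IsProbabilityMeasure μ] [SMulInvariantMeasure G X μ]
    (f : X → ℂ), MemLp f p μ → ConvergesPointwise τ μ f

/-- Pointwise ergodic in `L log L`. -/
def PointwiseErgodicLLogL (τ : ℝ → Measure G) : Prop :=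
  ∀ (X : Type u) [MeasurableSpace X] [StandardBorelSpace X] [MulAction G X]
    [MeasurableSMul₂ G X] (μ : Measure X) [IsProbabilityMeasure μ] [SMulInvariantMeasure G X μ]
    (f : X → ℂ), MemLLogL μ f → ConvergesPointwise τ μ f

/-- Good averaging family in `L^p`. -/
structure IsGoodInLp (τ : ℝ → Measure G) (p : ℝ≥0∞) : Prop where
  maximal : StrongMaximalLp.{u} τ p
  mean : MeanErgodicLp.{u} τ p
  pointwise : PointwiseErgodicLp.{u} τ p

/-- Good averaging family in `L log L`. -/
structure IsGoodInLLogL (τ : ℝ → Measure G) : Prop where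
  maximal : StrongMaximalLLogL.{u} τ
  mean : MeanErgodicLLogL.{u} τ
  pointwise : PointwiseErgodicLLogL.{u} τ

/-- A good averaging family: good in every `L^p`, `1 < p < ∞`, and in `L log L`. -/
structure IsGoodAveragingFamily [TopologicalSpace G] (τ : ℝ → Measure G) : Prop where
  isAveragingFamily : IsAveragingFamily τ
  goodInLp : ∀ p : ℝ≥0∞, 1 < p → p < ∞ → IsGoodInLp.{u} τ p
  goodInLLogL : IsGoodInLLogL.{u} τ

end Families

/-! ### The group `PSL₂(ℝ)`, its subgroup `K` and the shell measures on `A` -/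

/-- `PSL₂(ℝ)` with its quotient topology carries its Borel σ-algebra. -/
instance instMeasurableSpacePSL : MeasurableSpace PSL(2, ℝ) := borel _

instance instBorelSpacePSL : BorelSpace PSL(2, ℝ) := ⟨rfl⟩

/-- The rotation matrix `k_θ`. -/
def rotSL (θ : ℝ) : SL(2, ℝ) :=
  ⟨!![Real.cos θ, -Real.sin θ; Real.sin θ, Real.cos θ], by
    rw [Matrix.det_fin_two_of]; nlinarith [Real.sin_sq_add_cos_sq θ]⟩

/-- The matrix `a_t = diag(e^{t/2}, e^{-t/2})`. -/
def diagSL (t : ℝ) : SL(2, ℝ) :=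
  ⟨!![Real.exp (t / 2), 0; 0, Real.exp (-t / 2)], by
    rw [Matrix.det_fin_two_of, ← Real.exp_add]; simp [neg_div]⟩

/-- The image of `k_θ` in `PSL₂(ℝ)`. -/
def rot (θ : ℝ) : PSL(2, ℝ) := (rotSL θ : PSL(2, ℝ))

/-- The image of `a_t` in `PSL₂(ℝ)`. -/
def diagElt (t : ℝ) : PSL(2, ℝ) := (diagSL t : PSL(2, ℝ))

theorem rotSL_add (s t : ℝ) : rotSL (s + t) = rotSL s * rotSL t := by
  ext i j
  rw [Matrix.SpecialLinearGroup.coe_mul, Matrix.mul_apply, Fin.sum_univ_two]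
  fin_cases i <;> fin_cases j <;> simp [rotSL, Real.cos_add, Real.sin_add] <;> ring

theorem rotSL_zero : rotSL 0 = 1 := by
  ext i j
  fin_cases i <;> fin_cases j <;> simp [rotSL]

theorem rot_add (s t : ℝ) : rot (s + t) = rot s * rot t := by
  simp [rot, rotSL_add]

theorem rot_zero : rot 0 = 1 := by
  simp [rot, rotSL_zero]

theorem continuous_rot : Continuous rot := by
  refine continuous_quot_mk.comp (Continuous.subtype_mk (continuous_matrix fun i j => ?_) _)
  fin_cases i <;> fin_cases j <;> simp <;> fun_prop

/-- The maximal compact subgroup `K = {k_θ}` of `PSL₂(ℝ)`. -/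
def rotK : Subgroup PSL(2, ℝ) where
  carrier := range rot
  mul_mem' := by
    rintro _ _ ⟨s, rfl⟩ ⟨t, rfl⟩
    exact ⟨s + t, rot_add s t⟩
  one_mem' := ⟨0, rot_zero⟩
  inv_mem' := by
    rintro _ ⟨s, rfl⟩
    exact ⟨-s, eq_inv_of_mul_eq_one_left (by rw [← rot_add, neg_add_cancel, rot_zero])⟩

theorem rot_periodic : Function.Periodic rot (2 * Real.pi) := fun θ => by
  simp [rot, rotSL]

instance instCompactSpaceRotK : CompactSpace rotK :=
  isCompact_iff_compactSpace.mp <| by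
    have h : (rotK : Set PSL(2, ℝ)) = rot '' Icc 0 (0 + 2 * Real.pi) :=
      (rot_periodic.image_Icc Real.two_pi_pos 0).symm
    rw [h]
    exact isCompact_Icc.image continuous_rot

/-- The Haar probability measure `m_K` on `K`. -/
def haarK : Measure rotK := Measure.haarMeasure ⊤

theorem haarK_univ : haarK univ = 1 := by
  have h := Measure.haarMeasure_self (K₀ := (⊤ : TopologicalSpace.PositiveCompacts rotK))
  rwa [TopologicalSpace.PositiveCompacts.coe_top] at h

/-- The shell measure `α_{r,ε} = (∫_r^{r+ε} sinh t dt)⁻¹ ∫_r^{r+ε} sinh(t) δ_{a_t} dt`. -/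
def shellMeasure (r ε : ℝ) : Measure PSL(2, ℝ) :=
  (∫⁻ t in Icc r (r + ε), ENNReal.ofReal (Real.sinh t))⁻¹ •
    ((volume.restrict (Icc r (r + ε))).withDensity
      (fun t => ENNReal.ofReal (Real.sinh t))).map diagElt

/-- The convolution `ν * α_{r,ε} * lam` on `PSL₂(ℝ)` of measures `ν`, `lam` on `K` with the shell
measure; measures on `K` are regarded as measures on `PSL₂(ℝ)`. -/
def sectorFamily (ν lam : Measure rotK) (ε r : ℝ) : Measure PSL(2, ℝ) :=
  (ν.map Subtype.val).mconv ((shellMeasure r ε).mconv (lam.map Subtype.val))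

end

/-!
The sector averages `ν * α_{r,ε} * lam` are compared with averages along the horocycle flow
`n_u = unip u`. Writing `u = 2 sinh (t / 2)`, one has the explicit Cartan decomposition
`n_u = k_φ a_t k_{φ - π/2}` with `φ = arctan (exp (-t / 2))` (`unip_eq_rot_mul_diagElt_mul_rot`),
and the substitution turns the radial density `sinh t dt` into `u du`. A shell of radii of thickness `ε`
thus becomes a shell of horocycle times, on which normalized `u du` is dominated by a multiple of
the normalized Lebesgue measure on `[0, b]`, where `b` is the outer time.

*Maximal inequalities.* Since `ν` and `lam` have bounded densities, they may be replaced by Haar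
measure of `K`, at the cost of a constant; then `k_φ` and `k_{φ - π/2}` are absorbed. Hence all
sector averages of `f ≥ 0` are bounded, at every point, by the `K`-average of the horocycle maximal
function of the `K`-average of `f` (`exists_lintegral_sectorFamily_le`). The weak type inequality
for the latter is the maximal ergodic theorem for a single transformation `n_h`
(`measure_lt_ergMax_orbitAvg_le`); its form localized to large values of `f` yields the `L^p` and
`L log L` inequalities (`lintegral_rpow_le_of_weak_type`, `lintegral_le_of_weak_type`). All
constants depend on `ν`, `lam`, `ε` and `p` only.

*Convergence for bounded functions.* By the Mautner phenomenon (`smul_eq_of_unip_smul_eq`) the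
vectors of `L²` fixed by the horocycle flow are fixed by the group, so a function with zero ergodic mean
is an `L²`-limit of sums of horocycle coboundaries. Horocycle averages of coboundaries of bounded
functions over shells tend to zero, and Banach's principle (`ae_tendsto_of_approx`) gives almost
everywhere convergence of the horocycle averages to the ergodic mean
(`ae_tendsto_integral_horoShell`). As `φ → 0` when `t → ∞`, and absolutely continuous measures on
`K` move continuously in total variation under rotations (`exists_translation_modulus`), the sector
averages differ from `ν`-averages of horocycle averages by an error tending to zero
(`ae_tendsto_averagingOp_of_bounded`).

*General functions.* The maximal inequality, applied to null sets, shows that changing `f` on a null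
set affects, for almost every `x`, none of the averages (`IsDominated.ae_forall_ae_inv_smul`).
Truncation and Banach's principle extend pointwise convergence to `L log L`, which contains `L^p`;
as the maximal function is in `L^p`, respectively in `L¹`, mean convergence follows by dominated
convergence.
-/

noncomputable section

/-! ### The topological group `PSL₂(ℝ)` and its subgroups -/

instance : SecondCountableTopology SL(2, ℝ) :=
  haveI : SecondCountableTopology (Matrix (Fin 2) (Fin 2) ℝ) :=
    inferInstanceAs (SecondCountableTopology (Fin 2 → Fin 2 → ℝ))
  (Topology.IsEmbedding.subtypeVal (p := fun A : Matrix (Fin 2) (Fin 2) ℝ => A.det = 1)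
    ).secondCountableTopology

instance : LocallyCompactSpace SL(2, ℝ) := by
  have : LocallyCompactSpace (Matrix (Fin 2) (Fin 2) ℝ) :=
    inferInstanceAs (LocallyCompactSpace (Fin 2 → Fin 2 → ℝ))
  have hc : IsClosed {A : Matrix (Fin 2) (Fin 2) ℝ | A.det = 1} :=
    isClosed_eq (Continuous.matrix_det continuous_id) continuous_const
  exact hc.isClosedEmbedding_subtypeVal.locallyCompactSpace

instance : SecondCountableTopology PSL(2, ℝ) :=
  inferInstanceAs (SecondCountableTopology (SL(2, ℝ) ⧸ Subgroup.center SL(2, ℝ)))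

instance : LocallyCompactSpace PSL(2, ℝ) :=
  inferInstanceAs (LocallyCompactSpace (SL(2, ℝ) ⧸ Subgroup.center SL(2, ℝ)))

/-- The upper triangular unipotent matrix with entry `u`. -/
def unipSL (u : ℝ) : SL(2, ℝ) := ⟨!![1, u; 0, 1], by simp⟩

/-- The lower triangular unipotent matrix with entry `s`. -/
def lowSL (s : ℝ) : SL(2, ℝ) := ⟨!![1, 0; s, 1], by simp⟩

/-- The image `n_u` of the upper triangular unipotent matrix in `PSL₂(ℝ)`: the horocycle flow. -/
def unip (u : ℝ) : PSL(2, ℝ) := (unipSL u : PSL(2, ℝ))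

/-- The image of the lower triangular unipotent matrix in `PSL₂(ℝ)`. -/
def low (s : ℝ) : PSL(2, ℝ) := (lowSL s : PSL(2, ℝ))

theorem unip_add (s t : ℝ) : unip (s + t) = unip s * unip t := by
  rw [unip, unip, unip, ← QuotientGroup.mk_mul]
  congr 1
  ext i j
  rw [Matrix.SpecialLinearGroup.coe_mul, Matrix.mul_apply, Fin.sum_univ_two]
  fin_cases i <;> fin_cases j <;> simp [unipSL, add_comm]

theorem low_add (s t : ℝ) : low (s + t) = low s * low t := by
  rw [low, low, low, ← QuotientGroup.mk_mul]
  congr 1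
  ext i j
  rw [Matrix.SpecialLinearGroup.coe_mul, Matrix.mul_apply, Fin.sum_univ_two]
  fin_cases i <;> fin_cases j <;> simp [lowSL]

theorem unip_zero : unip 0 = 1 := by simpa using unip_add 0 0

theorem low_zero : low 0 = 1 := by simpa using low_add 0 0

theorem unip_neg (u : ℝ) : unip (-u) = (unip u)⁻¹ :=
  eq_inv_of_mul_eq_one_left (by rw [← unip_add, neg_add_cancel, unip_zero])

theorem low_neg (u : ℝ) : low (-u) = (low u)⁻¹ :=
  eq_inv_of_mul_eq_one_left (by rw [← low_add, neg_add_cancel, low_zero])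

theorem continuous_unip : Continuous unip := by
  refine continuous_quot_mk.comp (Continuous.subtype_mk (continuous_matrix fun i j => ?_) _)
  fin_cases i <;> fin_cases j <;> simp <;> fun_prop

theorem continuous_low : Continuous low := by
  refine continuous_quot_mk.comp (Continuous.subtype_mk (continuous_matrix fun i j => ?_) _)
  fin_cases i <;> fin_cases j <;> simp <;> fun_prop

theorem continuous_diagElt : Continuous diagElt := by
  refine continuous_quot_mk.comp (Continuous.subtype_mk (continuous_matrix fun i j => ?_) _)
  fin_cases i <;> fin_cases j <;> simp <;> fun_prop

theorem diagElt_mul_low (t s : ℝ) :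
    diagElt t * low s = low (Real.exp (-t) * s) * diagElt t := by
  rw [diagElt, low, low, ← QuotientGroup.mk_mul, ← QuotientGroup.mk_mul]
  congr 1
  ext i j
  rw [Matrix.SpecialLinearGroup.coe_mul, Matrix.SpecialLinearGroup.coe_mul, Matrix.mul_apply,
    Matrix.mul_apply, Fin.sum_univ_two, Fin.sum_univ_two]
  have h : Real.exp (-t) * Real.exp (t / 2) = Real.exp (-t / 2) := by
    rw [← Real.exp_add]; ring_nf
  fin_cases i <;> fin_cases j <;> simp [diagSL, lowSL]
  linear_combination (-s) * h

/-- The diagonal element `a_t` lies, up to an arbitrarily small lower unipotent error, in the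
double coset of any small lower unipotent element under the horocycle subgroup. -/
theorem unip_mul_low_mul_unip (t : ℝ) {s : ℝ} (hs : s ≠ 0) :
    unip ((Real.exp (t / 2) - 1) / s) * low s * unip ((Real.exp (-t / 2) - 1) / s) =
      diagElt t * low (Real.exp (t / 2) * s) := by
  rw [diagElt, low, low, unip, unip, ← QuotientGroup.mk_mul, ← QuotientGroup.mk_mul,
    ← QuotientGroup.mk_mul]
  congr 1
  have h : Real.exp (-t / 2) = (Real.exp (t / 2))⁻¹ := by rw [← Real.exp_neg, neg_div]
  have h0 := Real.exp_ne_zero (t / 2)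
  ext i j
  simp only [Matrix.SpecialLinearGroup.coe_mul]
  simp only [diagSL, lowSL, unipSL, h]
  generalize Real.exp (t / 2) = a at h0
  fin_cases i <;> fin_cases j <;> simp [Matrix.mul_apply, Fin.sum_univ_two] <;> field_simp <;> ring

/-- Upper and lower unipotent elements generate `PSL₂(ℝ)`. -/
theorem exists_eq_unip_low (g : PSL(2, ℝ)) :
    ∃ x y z w : ℝ, g = unip x * low y * unip z * low w := by
  induction g using QuotientGroup.induction_on with | H A => ?_
  have key : ∀ B : SL(2, ℝ), B 1 0 ≠ 0 → ∃ x y z : ℝ, B = unipSL x * lowSL y * unipSL z := by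
    intro B hB
    refine ⟨(B 0 0 - 1) / B 1 0, B 1 0, (B 1 1 - 1) / B 1 0, ?_⟩
    have hd := B.det_coe
    rw [Matrix.det_fin_two] at hd
    ext i j
    simp only [Matrix.SpecialLinearGroup.coe_mul]
    fin_cases i <;> fin_cases j <;>
      simp [lowSL, unipSL, Matrix.mul_apply, Fin.sum_univ_two] <;> field_simp <;>
      first | ring1 | linear_combination hd | linear_combination -hd
  by_cases h : A 1 0 = 0
  · have hd := A.det_coe
    rw [Matrix.det_fin_two, h, mul_zero, sub_zero] at hd
    obtain ⟨x, y, z, hB⟩ := key (A * lowSL 1) (by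
      simp only [Matrix.SpecialLinearGroup.coe_mul]
      simp [lowSL, Matrix.mul_apply, Fin.sum_univ_two, h]
      rintro h0
      simp [h0] at hd)
    refine ⟨x, y, z, -1, ?_⟩
    rw [low_neg, eq_mul_inv_iff_mul_eq]
    rw [low, low, unip, unip, ← QuotientGroup.mk_mul, hB]
    simp only [QuotientGroup.mk_mul]
  · obtain ⟨x, y, z, hB⟩ := key A h
    refine ⟨x, y, z, 0, ?_⟩
    rw [low_zero, mul_one, hB]
    simp only [QuotientGroup.mk_mul, unip, low]

/-- The angle `φ` in the Cartan decomposition `n_u = k_φ a_t k_{φ - π/2}`, `u = 2 sinh (t / 2)`. -/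
def cartanAngle (t : ℝ) : ℝ := Real.arctan (Real.exp (-t / 2))

theorem tendsto_cartanAngle : Tendsto cartanAngle atTop (𝓝 0) := by
  have h : Tendsto (fun t : ℝ => Real.exp (-t / 2)) atTop (𝓝 0) := by
    refine Real.tendsto_exp_atBot.comp ?_
    have := (tendsto_neg_atTop_atBot (G := ℝ)).atBot_div_const (r := (2 : ℝ)) (by norm_num)
    exact this
  rw [← Real.arctan_zero]
  exact (Real.continuous_arctan.tendsto 0).comp h

/-- The explicit Cartan decomposition of the horocycle flow. -/
theorem unip_eq_rot_mul_diagElt_mul_rot (t : ℝ) :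
    unip (2 * Real.sinh (t / 2)) =
      rot (cartanAngle t) * diagElt t * rot (cartanAngle t - Real.pi / 2) := by
  rw [unip, rot, diagElt, rot, ← QuotientGroup.mk_mul, ← QuotientGroup.mk_mul]
  congr 1
  set φ := cartanAngle t with hφ
  have hc : 0 < Real.cos φ := Real.cos_arctan_pos _
  have hs : Real.sin φ = Real.exp (-t / 2) * Real.cos φ := by
    have := Real.tan_arctan (Real.exp (-t / 2))
    rw [← cartanAngle, ← hφ, Real.tan_eq_sin_div_cos, div_eq_iff hc.ne'] at this
    exact this
  have h1 := Real.sin_sq_add_cos_sq φ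
  have h : Real.exp (-t / 2) = (Real.exp (t / 2))⁻¹ := by rw [← Real.exp_neg, neg_div]
  have h0 := Real.exp_ne_zero (t / 2)
  have hsh : 2 * Real.sinh (t / 2) = Real.exp (t / 2) - (Real.exp (t / 2))⁻¹ := by
    rw [Real.sinh_eq, Real.exp_neg]; ring
  have e1 : Real.cos (φ - Real.pi / 2) = Real.sin φ := Real.cos_sub_pi_div_two φ
  have e2 : Real.sin (φ - Real.pi / 2) = -Real.cos φ := Real.sin_sub_pi_div_two φ
  ext i j
  simp only [Matrix.SpecialLinearGroup.coe_mul]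
  simp only [diagSL, rotSL, unipSL, e1, e2, hsh, h]
  rw [h] at hs
  generalize Real.exp (t / 2) = a at h0 hs
  generalize Real.sin φ = x at *
  generalize Real.cos φ = y at *
  have hy : y = a * x := by rw [hs]; field_simp
  subst hy
  have h2 : a * (x ^ 2 + (a * x) ^ 2) = a := by rw [h1, mul_one]
  fin_cases i <;> fin_cases j <;> simp [Matrix.mul_apply, Fin.sum_univ_two] <;> field_simp <;>
    first | linarith | linear_combination (1 - a ^ 2) * h1

theorem rot_mul_comm (s t : ℝ) : rot s * rot t = rot t * rot s := by
  rw [← rot_add, add_comm, rot_add]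

theorem rotK_mul_comm (a b : rotK) : a * b = b * a := by
  obtain ⟨_, s, rfl⟩ := a
  obtain ⟨_, t, rfl⟩ := b
  exact Subtype.ext (rot_mul_comm s t)

/-- The rotation `k_θ` as an element of `K`. -/
def rotElt (θ : ℝ) : rotK := ⟨rot θ, θ, rfl⟩

theorem continuous_rotElt : Continuous rotElt := continuous_rot.subtype_mk _

theorem rotElt_zero : rotElt 0 = 1 := Subtype.ext rot_zero

instance : Measure.IsHaarMeasure haarK :=
  inferInstanceAs (Measure.IsHaarMeasure (Measure.haarMeasure ⊤))

instance : Measure.Regular haarK :=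
  inferInstanceAs (Measure.Regular (Measure.haarMeasure ⊤))

instance : IsProbabilityMeasure haarK := ⟨haarK_univ⟩

instance : Measure.IsMulRightInvariant haarK :=
  ⟨fun g => by simp_rw [rotK_mul_comm _ g]; exact map_mul_left_eq_self haarK g⟩

instance : SecondCountableTopology rotK :=
  TopologicalSpace.Subtype.secondCountableTopology (rotK : Set PSL(2, ℝ))

/-! ### Vectors fixed by the horocycle flow -/

section Mautner

open DomMulAct

variable {E : Type*} [MetricSpace E] [MulAction PSL(2, ℝ)ᵈᵐᵃ E] [IsIsometricSMul PSL(2, ℝ)ᵈᵐᵃ E]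

/-- If `v` is fixed by `m` and `n`, then the displacement of `v` under `g` does not change when `g`
is multiplied by them on either side. -/
theorem dist_smul_mul_mul {v : E} {m n : PSL(2, ℝ)} (hm : mk m • v = v) (hn : mk n • v = v)
    (g : PSL(2, ℝ)) : dist (mk (m * g * n) • v) v = dist (mk g • v) v := by
  rw [mk_mul, mk_mul, mul_smul, mul_smul, hm]
  calc dist (mk n • mk g • v) v = dist (mk n • mk g • v) (mk n • v) := by rw [hn]
    _ = dist (mk g • v) v := dist_smul _ _ _

/-- The Mautner phenomenon: in an isometric action of `PSL₂(ℝ)`, a point fixed by the horocycle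
flow, at which the opposite horocycle flow is continuous, is fixed by the whole group. -/
theorem smul_eq_of_unip_smul_eq {v : E} (hN : ∀ u : ℝ, mk (unip u) • v = v)
    (hcont : Tendsto (fun s : ℝ => mk (low s) • v) (𝓝 0) (𝓝 v)) (g : PSL(2, ℝ)) :
    mk g • v = v := by
  have hlow0 : Tendsto (fun s : ℝ => dist (mk (low s) • v) v) (𝓝[≠] 0) (𝓝 0) := by
    have := (hcont.mono_left (nhdsWithin_le_nhds (s := {0}ᶜ))).dist
      (tendsto_const_nhds (x := v))
    rwa [dist_self] at this
  have hmul (c : ℝ) : Tendsto (fun s : ℝ => c * s) (𝓝[≠] 0) (𝓝 0) := by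
    have : Tendsto (fun s : ℝ => c * s) (𝓝 0) (𝓝 (c * 0)) := tendsto_id.const_mul c
    rw [mul_zero] at this
    exact this.mono_left nhdsWithin_le_nhds
  -- `a_t * low s` lies in the double coset of `low s'`, where `s' → 0` as `s → 0`
  have hA : ∀ t : ℝ, mk (diagElt t) • v = v := by
    intro t
    have h1 : ∀ᶠ s : ℝ in 𝓝[≠] 0, dist (mk (diagElt t) • v) v ≤
        dist (mk (low s) • v) v + dist (mk (low (Real.exp (-t) * (Real.exp (t / 2) * s))) • v) v := by
      filter_upwards [self_mem_nhdsWithin] with s hs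
      rw [← dist_smul_mul_mul (hN ((Real.exp (t / 2) - 1) / s))
        (hN ((Real.exp (-t / 2) - 1) / s)) (low s), unip_mul_low_mul_unip t hs, diagElt_mul_low,
        mk_mul, mul_smul, add_comm]
      refine (dist_triangle _ (mk (diagElt t) • mk (low (Real.exp (-t) * (Real.exp (t / 2) * s)))
        • v) _).trans (add_le_add_left ?_ _)
      rw [dist_smul, dist_comm]
    have h2 := hlow0.add ((((hcont.comp ((hmul (Real.exp (-t) * Real.exp (t / 2)))))).dist
      (tendsto_const_nhds (x := v))))
    rw [dist_self, add_zero] at h2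
    have h3 := ge_of_tendsto h2 (h1.mono fun s hs => by
      simpa only [Function.comp, mul_assoc] using hs)
    exact dist_le_zero.mp h3
  have hL : ∀ s : ℝ, mk (low s) • v = v := by
    intro s
    have h1 : ∀ t : ℝ, dist (mk (low s) • v) v = dist (mk (low (Real.exp (-t) * s)) • v) v := by
      intro t
      have : low (Real.exp (-t) * s) = diagElt t * low s * (diagElt t)⁻¹ := by
        rw [diagElt_mul_low, mul_inv_cancel_right]
      have h' : mk (diagElt t)⁻¹ • v = v := by
        conv_lhs => rw [← hA t]
        rw [← mul_smul, ← mk_mul, mul_inv_cancel, mk_one, one_smul]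
      rw [this, dist_smul_mul_mul (hA t) h']
    have h2 : Tendsto (fun t : ℝ => Real.exp (-t) * s) atTop (𝓝 0) := by
      simpa using (Real.tendsto_exp_neg_atTop_nhds_zero).mul_const s
    have h3 := (hcont.comp h2).dist (tendsto_const_nhds (x := v))
    rw [dist_self] at h3
    exact dist_le_zero.mp (ge_of_tendsto h3 (Eventually.of_forall fun t => (h1 t).le))
  obtain ⟨x, y, z, w, rfl⟩ := exists_eq_unip_low g
  simp only [mk_mul, mul_smul, hN, hL]

end Mautner

/-! ### Measure-preserving actions: null sets, continuity in `L²`, invariant versions -/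

section Invariance

variable {G : Type} [Group G] {X : Type u} [MeasurableSpace X] [MulAction G X]

/-- A function that is measurable with respect to the σ-algebra of invariant sets is invariant. -/
theorem apply_smul_of_measurable_invariant {f : X → ℂ}
    (hf : Measurable[invariantSigmaAlgebra G X] f) (g : G) (x : X) : f (g • x) = f x := by
  have h := ((measurableSet_invariantSigmaAlgebra G X).1 (hf (measurableSet_singleton (f x)))).2 g
  have hx : x ∈ (fun x : X => g • x) ⁻¹' (f ⁻¹' {f x}) := by rw [h]; rfl
  exact hx

theorem measurable_invariant_of_apply_smul {f : X → ℂ} (hf : Measurable f)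
    (h : ∀ (g : G) (x : X), f (g • x) = f x) : Measurable[invariantSigmaAlgebra G X] f := by
  intro s hs
  refine (measurableSet_invariantSigmaAlgebra G X).2 ⟨hf hs, fun g => ?_⟩
  ext x
  simp [h]

variable [MeasurableSpace G] [MeasurableSMul₂ G X] {μ : Measure X} [SFinite μ]

/-- A property that holds almost everywhere holds, for almost every `x`, at almost all translates
of `x`. -/
theorem ae_ae_smul [SMulInvariantMeasure G X μ] {Y : Type*} [MeasurableSpace Y]
    (ρ : Measure Y) [SFinite ρ] {φ : Y → G} (hφ : Measurable φ) {p : X → Prop} (hp : ∀ᵐ x ∂μ, p x) :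
    ∀ᵐ x ∂μ, ∀ᵐ y ∂ρ, p (φ y • x) := by
  set Z := toMeasurable μ {x | ¬ p x} with hZ
  have hZ0 : μ Z = 0 := by rw [hZ, measure_toMeasurable]; exact hp
  have hZm : MeasurableSet Z := measurableSet_toMeasurable _ _
  have hm : Measurable fun q : X × Y => φ q.2 • q.1 :=
    (hφ.comp measurable_snd).smul measurable_fst
  have h : ∀ᵐ q : Y × X ∂(ρ.prod μ), φ q.1 • q.2 ∉ Z := by
    have hm' : Measurable fun q : Y × X => φ q.1 • q.2 := hm.comp measurable_swap
    rw [ae_iff]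
    simp only [not_not]
    change (ρ.prod μ) ((fun q : Y × X => φ q.1 • q.2) ⁻¹' Z) = 0
    rw [Measure.measure_prod_null (hm' hZm)]
    refine Eventually.of_forall fun y => ?_
    change μ ((fun x => φ y • x) ⁻¹' Z) = 0
    rw [measure_preimage_smul, hZ0]
  have h2 : ∀ᵐ q : X × Y ∂(μ.prod ρ), φ q.2 • q.1 ∉ Z := by
    have := (Measure.measurePreserving_swap (μ := μ) (ν := ρ)).quasiMeasurePreserving.ae h
    exact this
  filter_upwards [Measure.ae_ae_of_ae_prod h2] with x hx
  filter_upwards [hx] with y hy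
  by_contra hc
  exact hy (subset_toMeasurable μ {x | ¬ p x} hc)

/-- A function that is almost everywhere invariant under each group element separately agrees almost
everywhere with a strictly invariant function. -/
theorem exists_measurable_invariant_ae_eq [TopologicalSpace G] [IsTopologicalGroup G]
    [BorelSpace G] [SecondCountableTopology G] [LocallyCompactSpace G] {f : X → ℂ}
    (hf : Measurable f) (h : ∀ g : G, ∀ᵐ x ∂μ, f (g • x) = f x) :
    ∃ f' : X → ℂ, Measurable[invariantSigmaAlgebra G X] f' ∧ f =ᵐ[μ] f' := by
  classical
  obtain ⟨η, hη, hη'⟩ : ∃ η : Measure G, η.IsHaarMeasure ∧ SigmaFinite η :=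
    ⟨Measure.haar, inferInstance, inferInstance⟩
  obtain ⟨ρ, hρ, hηρ, hρη⟩ : ∃ ρ : Measure G, IsProbabilityMeasure ρ ∧ η ≪ ρ ∧ ρ ≪ η := by
    refine ⟨η.toFinite, ?_, absolutelyContinuous_toFinite η, toFinite_absolutelyContinuous η⟩
    have : NeZero η := inferInstance
    infer_instance
  have hfm : Measurable fun q : X × G => f (q.2 • q.1) :=
    hf.comp (measurable_snd.smul measurable_fst)
  -- `I x` is the mean of `f` over the orbit of `x`; on `A` the orbit function is almost constant
  set I : X → ℂ := fun x => ∫ g, f (g • x) ∂ρ with hI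
  have hIm : Measurable I := (StronglyMeasurable.integral_prod_right
    (f := fun x g => f (g • x)) hfm.stronglyMeasurable).measurable
  set A : Set X := {x | ∀ᵐ g ∂ρ, f (g • x) = I x} with hA
  have hAm : MeasurableSet A := by
    have hs : MeasurableSet {q : X × G | f (q.2 • q.1) ≠ I q.1} :=
      (measurableSet_eq_fun hfm (hIm.comp measurable_fst)).compl
    exact (measurable_measure_prodMk_left (ν := ρ) hs) (measurableSet_singleton 0)
  have hconst : ∀ x c, (∀ᵐ g ∂ρ, f (g • x) = c) → I x = c := by
    intro x c hc
    rw [hI]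
    simp only
    rw [integral_congr_ae hc, integral_const]
    simp
  have hinv : ∀ (k : G) (x : X), x ∈ A → k • x ∈ A ∧ I (k • x) = I x := by
    intro k x hx
    have h1 : ∀ᵐ g ∂η, f (g • x) = I x := hηρ.ae_le hx
    have hq : Measure.QuasiMeasurePreserving (fun g : G => g * k) η η :=
      quasiMeasurePreserving_mul_right η k
    have h2 : ∀ᵐ g ∂η, f ((g * k) • x) = I x :=
      hq.ae (p := fun g => f (g • x) = I x) h1
    have h3 : ∀ᵐ g ∂ρ, f (g • k • x) = I x := by
      filter_upwards [hρη.ae_le h2] with g hg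
      rwa [← mul_smul]
    have h4 := hconst _ _ h3
    refine ⟨?_, h4⟩
    change ∀ᵐ g ∂ρ, f (g • k • x) = I (k • x)
    rwa [h4]
  have hinv' : ∀ (k : G) (x : X), k • x ∈ A → x ∈ A := by
    intro k x hx
    simpa using (hinv k⁻¹ _ hx).1
  refine ⟨A.indicator I, measurable_invariant_of_apply_smul (hIm.indicator hAm) ?_, ?_⟩
  · intro k x
    by_cases hx : x ∈ A
    · rw [indicator_of_mem hx, indicator_of_mem (hinv k x hx).1, (hinv k x hx).2]
    · rw [indicator_of_notMem hx, indicator_of_notMem fun h => hx (hinv' k x h)]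
  · have h1 : ∀ᵐ q : G × X ∂(ρ.prod μ), f (q.1 • q.2) = f q.2 := by
      have hs : MeasurableSet {q : G × X | f (q.1 • q.2) = f q.2} :=
        measurableSet_eq_fun (hfm.comp measurable_swap) (hf.comp measurable_snd)
      rw [Measure.ae_prod_iff_ae_ae hs]
      exact Eventually.of_forall h
    have h2 : ∀ᵐ q : X × G ∂(μ.prod ρ), f (q.2 • q.1) = f q.1 :=
      (Measure.measurePreserving_swap (μ := μ) (ν := ρ)).quasiMeasurePreserving.ae h1
    filter_upwards [Measure.ae_ae_of_ae_prod h2] with x hx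
    have h3 := hconst x _ hx
    have hxA : x ∈ A := by change ∀ᵐ g ∂ρ, f (g • x) = I x; rwa [h3]
    rw [indicator_of_mem hxA, h3]

end Invariance

section Continuity

open DomMulAct

variable {G : Type} [Group G] [MeasurableSpace G] {X : Type u} [MeasurableSpace X]
  [StandardBorelSpace X] [MulAction G X] [MeasurableSMul₂ G X] {μ : Measure X} [SFinite μ]
  [SMulInvariantMeasure G X μ]

instance fact_two_ne_top : Fact ((2 : ℝ≥0∞) ≠ ∞) := ⟨ENNReal.ofNat_ne_top⟩

/-- A measurable flow acts continuously on `L²`. By separability, some set of times at which the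
orbit of `w` is in a given small ball has positive measure; its difference set is a neighbourhood
of zero by Steinhaus' theorem. -/
theorem tendsto_smul_Lp_of_measurable [SigmaFinite μ] {γ : ℝ → G} (hγ : Measurable γ)
    (hadd : ∀ s t, γ (s + t) = γ s * γ t) (w : Lp ℂ 2 μ) :
    Tendsto (fun s : ℝ => mk (γ s) • w) (𝓝 0) (𝓝 w) := by
  rw [Metric.tendsto_nhds]
  intro ε hε
  set d := TopologicalSpace.denseSeq (Lp ℂ 2 μ)
  set E : ℕ → Set ℝ := fun n => {s | edist (mk (γ s) • w) (d n) < ENNReal.ofReal (ε / 2)} with hE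
  have hmeas : ∀ n, MeasurableSet (E n) := by
    intro n
    have heq : (fun s => edist (mk (γ s) • w) (d n)) = fun s =>
        (∫⁻ x, ‖w (γ s • x) - d n x‖ₑ ^ (2 : ℝ) ∂μ) ^ (1 / (2 : ℝ)) := by
      funext s
      rw [Lp.edist_def, eLpNorm_eq_lintegral_rpow_enorm_toReal two_ne_zero ENNReal.ofNat_ne_top]
      simp only [ENNReal.toReal_ofNat]
      congr 1
      refine lintegral_congr_ae ?_
      filter_upwards [smul_Lp_ae_eq (mk (γ s)) w] with x hx
      rw [Pi.sub_apply, hx]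
      rfl
    refine measurableSet_lt ?_ measurable_const
    rw [heq]
    refine Measurable.pow_const (Measurable.lintegral_prod_right' (f := fun q : ℝ × X =>
      ‖w (γ q.1 • q.2) - d n q.2‖ₑ ^ (2 : ℝ)) ?_) _
    refine Measurable.pow_const (Measurable.enorm (Measurable.sub ?_ ?_)) _
    · exact (Lp.stronglyMeasurable w).measurable.comp
        ((hγ.comp measurable_fst).smul measurable_snd)
    · exact (Lp.stronglyMeasurable (d n)).measurable.comp measurable_snd
  have hcover : (⋃ n, E n) = univ := by
    refine eq_univ_of_forall fun s => mem_iUnion.2 ?_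
    obtain ⟨n, hn⟩ := (TopologicalSpace.denseRange_denseSeq (Lp ℂ 2 μ)).exists_dist_lt
      (mk (γ s) • w) (half_pos hε)
    refine ⟨n, ?_⟩
    change edist _ _ < _
    rw [edist_dist]
    exact (ENNReal.ofReal_lt_ofReal_iff (half_pos hε)).2 hn
  obtain ⟨n, hn⟩ : ∃ n, 0 < volume (E n) := by
    by_contra! hcon
    have : volume (⋃ n, E n) = 0 := measure_iUnion_null fun n => nonpos_iff_eq_zero.1 (hcon n)
    rw [hcover] at this
    simp at this
  filter_upwards [Measure.sub_mem_nhds_zero_of_addHaar_pos volume (E n) (hmeas n) hn] with s hs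
  obtain ⟨a, ha, b, hb, rfl⟩ := hs
  have hd : ∀ c ∈ E n, dist (mk (γ c) • w) (d n) < ε / 2 := by
    intro c hc
    change edist _ _ < _ at hc
    rw [edist_dist] at hc
    exact (ENNReal.ofReal_lt_ofReal_iff (half_pos hε)).1 hc
  calc dist (mk (γ (a - b)) • w) w
      = dist (mk (γ b) • mk (γ (a - b)) • w) (mk (γ b) • w) := (dist_smul _ _ _).symm
    _ = dist (mk (γ a) • w) (mk (γ b) • w) := by
        rw [smul_smul, ← mk_mul, ← hadd, sub_add_cancel]
    _ ≤ dist (mk (γ a) • w) (d n) + dist (mk (γ b) • w) (d n) := dist_triangle_right _ _ _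
    _ < ε := by linarith [hd a ha, hd b hb]

end Continuity

section MautnerL2

open DomMulAct

variable {X : Type u} [MeasurableSpace X] [StandardBorelSpace X] [MulAction PSL(2, ℝ) X]
  [MeasurableSMul₂ PSL(2, ℝ) X] {μ : Measure X} [IsProbabilityMeasure μ]
  [SMulInvariantMeasure PSL(2, ℝ) X μ]

/-- A square integrable function invariant under the horocycle flow agrees almost everywhere with
a strictly `PSL₂(ℝ)`-invariant function. -/
theorem aestronglyMeasurable_invariant_of_unip_smul_eq {w : Lp ℂ 2 μ}
    (hw : ∀ u : ℝ, mk (unip u) • w = w) :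
    AEStronglyMeasurable[invariantSigmaAlgebra PSL(2, ℝ) X] w μ := by
  have h := smul_eq_of_unip_smul_eq hw
    (tendsto_smul_Lp_of_measurable continuous_low.measurable low_add w)
  obtain ⟨f', hf', hww⟩ := exists_measurable_invariant_ae_eq (G := PSL(2, ℝ)) (μ := μ) (f := w)
    (Lp.stronglyMeasurable w).measurable (fun g => by
      have := smul_Lp_ae_eq (mk g) w
      rw [h g] at this
      filter_upwards [this] with x hx using hx.symm)
  exact ⟨f', hf'.stronglyMeasurable, hww⟩

/-- The closed span of the coboundaries of the horocycle flow in `L²` contains every function with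
vanishing ergodic mean, since its orthogonal complement consists of flow invariant functions,
which are `PSL₂(ℝ)`-invariant by the Mautner phenomenon. -/
theorem mem_closure_span_coboundaries {w : Lp ℂ 2 μ} (hw : ergodicMean PSL(2, ℝ) μ w =ᵐ[μ] 0) :
    w ∈ (Submodule.span ℂ
      {v : Lp ℂ 2 μ | ∃ (u : ℝ) (z : Lp ℂ 2 μ), v = mk (unip u) • z - z}).topologicalClosure := by
  set S := Submodule.span ℂ {v : Lp ℂ 2 μ | ∃ (u : ℝ) (z : Lp ℂ 2 μ), v = mk (unip u) • z - z}
  rw [← Submodule.orthogonal_orthogonal_eq_closure, Submodule.mem_orthogonal]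
  intro φ hφ
  have hinv : ∀ u : ℝ, mk (unip u) • φ = φ := by
    intro u
    have h0 := (Submodule.mem_orthogonal _ _).1 hφ _ (Submodule.subset_span ⟨u, φ, rfl⟩)
    rw [inner_sub_left, sub_eq_zero] at h0
    rw [← sub_eq_zero, ← norm_eq_zero, ← sq_eq_zero_iff, norm_sub_sq (𝕜 := ℂ), h0,
      norm_smul_Lp, inner_self_eq_norm_sq]
    ring
  have hm := aestronglyMeasurable_invariant_of_unip_smul_eq hinv
  have hle := invariantSigmaAlgebra_le PSL(2, ℝ) X
  rw [inner_eq_zero_symm, ← inner_condExpL2_eq_inner_fun (𝕜 := ℂ) hle w φ hm]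
  have h0 : (condExpL2 ℂ ℂ hle w : Lp ℂ 2 μ) = 0 := by
    have h1 := (Lp.memLp w).condExpL2_ae_eq_condExp (𝕜 := ℂ) hle
    rw [Lp.toLp_coeFn] at h1
    exact Lp.ext (h1.trans (hw.trans (Lp.coeFn_zero ℂ 2 μ).symm))
  rw [h0, inner_zero_left]

end MautnerL2

/-! ### The maximal ergodic theorem -/

section MaximalErgodic

variable {X : Type*}

/-- The maximal function of the ergodic averages of `f` along a transformation `T`. -/
def ergMax (T : X → X) (f : X → ℝ≥0∞) (x : X) : ℝ≥0∞ :=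
  ⨆ m : ℕ, (∑ j ∈ Finset.range (m + 1), f (T^[j] x)) / (m + 1 : ℕ)

/-- The iteration `M ↦ (f + M ∘ T) - c` with truncated subtraction. Its `n`-th term dominates the
excess of `∑ j < m, f ∘ T^j` over `m * c` for every `m ≤ n`. -/
def hopfIter (T : X → X) (f : X → ℝ≥0∞) (c : ℝ≥0∞) : ℕ → X → ℝ≥0∞
  | 0, _ => 0
  | n + 1, x => f x + hopfIter T f c n (T x) - c

theorem hopfIter_le_succ (T : X → X) (f : X → ℝ≥0∞) (c : ℝ≥0∞) (n : ℕ) (x : X) :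
    hopfIter T f c n x ≤ hopfIter T f c (n + 1) x := by
  induction n generalizing x with
  | zero => exact zero_le
  | succ n ih => exact tsub_le_tsub_right (by gcongr; exact ih _) _

theorem sum_sub_le_hopfIter (T : X → X) (f : X → ℝ≥0∞) (c : ℝ≥0∞) (n : ℕ) (x : X) :
    ∑ j ∈ Finset.range n, f (T^[j] x) - n * c ≤ hopfIter T f c n x := by
  induction n generalizing x with
  | zero => simp
  | succ n ih =>
    rw [Finset.sum_range_succ', Nat.cast_succ, add_one_mul, ← tsub_tsub]
    refine tsub_le_tsub_right ?_ _
    have := ih (T x)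
    rw [tsub_le_iff_right] at this ⊢
    simp only [Function.iterate_succ_apply, Function.iterate_zero_apply]
    rw [add_comm, add_assoc]
    gcongr

theorem ergMax_le_add_const {T : X → X} {f g : X → ℝ≥0∞} {c : ℝ≥0∞} (h : ∀ x, f x ≤ g x + c)
    (x : X) : ergMax T f x ≤ ergMax T g x + c := by
  refine iSup_le fun m => ?_
  calc (∑ j ∈ Finset.range (m + 1), f (T^[j] x)) / (m + 1 : ℕ)
      ≤ (∑ j ∈ Finset.range (m + 1), (g (T^[j] x) + c)) / (m + 1 : ℕ) := by
        gcongr; exact h _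
    _ = (∑ j ∈ Finset.range (m + 1), g (T^[j] x)) / (m + 1 : ℕ) + c := by
        rw [Finset.sum_add_distrib, Finset.sum_const, Finset.card_range, ENNReal.add_div,
          nsmul_eq_mul, mul_comm _ c, ENNReal.mul_div_cancel_right (by simp) (by simp)]
    _ ≤ ergMax T g x + c := by
        gcongr
        exact le_iSup (fun m : ℕ => (∑ j ∈ Finset.range (m + 1), g (T^[j] x)) / (m + 1 : ℕ)) m

variable [MeasurableSpace X] {μ : Measure X}

theorem measurable_hopfIter {T : X → X} (hT : Measurable T) {f : X → ℝ≥0∞} (hf : Measurable f)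
    (c : ℝ≥0∞) (n : ℕ) : Measurable (hopfIter T f c n) := by
  induction n with
  | zero => exact measurable_const
  | succ n ih => exact (hf.add (ih.comp hT)).sub measurable_const

theorem lintegral_hopfIter_ne_top {T : X → X} (hT : MeasurePreserving T μ μ) {f : X → ℝ≥0∞}
    (hf : Measurable f) (hfi : ∫⁻ x, f x ∂μ ≠ ∞) (c : ℝ≥0∞) (n : ℕ) :
    ∫⁻ x, hopfIter T f c n x ∂μ ≠ ∞ := by
  induction n with
  | zero => simp [hopfIter]
  | succ n ih =>
    refine ne_top_of_le_ne_top ?_ (lintegral_mono fun x => tsub_le_self)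
    rw [lintegral_add_left hf, hT.lintegral_comp (measurable_hopfIter hT.measurable hf c n)]
    exact ENNReal.add_ne_top.2 ⟨hfi, ih⟩

/-- Where the iterate is positive, the truncated subtraction is a genuine one, and integrating the
recursion gives the maximal inequality. -/
theorem mul_measure_hopfIter_pos_le {T : X → X} (hT : MeasurePreserving T μ μ) {f : X → ℝ≥0∞}
    (hf : Measurable f) (c : ℝ≥0∞) (n : ℕ) :
    c * μ {x | 0 < hopfIter T f c n x} ≤ ∫⁻ x, f x ∂μ := by
  by_cases hfi : ∫⁻ x, f x ∂μ = ∞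
  · simp [hfi]
  have hm := measurable_hopfIter hT.measurable hf c
  cases n with
  | zero => simp [hopfIter]
  | succ n =>
    have hs : MeasurableSet {x | 0 < hopfIter T f c (n + 1) x} :=
      measurableSet_lt measurable_const (hm _)
    have h1 : ∫⁻ x, hopfIter T f c (n + 1) x ∂μ + c * μ {x | 0 < hopfIter T f c (n + 1) x} ≤
        ∫⁻ x, hopfIter T f c (n + 1) x ∂μ + ∫⁻ x, f x ∂μ := by
      rw [← lintegral_indicator_const hs, ← lintegral_add_left (hm _)]
      calc ∫⁻ x, hopfIter T f c (n + 1) x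
            + ({x | 0 < hopfIter T f c (n + 1) x}.indicator (fun _ => c) x) ∂μ
          ≤ ∫⁻ x, f x + hopfIter T f c n (T x) ∂μ := by
            refine lintegral_mono fun x => ?_
            by_cases hx : 0 < hopfIter T f c (n + 1) x
            · rw [indicator_of_mem (show x ∈ {x | 0 < hopfIter T f c (n + 1) x} from hx)]
              exact (tsub_add_cancel_of_le (tsub_pos_iff_lt.1 hx).le).le
            · rw [indicator_of_notMem (show x ∉ {x | 0 < hopfIter T f c (n + 1) x} from hx),
                nonpos_iff_eq_zero.1 (not_lt.1 hx)]
              simp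
        _ = ∫⁻ x, f x ∂μ + ∫⁻ x, hopfIter T f c n x ∂μ := by
            rw [lintegral_add_left hf, hT.lintegral_comp (hm n)]
        _ ≤ ∫⁻ x, hopfIter T f c (n + 1) x ∂μ + ∫⁻ x, f x ∂μ := by
            rw [add_comm]
            gcongr
            exact hopfIter_le_succ T f c n _
    exact (ENNReal.add_le_add_iff_left (lintegral_hopfIter_ne_top hT hf hfi c _)).1 h1

theorem measurable_ergMax {T : X → X} (hT : Measurable T) {f : X → ℝ≥0∞} (hf : Measurable f) :
    Measurable (ergMax T f) :=
  Measurable.iSup fun _ => (Finset.measurable_sum _ fun j _ => hf.comp (hT.iterate j)).div_const _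

/-- The maximal ergodic theorem: where the maximal function exceeds `c`, one of the iterates
`hopfIter T f c n` is positive. -/
theorem mul_measure_lt_ergMax_le {T : X → X} (hT : MeasurePreserving T μ μ) {f : X → ℝ≥0∞}
    (hf : Measurable f) (c : ℝ≥0∞) :
    c * μ {x | c < ergMax T f x} ≤ ∫⁻ x, f x ∂μ := by
  have hsub : {x | c < ergMax T f x} ⊆ ⋃ n, {x | 0 < hopfIter T f c n x} := by
    intro x hx
    obtain ⟨m, hm⟩ := lt_iSup_iff.1 (show c < ergMax T f x from hx)
    refine mem_iUnion.2 ⟨m + 1, lt_of_lt_of_le ?_ (sum_sub_le_hopfIter T f c (m + 1) x)⟩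
    rw [ENNReal.lt_div_iff_mul_lt (by simp) (by simp)] at hm
    rwa [tsub_pos_iff_lt, mul_comm]
  have hmono : Monotone fun n => {x | 0 < hopfIter T f c n x} :=
    monotone_nat_of_le_succ fun n x hx => lt_of_lt_of_le hx (hopfIter_le_succ T f c n x)
  calc c * μ {x | c < ergMax T f x} ≤ c * μ (⋃ n, {x | 0 < hopfIter T f c n x}) := by gcongr
    _ = ⨆ n, c * μ {x | 0 < hopfIter T f c n x} := by
        rw [hmono.measure_iUnion, ENNReal.mul_iSup]
    _ ≤ ∫⁻ x, f x ∂μ := iSup_le fun n => mul_measure_hopfIter_pos_le hT hf c n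

end MaximalErgodic

/-! ### From weak type to strong type -/

section Interpolation

variable {X : Type*} [MeasurableSpace X] {μ : Measure X} [SFinite μ]

/-- The layer cake form of the Marcinkiewicz argument: the localized weak type inequality is
integrated over the level `c` against an arbitrary weight `w`. -/
theorem lintegral_weight_le {g : X → ℝ≥0∞} (hg : Measurable g) {f : X → ℝ} (hf : Measurable f)
    (hw : ∀ c : ℝ, 0 < c → μ {x | ENNReal.ofReal c < g x} ≤
      ENNReal.ofReal (2 / c) * ∫⁻ x in {x | c < 2 * f x}, ENNReal.ofReal (f x) ∂μ)
    {w : ℝ → ℝ≥0∞} (hwm : Measurable w) :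
    ∫⁻ x, (∫⁻ c in Ioi (0 : ℝ), {c | ENNReal.ofReal c < g x}.indicator w c) ∂μ ≤
      ∫⁻ x, ENNReal.ofReal (f x) *
        (∫⁻ c in Ioi (0 : ℝ), {c | c < 2 * f x}.indicator (fun c => ENNReal.ofReal (2 / c) * w c) c)
          ∂μ := by
  have hs1 : MeasurableSet {q : X × ℝ | ENNReal.ofReal q.2 < g q.1} :=
    measurableSet_lt (ENNReal.measurable_ofReal.comp measurable_snd) (hg.comp measurable_fst)
  have hs2 : MeasurableSet {q : X × ℝ | q.2 < 2 * f q.1} :=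
    measurableSet_lt measurable_snd ((hf.comp measurable_fst).const_mul 2)
  have hm1 : Measurable fun q : X × ℝ => {c | ENNReal.ofReal c < g q.1}.indicator w q.2 :=
    (hwm.comp measurable_snd).indicator hs1
  have hwm2 : Measurable fun c : ℝ => ENNReal.ofReal (2 / c) * w c :=
    (ENNReal.measurable_ofReal.comp (measurable_const.div measurable_id)).mul hwm
  have hm2 : Measurable fun q : X × ℝ =>
      {c | c < 2 * f q.1}.indicator (fun c => ENNReal.ofReal (2 / c) * w c) q.2 :=
    (hwm2.comp measurable_snd).indicator hs2
  have hf' : Measurable fun x => ENNReal.ofReal (f x) := ENNReal.measurable_ofReal.comp hf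
  rw [lintegral_lintegral_swap hm1.aemeasurable]
  calc ∫⁻ c in Ioi (0 : ℝ), ∫⁻ x, {c | ENNReal.ofReal c < g x}.indicator w c ∂μ
      ≤ ∫⁻ c in Ioi (0 : ℝ), ∫⁻ x, ENNReal.ofReal (f x) *
          {c | c < 2 * f x}.indicator (fun c => ENNReal.ofReal (2 / c) * w c) c ∂μ := by
        refine setLIntegral_mono_ae' measurableSet_Ioi (Eventually.of_forall fun c hc => ?_)
        have e1 : ∫⁻ x, {c | ENNReal.ofReal c < g x}.indicator w c ∂μ =
            w c * μ {x | ENNReal.ofReal c < g x} := by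
          rw [← lintegral_indicator_const (measurableSet_lt measurable_const hg)]
          rfl
        have e2 : ∫⁻ x, ENNReal.ofReal (f x) *
            {c | c < 2 * f x}.indicator (fun c => ENNReal.ofReal (2 / c) * w c) c ∂μ =
            (ENNReal.ofReal (2 / c) * w c) *
              ∫⁻ x in {x | c < 2 * f x}, ENNReal.ofReal (f x) ∂μ := by
          rw [← lintegral_indicator (measurableSet_lt measurable_const (hf.const_mul 2)),
            ← lintegral_const_mul _ (hf'.indicator
              (measurableSet_lt measurable_const (hf.const_mul 2)))]
          refine lintegral_congr fun x => ?_
          by_cases hx : c < 2 * f x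
          · rw [indicator_of_mem (show c ∈ {c | c < 2 * f x} from hx),
              indicator_of_mem (show x ∈ {x | c < 2 * f x} from hx), mul_comm]
          · rw [indicator_of_notMem (show c ∉ {c | c < 2 * f x} from hx),
              indicator_of_notMem (show x ∉ {x | c < 2 * f x} from hx), mul_zero, mul_zero]
        rw [e1, e2, mul_comm (ENNReal.ofReal _) (w c), mul_assoc]
        gcongr
        exact hw c hc
    _ = _ := by
        rw [lintegral_lintegral_swap]
        · refine lintegral_congr fun x => ?_
          rw [lintegral_const_mul]
          exact hm2.comp measurable_prodMk_left
        · exact ((hf'.comp measurable_snd).mul (hm2.comp measurable_swap)).aemeasurable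

/-- The localized weak type inequality implies the strong type inequality in `L^p`, `p > 1`, by
integration against the weight `p * c ^ (p - 1)`. -/
theorem lintegral_rpow_le_of_weak_type {g : X → ℝ≥0∞} (hg : Measurable g) {f : X → ℝ}
    (hf : Measurable f) (hf0 : ∀ x, 0 ≤ f x)
    (hw : ∀ c : ℝ, 0 < c → μ {x | ENNReal.ofReal c < g x} ≤
      ENNReal.ofReal (2 / c) * ∫⁻ x in {x | c < 2 * f x}, ENNReal.ofReal (f x) ∂μ)
    {p : ℝ} (hp : 1 < p) :
    ∫⁻ x, g x ^ p ∂μ ≤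
      ENNReal.ofReal (2 ^ p * p / (p - 1)) * ∫⁻ x, ENNReal.ofReal (f x) ^ p ∂μ := by
  have hp0 : 0 < p := by linarith
  have hp1 : 0 < p - 1 := by linarith
  have hwm : Measurable fun c : ℝ => ENNReal.ofReal (p * c ^ (p - 1)) := by fun_prop
  have hint : ∀ b : ℝ, 0 ≤ b → ∀ q : ℝ, -1 < q → ∀ k : ℝ, 0 ≤ k →
      ∫⁻ c in Ioo 0 b, ENNReal.ofReal (k * c ^ q) = ENNReal.ofReal (k * b ^ (q + 1) / (q + 1)) := by
    intro b hb q hq k hk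
    rw [← ofReal_integral_eq_lintegral_ofReal, ← integral_Ioc_eq_integral_Ioo,
      ← intervalIntegral.integral_of_le hb, intervalIntegral.integral_const_mul,
      integral_rpow (Or.inl hq), Real.zero_rpow (by linarith), sub_zero, mul_div_assoc]
    · have h := ((intervalIntegral.intervalIntegrable_rpow' (a := 0) (b := b) hq).const_mul k).1
      exact h.mono_set Ioo_subset_Ioc_self
    · refine (ae_restrict_mem measurableSet_Ioo).mono fun c hc => ?_
      exact mul_nonneg hk (Real.rpow_nonneg hc.1.le _)
  have hrestr : ∀ (b : ℝ) (u : ℝ → ℝ≥0∞),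
      ∫⁻ c in Ioi (0 : ℝ), {c | c < b}.indicator u c = ∫⁻ c in Ioo 0 b, u c := by
    intro b u
    have hb : MeasurableSet {c : ℝ | c < b} := measurableSet_Iio
    rw [lintegral_indicator hb, Measure.restrict_restrict hb, inter_comm]
    rfl
  -- the value `a = ∞` is allowed, so the layer cake formula is proved for finite minorants of `a`
  have h1 : ∀ a : ℝ≥0∞, a ^ p ≤ ∫⁻ c in Ioi (0 : ℝ),
      {c | ENNReal.ofReal c < a}.indicator (fun c => ENNReal.ofReal (p * c ^ (p - 1))) c := by
    have hfin : ∀ (b : ℝ≥0) (a : ℝ≥0∞), (b : ℝ≥0∞) ≤ a → (b : ℝ≥0∞) ^ p ≤ ∫⁻ c in Ioi (0 : ℝ),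
        {c | ENNReal.ofReal c < a}.indicator (fun c => ENNReal.ofReal (p * c ^ (p - 1))) c := by
      intro b a hba
      rcases eq_zero_or_pos b with rfl | hb0
      · simp [ENNReal.zero_rpow_of_pos hp0]
      calc (b : ℝ≥0∞) ^ p = ∫⁻ c in Ioo 0 (b : ℝ), ENNReal.ofReal (p * c ^ (p - 1)) := by
            rw [hint b b.2 _ (by linarith) p hp0.le, sub_add_cancel, mul_div_cancel_left₀ _ hp0.ne',
              ← ENNReal.ofReal_coe_nnreal, ENNReal.ofReal_rpow_of_nonneg b.coe_nonneg hp0.le]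
        _ = ∫⁻ c in Ioi (0 : ℝ),
            {c | c < (b : ℝ)}.indicator (fun c => ENNReal.ofReal (p * c ^ (p - 1))) c :=
            (hrestr _ _).symm
        _ ≤ _ := by
            refine lintegral_mono fun c => indicator_le_indicator_of_subset ?_ (fun _ => zero_le) c
            intro c hc
            refine lt_of_lt_of_le ?_ hba
            rw [← ENNReal.ofReal_coe_nnreal]
            exact (ENNReal.ofReal_lt_ofReal_iff (NNReal.coe_pos.2 hb0)).2 hc
    intro a
    induction a with
    | top =>
      rw [ENNReal.top_rpow_of_pos hp0, top_le_iff]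
      refine ENNReal.eq_top_of_forall_nnreal_le fun r => ?_
      refine le_trans ?_ (hfin (r ^ (1 / p)) ∞ le_top)
      rw [← ENNReal.coe_rpow_of_nonneg _ hp0.le, ← NNReal.rpow_mul, one_div,
        inv_mul_cancel₀ hp0.ne', NNReal.rpow_one]
    | coe b => exact hfin b b le_rfl
  have h2 : ∀ a : ℝ, 0 ≤ a → ENNReal.ofReal a * ∫⁻ c in Ioi (0 : ℝ), {c | c < 2 * a}.indicator
      (fun c => ENNReal.ofReal (2 / c) * ENNReal.ofReal (p * c ^ (p - 1))) c =
      ENNReal.ofReal (2 ^ p * p / (p - 1)) * ENNReal.ofReal a ^ p := by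
    intro a ha
    have h : ∫⁻ c in Ioo 0 (2 * a), ENNReal.ofReal (2 / c) * ENNReal.ofReal (p * c ^ (p - 1)) =
        ∫⁻ c in Ioo 0 (2 * a), ENNReal.ofReal (2 * p * c ^ (p - 2)) := by
      refine setLIntegral_congr_fun measurableSet_Ioo fun c hc => ?_
      rw [← ENNReal.ofReal_mul (by have := hc.1; positivity)]
      congr 1
      rw [show p - 1 = (p - 2) + 1 by ring, Real.rpow_add_one hc.1.ne']
      have := hc.1.ne'
      field_simp
    rw [hrestr, h, hint _ (by positivity) _ (by linarith) _ (by positivity),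
      ENNReal.ofReal_rpow_of_nonneg ha hp0.le, ← ENNReal.ofReal_mul ha,
      ← ENNReal.ofReal_mul (by positivity)]
    congr 1
    rw [show p - 2 + 1 = p - 1 by ring, Real.mul_rpow two_pos.le ha]
    rcases ha.eq_or_lt with rfl | ha
    · rw [Real.zero_rpow hp0.ne']; simp
    · have e1 : (2 : ℝ) ^ p = 2 ^ (p - 1) * 2 := by
        rw [← Real.rpow_add_one two_ne_zero, sub_add_cancel]
      have e2 : a ^ p = a ^ (p - 1) * a := by rw [← Real.rpow_add_one ha.ne', sub_add_cancel]
      rw [e1, e2]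
      ring
  calc ∫⁻ x, g x ^ p ∂μ ≤ _ := lintegral_mono fun x => h1 (g x)
    _ ≤ _ := lintegral_weight_le hg hf hw hwm
    _ = ∫⁻ x, ENNReal.ofReal (2 ^ p * p / (p - 1)) * ENNReal.ofReal (f x) ^ p ∂μ :=
        lintegral_congr fun x => h2 (f x) (hf0 x)
    _ = _ := lintegral_const_mul _ ((ENNReal.measurable_ofReal.comp hf).pow_const p)

/-- The localized weak type inequality implies the `L log L` maximal inequality, by integration
over the levels `c > 1`. -/
theorem lintegral_le_of_weak_type [IsProbabilityMeasure μ] {g : X → ℝ≥0∞} (hg : Measurable g)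
    {f : X → ℝ} (hf : Measurable f) (hf0 : ∀ x, 0 ≤ f x)
    (hw : ∀ c : ℝ, 0 < c → μ {x | ENNReal.ofReal c < g x} ≤
      ENNReal.ofReal (2 / c) * ∫⁻ x in {x | c < 2 * f x}, ENNReal.ofReal (f x) ∂μ) :
    ∫⁻ x, g x ∂μ ≤ 7 * (1 + ∫⁻ x, ENNReal.ofReal (f x * Real.log (max (f x) 1)) ∂μ) := by
  set w : ℝ → ℝ≥0∞ := (Ioi 1).indicator fun _ => 1 with hwdef
  have hwm : Measurable w := measurable_const.indicator measurableSet_Ioi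
  have hsub : ∀ b : ℝ, Ioo 1 b ∩ Ioi 0 = Ioo 1 b := fun b =>
    inter_eq_left.2 (Ioo_subset_Ioi_self.trans (Ioi_subset_Ioi zero_le_one))
  have h1 : ∀ a : ℝ≥0∞, a ≤ 1 + ∫⁻ c in Ioi (0 : ℝ), {c | ENNReal.ofReal c < a}.indicator w c := by
    have hfin : ∀ (b : ℝ≥0) (a : ℝ≥0∞), (b : ℝ≥0∞) ≤ a → (b : ℝ≥0∞) ≤ 1 + ∫⁻ c in Ioi (0 : ℝ),
        {c | ENNReal.ofReal c < a}.indicator w c := by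
      intro b a hba
      have h : ∫⁻ c in Ioi (0 : ℝ), (Ioo 1 (b : ℝ)).indicator (fun _ => (1 : ℝ≥0∞)) c ≤
          ∫⁻ c in Ioi (0 : ℝ), {c | ENNReal.ofReal c < a}.indicator w c := by
        refine lintegral_mono fun c => ?_
        by_cases hc : c ∈ Ioo 1 (b : ℝ)
        · have hca : ENNReal.ofReal c < a := by
            refine lt_of_lt_of_le ?_ hba
            rw [← ENNReal.ofReal_coe_nnreal]
            exact (ENNReal.ofReal_lt_ofReal_iff (by linarith [hc.1, hc.2])).2 hc.2
          rw [indicator_of_mem hc, indicator_of_mem (show c ∈ {c | ENNReal.ofReal c < a} from hca),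
            hwdef, indicator_of_mem (show c ∈ Ioi (1 : ℝ) from hc.1)]
        · rw [indicator_of_notMem hc]
          exact zero_le
      refine le_trans ?_ (add_le_add_right h 1)
      rw [lintegral_indicator measurableSet_Ioo, Measure.restrict_restrict measurableSet_Ioo,
        hsub, setLIntegral_one, Real.volume_Ioo,
        ← ENNReal.ofReal_one, ← ENNReal.ofReal_coe_nnreal]
      refine le_trans (ENNReal.ofReal_le_ofReal (by linarith)) (ENNReal.ofReal_add_le (p := 1))
    intro a
    induction a with
    | top =>
      rw [top_le_iff]
      exact ENNReal.eq_top_of_forall_nnreal_le fun r => hfin r ∞ le_top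
    | coe b => exact hfin b b le_rfl
  have h2 : ∀ a : ℝ, 0 ≤ a → ENNReal.ofReal a * ∫⁻ c in Ioi (0 : ℝ), {c | c < 2 * a}.indicator
      (fun c => ENNReal.ofReal (2 / c) * w c) c ≤
      ENNReal.ofReal (6 + 4 * (a * Real.log (max a 1))) := by
    intro a ha
    have hL : 0 ≤ Real.log (max a 1) := Real.log_nonneg (le_max_right _ _)
    have heq : ∫⁻ c in Ioi (0 : ℝ), {c | c < 2 * a}.indicator
        (fun c => ENNReal.ofReal (2 / c) * w c) c = ∫⁻ c in Ioo 1 (2 * a), ENNReal.ofReal (2 / c) := by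
      have : (fun c => {c | c < 2 * a}.indicator (fun c => ENNReal.ofReal (2 / c) * w c) c) =
          (Ioo 1 (2 * a)).indicator fun c => ENNReal.ofReal (2 / c) := by
        funext c
        by_cases h3 : c < 2 * a <;> by_cases h4 : 1 < c <;> simp [indicator, hwdef, h3, h4]
      rw [this, lintegral_indicator measurableSet_Ioo, Measure.restrict_restrict measurableSet_Ioo,
        hsub]
    rw [heq]
    by_cases h5 : 1 < 2 * a
    · have hint : ∫⁻ c in Ioo 1 (2 * a), ENNReal.ofReal (2 / c) =
          ENNReal.ofReal (2 * Real.log (2 * a)) := by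
        have hii : IntervalIntegrable (fun c : ℝ => 2 / c) volume 1 (2 * a) := by
          refine ContinuousOn.intervalIntegrable fun c hc => ?_
          rw [uIcc_of_le h5.le] at hc
          exact (continuousAt_const.div continuousAt_id
            (by linarith [hc.1] : (c : ℝ) ≠ 0)).continuousWithinAt
        rw [← ofReal_integral_eq_lintegral_ofReal, ← integral_Ioc_eq_integral_Ioo,
          ← intervalIntegral.integral_of_le h5.le]
        · congr 1
          simp_rw [div_eq_mul_inv (2 : ℝ)]
          rw [intervalIntegral.integral_const_mul, integral_inv_of_pos one_pos (by linarith), div_one]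
        · exact hii.1.mono_set Ioo_subset_Ioc_self
        · refine (ae_restrict_mem measurableSet_Ioo).mono fun c hc => ?_
          have := hc.1
          simp only [Pi.zero_apply]
          positivity
      rw [hint, ← ENNReal.ofReal_mul ha]
      refine ENNReal.ofReal_le_ofReal ?_
      have ha0 : 0 < a := by linarith
      have h6 : Real.log (2 * a) ≤ Real.log 2 + Real.log (max a 1) := by
        rw [Real.log_mul two_ne_zero ha0.ne']
        gcongr
        exact le_max_left _ _
      have h7 : a ≤ Real.exp 1 + a * Real.log (max a 1) := by
        rcases le_total a (Real.exp 1) with h | h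
        · nlinarith [mul_nonneg ha hL]
        · have : 1 ≤ Real.log (max a 1) := by
            rw [Real.le_log_iff_exp_le (by positivity)]
            exact h.trans (le_max_left _ _)
          nlinarith [Real.exp_pos 1]
      have h8 := Real.log_two_lt_d9
      have h9 := Real.exp_one_lt_d9
      have h10 : a * Real.log (2 * a) ≤ a * Real.log 2 + a * Real.log (max a 1) := by nlinarith
      have h11 : a * Real.log 2 ≤ 0.6931471808 * a := by nlinarith
      nlinarith [mul_nonneg ha hL]
    · rw [Ioo_eq_empty (fun h => h5 h)]
      simp
  calc ∫⁻ x, g x ∂μ ≤ ∫⁻ x, (1 + ∫⁻ c in Ioi (0 : ℝ),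
        {c | ENNReal.ofReal c < g x}.indicator w c) ∂μ := lintegral_mono fun x => h1 (g x)
    _ = 1 + ∫⁻ x, (∫⁻ c in Ioi (0 : ℝ), {c | ENNReal.ofReal c < g x}.indicator w c) ∂μ := by
        rw [lintegral_add_left measurable_const]; simp
    _ ≤ 1 + ∫⁻ x, ENNReal.ofReal (6 + 4 * (f x * Real.log (max (f x) 1))) ∂μ := by
        exact add_le_add le_rfl ((lintegral_weight_le hg hf hw hwm).trans
          (lintegral_mono fun x => h2 (f x) (hf0 x)))
    _ = 1 + (6 + 4 * ∫⁻ x, ENNReal.ofReal (f x * Real.log (max (f x) 1)) ∂μ) := by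
        congr 1
        rw [← lintegral_const_mul _ (by fun_prop)]
        have h6 : ∫⁻ _, (6 : ℝ≥0∞) ∂μ = 6 := by simp
        rw [← h6, ← lintegral_add_left measurable_const]
        refine lintegral_congr fun x => ?_
        have : 0 ≤ f x * Real.log (max (f x) 1) :=
          mul_nonneg (hf0 x) (Real.log_nonneg (le_max_right _ _))
        rw [ENNReal.ofReal_add (by norm_num) (by positivity), ENNReal.ofReal_mul (by norm_num)]
        simp
    _ ≤ _ := by
        rw [mul_add, mul_one, ← add_assoc]
        norm_num
        gcongr
        norm_num

end Interpolation

/-! ### Shells of radii and of horocycle times -/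

section Shells

/-- The probability measure with density proportional to `sinh` on `[r, r + ε]`. -/
def shellTime (r ε : ℝ) : Measure ℝ :=
  (∫⁻ t in Icc r (r + ε), ENNReal.ofReal (Real.sinh t))⁻¹ •
    (volume.restrict (Icc r (r + ε))).withDensity (fun t => ENNReal.ofReal (Real.sinh t))

theorem shellMeasure_eq_map (r ε : ℝ) : shellMeasure r ε = (shellTime r ε).map diagElt := by
  rw [shellMeasure, shellTime, Measure.map_smul]

/-- The time `u ≥ 0` at which the horocycle element `n_u` has Cartan component `a_t`. -/
def horoTime (t : ℝ) : ℝ := 2 * Real.sinh (t / 2)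

theorem continuous_horoTime : Continuous horoTime := by unfold horoTime; fun_prop

theorem strictMono_horoTime : StrictMono horoTime := fun s t h => by
  have := Real.sinh_strictMono (show s / 2 < t / 2 by linarith)
  unfold horoTime; linarith

theorem horoTime_zero : horoTime 0 = 0 := by simp [horoTime]

theorem horoTime_pos {t : ℝ} (ht : 0 < t) : 0 < horoTime t := by
  rw [← horoTime_zero]; exact strictMono_horoTime ht

theorem tendsto_horoTime : Tendsto horoTime atTop atTop := by
  refine tendsto_atTop_mono' _ ?_ tendsto_id
  filter_upwards [eventually_ge_atTop 0] with t ht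
  have := Real.self_le_sinh_iff.2 (show 0 ≤ t / 2 by linarith)
  simp only [horoTime, id]
  linarith

/-- The mass `(b² - a²) / 2` of `u du` on the shell `[a, b]` of horocycle times is at least a fixed
fraction of `b²`, uniformly in the radius: this is where `ε > 0` enters. -/
theorem mul_sq_horoTime_le {r ε : ℝ} (hr : 0 ≤ r) (hε : 0 ≤ ε) :
    (1 - Real.exp (-ε)) * horoTime (r + ε) ^ 2 ≤ horoTime (r + ε) ^ 2 - horoTime r ^ 2 := by
  have h1 : horoTime r ≤ Real.exp (-ε / 2) * horoTime (r + ε) := by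
    have e1 : Real.exp (-ε / 2) * Real.exp ((r + ε) / 2) = Real.exp (r / 2) := by
      rw [← Real.exp_add]; ring_nf
    have e2 : Real.exp (-ε / 2) * Real.exp (-((r + ε) / 2)) = Real.exp (-(r / 2) - ε) := by
      rw [← Real.exp_add]; ring_nf
    have e3 : Real.exp (-(r / 2) - ε) ≤ Real.exp (-(r / 2)) := Real.exp_le_exp.2 (by linarith)
    simp only [horoTime, Real.sinh_eq]
    linarith
  have h0 : 0 ≤ horoTime r := by
    rw [← horoTime_zero]; exact strictMono_horoTime.monotone hr
  have h2 : horoTime r ^ 2 ≤ (Real.exp (-ε / 2) * horoTime (r + ε)) ^ 2 := by gcongr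
  have h3 : Real.exp (-ε / 2) ^ 2 = Real.exp (-ε) := by
    rw [← Real.exp_nat_mul]; ring_nf
  rw [mul_pow, h3] at h2
  linarith

theorem horoTime_sq_lt {r ε : ℝ} (hr : 0 ≤ r) (hε : 0 < ε) :
    horoTime r ^ 2 < horoTime (r + ε) ^ 2 := by
  have h0 : 0 ≤ horoTime r := by
    rw [← horoTime_zero]; exact strictMono_horoTime.monotone hr
  have := strictMono_horoTime (show r < r + ε by linarith)
  gcongr

/-- The substitution `u = 2 sinh (t / 2)` turns `sinh t dt` into `u du`. -/
theorem setLIntegral_sinh_comp_horoTime {r ε : ℝ} (hε : 0 ≤ ε) (h : ℝ → ℝ≥0∞) :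
    ∫⁻ t in Icc r (r + ε), ENNReal.ofReal (Real.sinh t) * h (horoTime t) =
      ∫⁻ u in Icc (horoTime r) (horoTime (r + ε)), ENNReal.ofReal u * h u := by
  have him : horoTime '' Icc r (r + ε) = Icc (horoTime r) (horoTime (r + ε)) :=
    continuous_horoTime.continuousOn.image_Icc_of_monotoneOn (by linarith)
      (strictMono_horoTime.monotone.monotoneOn _)
  rw [← him, lintegral_image_eq_lintegral_deriv_mul_of_monotoneOn (f' := fun t => Real.cosh (t / 2))
    measurableSet_Icc _ (strictMono_horoTime.monotone.monotoneOn _)]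
  · refine setLIntegral_congr_fun measurableSet_Icc fun t ht => ?_
    have h2 : Real.sinh t = Real.cosh (t / 2) * horoTime t := by
      conv_lhs => rw [← mul_div_cancel₀ t (two_ne_zero (α := ℝ)), Real.sinh_two_mul]
      unfold horoTime; ring
    rw [h2, ENNReal.ofReal_mul (Real.cosh_pos _).le, mul_assoc]
  · intro t _
    have h1 : HasDerivAt (fun t : ℝ => t / 2) (1 / 2) t := (hasDerivAt_id t).div_const 2
    have h2 := ((Real.hasDerivAt_sinh (t / 2)).comp t h1).const_mul 2
    have h3 : 2 * (Real.cosh (t / 2) * (1 / 2)) = Real.cosh (t / 2) := by ring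
    rw [h3] at h2
    exact h2.hasDerivWithinAt

theorem setLIntegral_id {a b : ℝ} (ha : 0 ≤ a) (hab : a ≤ b) :
    ∫⁻ u in Icc a b, ENNReal.ofReal u = ENNReal.ofReal ((b ^ 2 - a ^ 2) / 2) := by
  rw [← ofReal_integral_eq_lintegral_ofReal, integral_Icc_eq_integral_Ioc,
    ← intervalIntegral.integral_of_le hab, integral_id]
  · exact continuous_id.integrableOn_Icc
  · exact (ae_restrict_mem measurableSet_Icc).mono fun c hc => ha.trans hc.1

theorem shellMass_eq {r ε : ℝ} (hr : 0 ≤ r) (hε : 0 ≤ ε) :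
    ∫⁻ t in Icc r (r + ε), ENNReal.ofReal (Real.sinh t) =
      ENNReal.ofReal ((horoTime (r + ε) ^ 2 - horoTime r ^ 2) / 2) := by
  have h := setLIntegral_sinh_comp_horoTime (r := r) hε fun _ => 1
  simp only [mul_one] at h
  rw [h, setLIntegral_id (by rw [← horoTime_zero]; exact strictMono_horoTime.monotone hr)
    (strictMono_horoTime.monotone (by linarith))]

theorem isProbabilityMeasure_shellTime {r ε : ℝ} (hr : 0 ≤ r) (hε : 0 < ε) :
    IsProbabilityMeasure (shellTime r ε) := by
  constructor
  have h0 := horoTime_sq_lt hr hε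
  rw [shellTime, Measure.smul_apply, withDensity_apply _ MeasurableSet.univ, Measure.restrict_univ,
    smul_eq_mul, ENNReal.inv_mul_cancel]
  · rw [shellMass_eq hr hε.le]
    exact (ENNReal.ofReal_pos.2 (by linarith)).ne'
  · rw [shellMass_eq hr hε.le]
    exact ENNReal.ofReal_ne_top

instance (r ε : ℝ) : SFinite (shellTime r ε) := by unfold shellTime; infer_instance

theorem ae_shellTime_mem (r ε : ℝ) : ∀ᵐ t ∂(shellTime r ε), t ∈ Icc r (r + ε) := by
  have h : shellTime r ε ≪ volume.restrict (Icc r (r + ε)) :=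
    (withDensity_absolutelyContinuous _ _).smul_left _
  exact h.ae_le (ae_restrict_mem measurableSet_Icc)

/-- The distribution of the horocycle time in a shell: the probability measure with density
proportional to `u` on `[horoTime r, horoTime (r + ε)]`. -/
def horoShell (r ε : ℝ) : Measure ℝ := (shellTime r ε).map horoTime

instance (r ε : ℝ) : SFinite (horoShell r ε) := by unfold horoShell; infer_instance

theorem isProbabilityMeasure_horoShell {r ε : ℝ} (hr : 0 ≤ r) (hε : 0 < ε) :
    IsProbabilityMeasure (horoShell r ε) := by
  have := isProbabilityMeasure_shellTime hr hε
  exact Measure.isProbabilityMeasure_map continuous_horoTime.measurable.aemeasurable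

theorem lintegral_shellTime (r ε : ℝ) {h : ℝ → ℝ≥0∞} (hh : Measurable h) :
    ∫⁻ t, h t ∂(shellTime r ε) = (∫⁻ t in Icc r (r + ε), ENNReal.ofReal (Real.sinh t))⁻¹ *
      ∫⁻ t in Icc r (r + ε), ENNReal.ofReal (Real.sinh t) * h t := by
  have hm : Measurable fun t => ENNReal.ofReal (Real.sinh t) := by fun_prop
  rw [shellTime, lintegral_smul_measure, lintegral_withDensity_eq_lintegral_mul _ hm hh]
  rfl

theorem lintegral_horoShell {r ε : ℝ} (hr : 0 ≤ r) (hε : 0 ≤ ε) {h : ℝ → ℝ≥0∞}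
    (hh : Measurable h) :
    ∫⁻ u, h u ∂(horoShell r ε) =
      (ENNReal.ofReal ((horoTime (r + ε) ^ 2 - horoTime r ^ 2) / 2))⁻¹ *
        ∫⁻ u in Icc (horoTime r) (horoTime (r + ε)), ENNReal.ofReal u * h u := by
  rw [horoShell, lintegral_map hh continuous_horoTime.measurable,
    lintegral_shellTime (h := fun t => h (horoTime t)) _ _
      (hh.comp continuous_horoTime.measurable), shellMass_eq hr hε]
  congr 1
  exact setLIntegral_sinh_comp_horoTime hε h

theorem horoShell_eq {r ε : ℝ} (hr : 0 ≤ r) (hε : 0 ≤ ε) :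
    horoShell r ε = (ENNReal.ofReal ((horoTime (r + ε) ^ 2 - horoTime r ^ 2) / 2))⁻¹ •
      (volume.restrict (Icc (horoTime r) (horoTime (r + ε)))).withDensity
        (fun u => ENNReal.ofReal u) := by
  refine Measure.ext_of_lintegral _ fun h hh => ?_
  rw [lintegral_horoShell hr hε hh, lintegral_smul_measure,
    lintegral_withDensity_eq_lintegral_mul _ ENNReal.measurable_ofReal hh]
  rfl

theorem integral_horoShell {r ε : ℝ} (hr : 0 ≤ r) (hε : 0 < ε) (h : ℝ → ℂ) :
    ∫ u, h u ∂(horoShell r ε) = (((horoTime (r + ε) ^ 2 - horoTime r ^ 2) / 2)⁻¹ : ℝ) •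
        ∫ u in (horoTime r)..(horoTime (r + ε)), u • h u := by
  have h0 : 0 ≤ horoTime r := by
    rw [← horoTime_zero]; exact strictMono_horoTime.monotone hr
  have h1 := horoTime_sq_lt hr hε
  rw [horoShell_eq hr hε.le, integral_smul_measure,
    integral_withDensity_eq_integral_toReal_smul ENNReal.measurable_ofReal
      (Eventually.of_forall fun _ => ENNReal.ofReal_lt_top), ENNReal.toReal_inv,
    ENNReal.toReal_ofReal (by linarith), integral_Icc_eq_integral_Ioc,
    ← intervalIntegral.integral_of_le (strictMono_horoTime.monotone (by linarith))]
  congr 1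
  refine intervalIntegral.integral_congr fun u hu => ?_
  rw [uIcc_of_le (strictMono_horoTime.monotone (by linarith))] at hu
  rw [ENNReal.toReal_ofReal (h0.trans hu.1)]

/-- The density of a shell of horocycle times with outer radius `b` is at most a constant over `b`,
so averages over shells are dominated by averages over `[0, b]`. -/
theorem lintegral_horoShell_le {r ε : ℝ} (hr : 0 < r) (hε : 0 < ε) {h : ℝ → ℝ≥0∞}
    (hh : Measurable h) :
    ∫⁻ u, h u ∂(horoShell r ε) ≤ ENNReal.ofReal (2 / ((1 - Real.exp (-ε)) * horoTime (r + ε))) *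
      ∫⁻ u in Icc 0 (horoTime (r + ε)), h u := by
  have h0 := horoTime_pos hr
  have h1 := horoTime_sq_lt hr.le hε
  have h2 := mul_sq_horoTime_le hr.le hε.le
  have hb := horoTime_pos (show 0 < r + ε by linarith)
  have he : 0 < 1 - Real.exp (-ε) := by
    have := Real.exp_lt_one_iff.2 (show -ε < 0 by linarith)
    linarith
  rw [lintegral_horoShell hr.le hε.le hh, ← ENNReal.ofReal_inv_of_pos (by linarith)]
  calc ENNReal.ofReal ((horoTime (r + ε) ^ 2 - horoTime r ^ 2) / 2)⁻¹ *
        ∫⁻ u in Icc (horoTime r) (horoTime (r + ε)), ENNReal.ofReal u * h u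
      ≤ ENNReal.ofReal ((horoTime (r + ε) ^ 2 - horoTime r ^ 2) / 2)⁻¹ *
        (ENNReal.ofReal (horoTime (r + ε)) * ∫⁻ u in Icc 0 (horoTime (r + ε)), h u) := by
        gcongr
        rw [← lintegral_const_mul _ hh]
        refine (setLIntegral_mono' measurableSet_Icc fun u hu => ?_).trans
          (lintegral_mono_set (Icc_subset_Icc_left h0.le))
        gcongr
        exact hu.2
    _ ≤ _ := by
        rw [← mul_assoc, ← ENNReal.ofReal_mul (by rw [inv_nonneg]; linarith)]
        gcongr
        rw [inv_div, div_mul_eq_mul_div, div_le_div_iff₀ (by linarith) (by positivity)]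
        nlinarith

/-- Averages over shells of horocycle times are asymptotically translation invariant on bounded
functions: the shift changes `∫ u • h u` by `O(b)` only, while the mass of the shell is of order
`b ^ 2`, where `b` is the outer radius. -/
theorem tendsto_integral_horoShell_sub_shift {ε : ℝ} (hε : 0 < ε) {h : ℝ → ℂ} (hh : Measurable h)
    {M : ℝ} (hM : ∀ u, ‖h u‖ ≤ M) (s : ℝ) :
    Tendsto (fun r => ∫ u, (h u - h (u + s)) ∂(horoShell r ε)) atTop (𝓝 0) := by
  have he : 0 < 1 - Real.exp (-ε) := by
    have := Real.exp_lt_one_iff.2 (show -ε < 0 by linarith)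
    linarith
  have hM0 : 0 ≤ M := (norm_nonneg _).trans (hM 0)
  have hbd : ∀ᶠ r in atTop, ‖∫ u, (h u - h (u + s)) ∂(horoShell r ε)‖ ≤
      2 * M * |s| / (1 - Real.exp (-ε)) *
        (3 * (horoTime (r + ε))⁻¹ + 2 * |s| * (horoTime (r + ε))⁻¹ ^ 2) := by
    filter_upwards [eventually_gt_atTop 0] with r hr
    set a := horoTime r with ha
    set b := horoTime (r + ε) with hb
    have ha0 : 0 < a := horoTime_pos hr
    have hb0 : 0 < b := horoTime_pos (show 0 < r + ε by linarith)
    have hab : a ≤ b := strictMono_horoTime.monotone (by linarith)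
    have h1 : a ^ 2 < b ^ 2 := horoTime_sq_lt hr.le hε
    have h2 : (1 - Real.exp (-ε)) * b ^ 2 ≤ b ^ 2 - a ^ 2 := mul_sq_horoTime_le hr.le hε.le
    have hint : ∀ c d : ℝ, IntervalIntegrable h volume c d := fun c d =>
      (intervalIntegrable_const (c := M)).mono_fun' hh.aestronglyMeasurable
        (Eventually.of_forall hM)
    have hint2 : ∀ c d : ℝ, IntervalIntegrable (fun u => u • h u) volume c d := fun c d =>
      (hint c d).continuousOn_smul continuousOn_id
    have hint3 : ∀ c d : ℝ, IntervalIntegrable (fun u => s • h u) volume c d := fun c d =>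
      (hint c d).smul s
    have hint' : ∀ c d : ℝ, IntervalIntegrable (fun u => h (u + s)) volume c d := fun c d =>
      (intervalIntegrable_const (c := M)).mono_fun'
        (hh.comp (measurable_id.add_const s)).aestronglyMeasurable
        (Eventually.of_forall fun u => hM (u + s))
    have hint2' : ∀ c d : ℝ, IntervalIntegrable (fun u => u • h (u + s)) volume c d := fun c d =>
      (hint' c d).continuousOn_smul continuousOn_id
    have e1 : ∫ u in a..b, u • (h u - h (u + s)) =
        (∫ u in a..(a + s), u • h u) - (∫ u in b..(b + s), u • h u)
          + s • ∫ u in (a + s)..(b + s), h u := by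
      have e2 : ∫ u in a..b, u • h (u + s) =
          (∫ u in (a + s)..(b + s), u • h u) - s • ∫ u in (a + s)..(b + s), h u := by
        rw [← intervalIntegral.integral_smul, ← intervalIntegral.integral_sub (hint2 _ _)
          (hint3 _ _), ← intervalIntegral.integral_comp_add_right
            (fun u => u • h u - s • h u) s]
        refine intervalIntegral.integral_congr fun u _ => ?_
        simp only [← sub_smul, add_sub_cancel_right]
      simp only [smul_sub]
      rw [intervalIntegral.integral_sub (hint2 _ _) (hint2' _ _), e2,
        ← intervalIntegral.integral_interval_sub_interval_comm (hint2 _ _) (hint2 _ _) (hint2 _ _)]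
      abel
    have hn : ∀ c : ℝ, 0 ≤ c → ‖∫ u in c..(c + s), u • h u‖ ≤ (c + |s|) * M * |s| := by
      intro c hc
      have := intervalIntegral.norm_integral_le_of_norm_le_const (a := c) (b := c + s)
        (f := fun u => u • h u) (C := (c + |s|) * M) (fun u hu => by
          rw [norm_smul, Real.norm_eq_abs]
          gcongr
          · have h3 := abs_sub_left_of_mem_uIcc (uIoc_subset_uIcc hu)
            rw [add_sub_cancel_left] at h3
            calc |u| = |c + (u - c)| := by ring_nf
              _ ≤ |c| + |u - c| := abs_add_le _ _
              _ ≤ c + |s| := by rw [abs_of_nonneg hc]; gcongr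
          · exact hM u)
      rwa [add_sub_cancel_left] at this
    have hn2 : ‖∫ u in (a + s)..(b + s), h u‖ ≤ M * b := by
      refine (intervalIntegral.norm_integral_le_of_norm_le_const (fun u _ => hM u)).trans ?_
      gcongr
      rw [add_sub_add_right_eq_sub, abs_of_nonneg (by linarith)]
      linarith
    have hn3 : ‖∫ u in a..b, u • (h u - h (u + s))‖ ≤ M * |s| * (3 * b + 2 * |s|) := by
      rw [e1]
      refine (norm_add_le _ _).trans ((add_le_add (norm_sub_le _ _) le_rfl).trans ?_)
      rw [norm_smul, Real.norm_eq_abs]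
      have h3 := hn a ha0.le
      have h4 := hn b hb0.le
      have h5 : |s| * ‖∫ u in (a + s)..(b + s), h u‖ ≤ |s| * (M * b) := by gcongr
      have h6 : (a + |s|) * M * |s| ≤ (b + |s|) * M * |s| := by gcongr
      linarith
    rw [integral_horoShell hr.le hε, norm_smul, Real.norm_eq_abs, abs_of_nonneg
      (by rw [inv_nonneg]; linarith)]
    calc ((b ^ 2 - a ^ 2) / 2)⁻¹ * ‖∫ u in a..b, u • (h u - h (u + s))‖
        ≤ ((1 - Real.exp (-ε)) * b ^ 2 / 2)⁻¹ * (M * |s| * (3 * b + 2 * |s|)) := by gcongr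
      _ = _ := by field_simp
  refine squeeze_zero_norm' hbd ?_
  have hlim : Tendsto (fun r => (horoTime (r + ε))⁻¹) atTop (𝓝 0) :=
    tendsto_inv_atTop_zero.comp (tendsto_horoTime.comp (tendsto_atTop_add_const_right _ ε tendsto_id))
  have := ((hlim.const_mul 3).add ((hlim.pow 2).const_mul (2 * |s|))).const_mul
    (2 * M * |s| / (1 - Real.exp (-ε)))
  simpa using this

end Shells

/-! ### Averages along orbits and the horocycle maximal inequality -/

section OrbitAvg

variable {G : Type} [Group G] {X : Type u} [MulAction G X] {Ω : Type*} [MeasurableSpace Ω]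

/-- The average of `f` over the random translate `φ ω • x`, where `ω` has distribution `ρ`. -/
def orbitAvg (ρ : Measure Ω) (φ : Ω → G) (f : X → ℝ≥0∞) (x : X) : ℝ≥0∞ :=
  ∫⁻ ω, f (φ ω • x) ∂ρ

theorem orbitAvg_le_add_const {ρ : Measure Ω} [IsProbabilityMeasure ρ] {φ : Ω → G}
    {f g : X → ℝ≥0∞} {c : ℝ≥0∞} (h : ∀ x, f x ≤ g x + c) (x : X) :
    orbitAvg ρ φ f x ≤ orbitAvg ρ φ g x + c := by
  refine (lintegral_mono fun ω => h _).trans ?_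
  rw [lintegral_add_right _ measurable_const]
  simp [orbitAvg]

variable [MeasurableSpace G] [MeasurableSpace X] [MeasurableSMul₂ G X]

theorem measurable_orbitAvg {ρ : Measure Ω} [SFinite ρ] {φ : Ω → G} (hφ : Measurable φ)
    {f : X → ℝ≥0∞} (hf : Measurable f) : Measurable (orbitAvg ρ φ f) :=
  Measurable.lintegral_prod_right' (f := fun q : X × Ω => f (φ q.2 • q.1))
    (hf.comp ((hφ.comp measurable_snd).smul measurable_fst))

theorem lintegral_orbitAvg {μ : Measure X} [SFinite μ] [SMulInvariantMeasure G X μ]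
    {ρ : Measure Ω} [IsProbabilityMeasure ρ] {φ : Ω → G} (hφ : Measurable φ)
    {f : X → ℝ≥0∞} (hf : Measurable f) : ∫⁻ x, orbitAvg ρ φ f x ∂μ = ∫⁻ x, f x ∂μ := by
  unfold orbitAvg
  rw [lintegral_lintegral_swap (f := fun x ω => f (φ ω • x))
    (hf.comp ((hφ.comp measurable_snd).smul measurable_fst)).aemeasurable]
  have : ∀ ω, ∫⁻ x, f (φ ω • x) ∂μ = ∫⁻ x, f x ∂μ := fun ω =>
    (measurePreserving_smul (φ ω) μ).lintegral_comp hf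
  simp [this]

/-- A composition of orbit averages is again an orbit average. -/
theorem orbitAvg_orbitAvg {Ω' : Type*} [MeasurableSpace Ω'] {ρ : Measure Ω} {ρ' : Measure Ω'}
    [SFinite ρ'] {φ : Ω → G} {ψ : Ω' → G} (hφ : Measurable φ)
    (hψ : Measurable ψ) [MeasurableMul₂ G] {f : X → ℝ≥0∞} (hf : Measurable f) (x : X) :
    orbitAvg ρ φ (orbitAvg ρ' ψ f) x = orbitAvg (ρ.prod ρ') (fun q => ψ q.2 * φ q.1) f x := by
  unfold orbitAvg
  rw [lintegral_prod]
  · simp only [mul_smul]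
  · exact (hf.comp (((hψ.comp measurable_snd).mul (hφ.comp measurable_fst)).smul
      measurable_const)).aemeasurable

/-- The weak type maximal inequality for ergodic averages of orbit averages, localized to the set
where the function is large: the part of `f` below `c / 2` contributes at most `c / 2` to the
maximal function. -/
theorem measure_lt_ergMax_orbitAvg_le {μ : Measure X} [SFinite μ] [SMulInvariantMeasure G X μ]
    {ρ : Measure Ω} [IsProbabilityMeasure ρ] {φ : Ω → G} (hφ : Measurable φ) (g : G)
    {f : X → ℝ} (hf : Measurable f) {c : ℝ} (hc : 0 < c) :
    μ {x | ENNReal.ofReal c <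
      ergMax (fun x => g • x) (orbitAvg ρ φ fun x => ENNReal.ofReal (f x)) x} ≤
      ENNReal.ofReal (2 / c) * ∫⁻ x in {x | c < 2 * f x}, ENNReal.ofReal (f x) ∂μ := by
  set f₁ : X → ℝ≥0∞ := {x | c < 2 * f x}.indicator fun x => ENNReal.ofReal (f x) with hf₁
  have hs : MeasurableSet {x | c < 2 * f x} := measurableSet_lt measurable_const (hf.const_mul 2)
  have hf₁m : Measurable f₁ := (ENNReal.measurable_ofReal.comp hf).indicator hs
  have hsplit : ∀ x, ENNReal.ofReal (f x) ≤ f₁ x + ENNReal.ofReal (c / 2) := by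
    intro x
    by_cases hx : c < 2 * f x
    · rw [hf₁, indicator_of_mem (show x ∈ {x | c < 2 * f x} from hx)]
      exact le_self_add
    · exact (ENNReal.ofReal_le_ofReal (by linarith)).trans le_add_self
  have hmax := ergMax_le_add_const (T := fun x : X => g • x)
    (orbitAvg_le_add_const (ρ := ρ) (φ := φ) hsplit)
  have hsub : {x | ENNReal.ofReal c <
      ergMax (fun x => g • x) (orbitAvg ρ φ fun x => ENNReal.ofReal (f x)) x} ⊆
      {x | ENNReal.ofReal (c / 2) < ergMax (fun x => g • x) (orbitAvg ρ φ f₁) x} := by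
    intro x hx
    by_contra hcon
    refine absurd (lt_of_lt_of_le (show ENNReal.ofReal c < _ from hx)
      ((hmax x).trans (add_le_add_left (not_lt.1 hcon) _))) ?_
    rw [← ENNReal.ofReal_add (by positivity) (by positivity), add_halves]
    exact lt_irrefl _
  have hweak := mul_measure_lt_ergMax_le (measurePreserving_smul g μ)
    (measurable_orbitAvg (ρ := ρ) hφ hf₁m) (ENNReal.ofReal (c / 2))
  rw [lintegral_orbitAvg hφ hf₁m, hf₁, lintegral_indicator hs] at hweak
  calc _ ≤ _ := measure_mono hsub
    _ = ENNReal.ofReal (2 / c) * (ENNReal.ofReal (c / 2) *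
          μ {x | ENNReal.ofReal (c / 2) < ergMax (fun x => g • x) (orbitAvg ρ φ f₁) x}) := by
        rw [← mul_assoc, ← ENNReal.ofReal_mul (by positivity),
          show 2 / c * (c / 2) = 1 by field_simp, ENNReal.ofReal_one, one_mul]
    _ ≤ _ := by gcongr

end OrbitAvg

section HoroMax

variable {X : Type u} [MeasurableSpace X] [MulAction PSL(2, ℝ) X] [MeasurableSMul₂ PSL(2, ℝ) X]

/-- The uniform probability measure on a block `[0, h]` of horocycle times. -/
def blockMeasure (h : ℝ) : Measure ℝ := (ENNReal.ofReal h)⁻¹ • volume.restrict (Icc 0 h)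

theorem isProbabilityMeasure_blockMeasure {h : ℝ} (hh : 0 < h) :
    IsProbabilityMeasure (blockMeasure h) := by
  constructor
  rw [blockMeasure, Measure.smul_apply, Measure.restrict_apply_univ, Real.volume_Icc, sub_zero,
    smul_eq_mul, ENNReal.inv_mul_cancel (ENNReal.ofReal_pos.2 hh).ne' ENNReal.ofReal_ne_top]

instance (h : ℝ) : SFinite (blockMeasure h) := by unfold blockMeasure; infer_instance

theorem measurable_unip_inv : Measurable fun u : ℝ => (unip u)⁻¹ :=
  continuous_unip.measurable.inv

/-- The horocycle maximal operator: the ergodic maximal function of the average over a block. -/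
def horoMax (h : ℝ) (f : X → ℝ≥0∞) : X → ℝ≥0∞ :=
  ergMax (fun x => (unip h)⁻¹ • x) (orbitAvg (blockMeasure h) (fun u => (unip u)⁻¹) f)

/-- The integral over the `j`-th block of horocycle times is the block average at the `j`-th iterate
of the time `h` map. -/
theorem setLIntegral_block_eq {h : ℝ} (hh : 0 < h) {f : X → ℝ≥0∞} (hf : Measurable f) (y : X)
    (j : ℕ) : ∫⁻ u in Icc (j * h) ((j + 1) * h), f ((unip u)⁻¹ • y) =
      ENNReal.ofReal h * orbitAvg (blockMeasure h) (fun u => (unip u)⁻¹) f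
        ((fun x => (unip h)⁻¹ • x)^[j] y) := by
  have hit : (fun x => (unip h)⁻¹ • x)^[j] y = (unip (j * h))⁻¹ • y := by
    induction j with
    | zero => simp [unip_zero]
    | succ j ih =>
      rw [Function.iterate_succ_apply', ih, smul_smul, ← mul_inv_rev, ← unip_add]
      push_cast
      ring_nf
  have hm : Measurable fun u : ℝ => f ((unip u)⁻¹ • y) :=
    hf.comp (measurable_unip_inv.smul measurable_const)
  rw [hit, orbitAvg, blockMeasure, lintegral_smul_measure, smul_eq_mul, ← mul_assoc,
    ENNReal.mul_inv_cancel (ENNReal.ofReal_pos.2 hh).ne' ENNReal.ofReal_ne_top, one_mul,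
    ← (measurePreserving_add_right volume ((j : ℝ) * h)).setLIntegral_comp_preimage
      measurableSet_Icc hm]
  have hp : (fun u : ℝ => u + j * h) ⁻¹' Icc (j * h) ((j + 1) * h) = Icc 0 h := by
    rw [preimage_add_const_Icc]; ring_nf
  rw [hp]
  refine lintegral_congr fun u => ?_
  rw [smul_smul, ← mul_inv_rev, ← unip_add, add_comm]

/-- An interval `[0, b]` with `b ≥ h` is covered by blocks of total length at most `2 * b`. -/
theorem setLIntegral_unip_le {h b : ℝ} (hh : 0 < h) (hb : h ≤ b) {f : X → ℝ≥0∞}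
    (hf : Measurable f) (y : X) :
    ∫⁻ u in Icc 0 b, f ((unip u)⁻¹ • y) ≤ ENNReal.ofReal (2 * b) * horoMax h f y := by
  set m := ⌊b / h⌋₊ with hm
  have hb0 : 0 ≤ b / h := div_nonneg (hh.le.trans hb) hh.le
  have hm1 : b < (m + 1) * h := by
    rw [← div_lt_iff₀ hh]; exact Nat.lt_floor_add_one _
  have hm2 : (m + 1) * h ≤ 2 * b := by
    have : m * h ≤ b := by rw [← le_div_iff₀ hh]; exact Nat.floor_le hb0
    linarith
  have hcover : Icc 0 b ⊆ ⋃ j : Fin (m + 1), Icc ((j : ℕ) * h) (((j : ℕ) + 1) * h) := by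
    intro u hu
    have h0 : 0 ≤ u / h := div_nonneg hu.1 hh.le
    have hlt : ⌊u / h⌋₊ < m + 1 := Nat.lt_succ_of_le (Nat.floor_mono (by gcongr; exact hu.2))
    refine mem_iUnion.2 ⟨⟨⌊u / h⌋₊, hlt⟩, ?_, ?_⟩
    · rw [← le_div_iff₀ hh]; exact Nat.floor_le h0
    · rw [← div_le_iff₀ hh]; exact (Nat.lt_floor_add_one _).le
  calc ∫⁻ u in Icc 0 b, f ((unip u)⁻¹ • y)
      ≤ ∫⁻ u in ⋃ j : Fin (m + 1), Icc ((j : ℕ) * h) (((j : ℕ) + 1) * h), f ((unip u)⁻¹ • y) :=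
        lintegral_mono_set hcover
    _ ≤ ∑' j : Fin (m + 1), ∫⁻ u in Icc ((j : ℕ) * h) (((j : ℕ) + 1) * h), f ((unip u)⁻¹ • y) :=
        lintegral_iUnion_le _ _
    _ = ENNReal.ofReal h * ∑ j ∈ Finset.range (m + 1),
          orbitAvg (blockMeasure h) (fun u => (unip u)⁻¹) f ((fun x => (unip h)⁻¹ • x)^[j] y) := by
        rw [tsum_fintype, Fin.sum_univ_eq_sum_range
          (fun j => ∫⁻ u in Icc ((j : ℕ) * h) (((j : ℕ) + 1) * h), f ((unip u)⁻¹ • y)),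
          Finset.mul_sum]
        exact Finset.sum_congr rfl fun j _ => setLIntegral_block_eq hh hf y j
    _ = ENNReal.ofReal ((m + 1) * h) * ((∑ j ∈ Finset.range (m + 1),
          orbitAvg (blockMeasure h) (fun u => (unip u)⁻¹) f ((fun x => (unip h)⁻¹ • x)^[j] y)) /
            (m + 1 : ℕ)) := by
        rw [ENNReal.ofReal_mul (by positivity), mul_comm (ENNReal.ofReal (m + 1)), mul_assoc]
        congr 1
        have : ENNReal.ofReal ((m : ℝ) + 1) = (m + 1 : ℕ) := by
          rw [← ENNReal.ofReal_natCast]; push_cast; rfl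
        rw [this, ENNReal.mul_div_cancel (by simp) (by simp)]
    _ ≤ _ := by
        gcongr
        exact le_iSup (fun m : ℕ => (∑ j ∈ Finset.range (m + 1), orbitAvg (blockMeasure h)
          (fun u => (unip u)⁻¹) f ((fun x => (unip h)⁻¹ • x)^[j] y)) / (m + 1 : ℕ)) m

/-- The comparison constant between horocycle shells and full horocycle blocks. -/
def shellConst (ε : ℝ) : ℝ≥0∞ := ENNReal.ofReal (4 / (1 - Real.exp (-ε)))

/-- Horocycle averages over shells are dominated by the horocycle maximal function. -/
theorem lintegral_horoShell_smul_le {r ε : ℝ} (hr : 0 < r) (hε : 0 < ε) {f : X → ℝ≥0∞}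
    (hf : Measurable f) (y : X) :
    ∫⁻ u, f ((unip u)⁻¹ • y) ∂(horoShell r ε) ≤ shellConst ε * horoMax (horoTime ε) f y := by
  have he : 0 < 1 - Real.exp (-ε) := by
    have := Real.exp_lt_one_iff.2 (show -ε < 0 by linarith)
    linarith
  have hb := horoTime_pos (show 0 < r + ε by linarith)
  refine (lintegral_horoShell_le hr hε
    (hf.comp (measurable_unip_inv.smul measurable_const))).trans ?_
  refine (mul_le_mul_right (setLIntegral_unip_le (horoTime_pos hε)
    (strictMono_horoTime.monotone (show ε ≤ r + ε by linarith)) hf y) _).trans ?_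
  rw [← mul_assoc, ← ENNReal.ofReal_mul (by positivity), shellConst]
  gcongr
  refine le_of_eq ?_
  field_simp
  norm_num

end HoroMax

/-! ### Sector averages -/

section Sector

/-- The group element with Cartan coordinates `(t, k, k')`. -/
def cartanElt (q : ℝ × (rotK × rotK)) : PSL(2, ℝ) := q.2.1 * diagElt q.1 * q.2.2

theorem continuous_cartanElt : Continuous cartanElt := by
  have := continuous_diagElt
  unfold cartanElt
  fun_prop

theorem sectorFamily_eq_map (ν lam : Measure rotK) [SFinite ν] [SFinite lam] (ε r : ℝ) :
    sectorFamily ν lam ε r = ((shellTime r ε).prod (ν.prod lam)).map cartanElt := by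
  have hd := continuous_diagElt.measurable
  have hK : Measurable (Subtype.val : rotK → PSL(2, ℝ)) := measurable_subtype_coe
  refine Measure.ext_of_lintegral _ fun F hF => ?_
  have hFc : Measurable fun q => F (cartanElt q) := hF.comp continuous_cartanElt.measurable
  rw [sectorFamily, shellMeasure_eq_map, Measure.lintegral_mconv hF,
    lintegral_map hF continuous_cartanElt.measurable]
  have h1 : ∀ x : PSL(2, ℝ), ∫⁻ y, F (x * y) ∂(((shellTime r ε).map diagElt).mconv
      (lam.map Subtype.val)) = ∫⁻ t, ∫⁻ k', F (x * (diagElt t * k')) ∂lam ∂(shellTime r ε) := by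
    intro x
    have hFx : Measurable fun y => F (x * y) := hF.comp (measurable_const_mul x)
    rw [Measure.lintegral_mconv hFx]
    have h2 : ∀ a : PSL(2, ℝ), ∫⁻ y, F (x * (a * y)) ∂(lam.map Subtype.val) =
        ∫⁻ k' : rotK, F (x * (a * k')) ∂lam := fun a =>
      lintegral_map (hFx.comp (measurable_const_mul a)) hK
    simp_rw [h2]
    rw [lintegral_map _ hd]
    exact Measurable.lintegral_prod_right' (f := fun q : PSL(2, ℝ) × rotK => F (x * (q.1 * q.2)))
      (hFx.comp (measurable_fst.mul (hK.comp measurable_snd)))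
  simp_rw [h1]
  have hdc := continuous_diagElt
  have hm1 : Measurable fun q : (rotK × ℝ) × rotK =>
      F ((q.1.1 : PSL(2, ℝ)) * (diagElt q.1.2 * q.2)) :=
    hF.comp (Continuous.measurable (by fun_prop))
  have hm2 : Measurable fun q : (PSL(2, ℝ) × ℝ) × rotK => F (q.1.1 * (diagElt q.1.2 * q.2)) :=
    hF.comp (Continuous.measurable (by fun_prop))
  rw [lintegral_map _ hK, lintegral_prod _ hFc.aemeasurable,
    lintegral_lintegral_swap]
  · refine lintegral_congr fun t => ?_
    rw [lintegral_prod (fun q => F (cartanElt (t, q))) (hFc.comp measurable_prodMk_left).aemeasurable]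
    simp only [cartanElt, mul_assoc]
  · exact (Measurable.lintegral_prod_right' (ν := lam) hm1).aemeasurable
  · exact Measurable.lintegral_prod_right' (ν := shellTime r ε)
      (Measurable.lintegral_prod_right' (ν := lam) hm2)

theorem lintegral_sectorFamily (ν lam : Measure rotK) [SFinite ν] [SFinite lam] (ε r : ℝ)
    {F : PSL(2, ℝ) → ℝ≥0∞} (hF : Measurable F) :
    ∫⁻ g, F g ∂(sectorFamily ν lam ε r) =
      ∫⁻ t, ∫⁻ k : rotK, ∫⁻ k' : rotK, F (k * diagElt t * k') ∂lam ∂ν ∂(shellTime r ε) := by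
  have hFc : Measurable fun q => F (cartanElt q) := hF.comp continuous_cartanElt.measurable
  rw [sectorFamily_eq_map, lintegral_map hF continuous_cartanElt.measurable,
    lintegral_prod _ hFc.aemeasurable]
  refine lintegral_congr fun t => ?_
  rw [lintegral_prod (fun q => F (cartanElt (t, q))) (hFc.comp measurable_prodMk_left).aemeasurable]
  rfl

theorem isProbabilityMeasure_sectorFamily (ν lam : Measure rotK) [IsProbabilityMeasure ν]
    [IsProbabilityMeasure lam] {ε r : ℝ} (hr : 0 < r) (hε : 0 < ε) :
    IsProbabilityMeasure (sectorFamily ν lam ε r) := by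
  have := isProbabilityMeasure_shellTime hr.le hε
  rw [sectorFamily_eq_map]
  exact Measure.isProbabilityMeasure_map continuous_cartanElt.measurable.aemeasurable

/-- A measure with essentially bounded density is dominated by a multiple of Haar measure. -/
theorem exists_le_smul_haarK {ν : Measure rotK} [IsProbabilityMeasure ν] (hν : ν ≪ haarK)
    (hν' : MemLp (ν.rnDeriv haarK) ∞ haarK) : ∃ c : ℝ≥0, ν ≤ c • haarK := by
  obtain ⟨c, hc⟩ : ∃ c : ℝ≥0, (c : ℝ≥0∞) = eLpNorm (ν.rnDeriv haarK) ∞ haarK :=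
    ⟨_, ENNReal.coe_toNNReal hν'.2.ne⟩
  refine ⟨c, ?_⟩
  have hb : ∀ᵐ k ∂haarK, ν.rnDeriv haarK k ≤ c := by
    rw [hc]
    filter_upwards [ae_le_eLpNormEssSup (f := ν.rnDeriv haarK) (μ := haarK)] with k hk
    rw [eLpNorm_exponent_top]
    simpa using hk
  refine Measure.le_iff.2 fun s hs => ?_
  rw [← Measure.setLIntegral_rnDeriv hν s]
  refine (lintegral_mono_ae (ae_restrict_of_ae hb)).trans ?_
  rw [setLIntegral_const]
  rfl

/-- Bi-`K`-averages over the Cartan component `a_t` and over the horocycle element `n_u`,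
`u = horoTime t`, agree. -/
theorem lintegral_haarK_diagElt_eq (t : ℝ) (F : PSL(2, ℝ) → ℝ≥0∞) :
    ∫⁻ k : rotK, ∫⁻ k' : rotK, F (k * diagElt t * k') ∂haarK ∂haarK =
      ∫⁻ k : rotK, ∫⁻ k' : rotK, F (k * unip (horoTime t) * k') ∂haarK ∂haarK := by
  have hu : unip (horoTime t) = (rotElt (cartanAngle t) : PSL(2, ℝ)) * diagElt t *
      (rotElt (cartanAngle t - Real.pi / 2) : PSL(2, ℝ)) := unip_eq_rot_mul_diagElt_mul_rot t
  symm
  calc ∫⁻ k : rotK, ∫⁻ k' : rotK, F (k * unip (horoTime t) * k') ∂haarK ∂haarK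
      = ∫⁻ k : rotK, ∫⁻ k' : rotK, F (((k * rotElt (cartanAngle t) : rotK) : PSL(2, ℝ)) *
          diagElt t * ((rotElt (cartanAngle t - Real.pi / 2) * k' : rotK) : PSL(2, ℝ)))
            ∂haarK ∂haarK := by
        simp only [hu, Subgroup.coe_mul, mul_assoc]
    _ = ∫⁻ k : rotK, ∫⁻ k' : rotK, F (((k * rotElt (cartanAngle t) : rotK) : PSL(2, ℝ)) *
          diagElt t * k') ∂haarK ∂haarK := by
        refine lintegral_congr fun k => ?_
        exact lintegral_mul_left_eq_self (fun k' : rotK =>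
          F (((k * rotElt (cartanAngle t) : rotK) : PSL(2, ℝ)) * diagElt t * k')) _
    _ = _ := lintegral_mul_right_eq_self (fun k : rotK =>
          ∫⁻ k' : rotK, F (k * diagElt t * k') ∂haarK) _

/-- The inverse of an element of `K`, as an element of the group. -/
def invK (k : rotK) : PSL(2, ℝ) := (k : PSL(2, ℝ))⁻¹

theorem measurable_invK : Measurable invK := measurable_subtype_coe.inv

/-- The sector averages of `f` are dominated by a `K`-average of the horocycle maximal function of
the `K`-average of `f`. -/
theorem exists_lintegral_sectorFamily_le {ν lam : Measure rotK} [IsProbabilityMeasure ν]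
    [IsProbabilityMeasure lam] (hν : ν ≪ haarK) (hlam : lam ≪ haarK)
    (hν' : MemLp (ν.rnDeriv haarK) ∞ haarK) (hlam' : MemLp (lam.rnDeriv haarK) ∞ haarK)
    {ε : ℝ} (hε : 0 < ε) :
    ∃ C : ℝ≥0, ∀ (X : Type u) [MeasurableSpace X] [MulAction PSL(2, ℝ) X]
      [MeasurableSMul₂ PSL(2, ℝ) X] (f : X → ℝ≥0∞), Measurable f → ∀ (x : X) (r : ℝ), 0 < r →
      ∫⁻ g, f (g⁻¹ • x) ∂(sectorFamily ν lam ε r) ≤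
        C * orbitAvg haarK invK (horoMax (horoTime ε) (orbitAvg haarK invK f)) x := by
  obtain ⟨a, ha⟩ := exists_le_smul_haarK hν hν'
  obtain ⟨b, hb⟩ := exists_le_smul_haarK hlam hlam'
  refine ⟨a * b * (4 / (1 - Real.exp (-ε))).toNNReal, fun X _ _ _ f hf x r hr => ?_⟩
  have hF : Measurable fun g : PSL(2, ℝ) => f (g⁻¹ • x) :=
    hf.comp (measurable_inv.smul measurable_const)
  have hKm : Measurable (orbitAvg haarK invK f) := measurable_orbitAvg measurable_invK hf
  have hbd : ∀ (c : ℝ≥0) (η : Measure rotK) (w : rotK → ℝ≥0∞), η ≤ c • haarK →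
      ∫⁻ k, w k ∂η ≤ c * ∫⁻ k, w k ∂haarK := by
    intro c η w hη
    refine (lintegral_mono' hη le_rfl).trans_eq ?_
    rw [lintegral_smul_measure]
    rfl
  have hm1 : Measurable fun q : ℝ × (rotK × rotK) =>
      f (((q.2.1 : PSL(2, ℝ)) * diagElt q.1 * q.2.2)⁻¹ • x) :=
    hF.comp continuous_cartanElt.measurable
  rw [lintegral_sectorFamily _ _ _ _ hF]
  calc ∫⁻ t, ∫⁻ k : rotK, ∫⁻ k' : rotK, f (((k : PSL(2, ℝ)) * diagElt t * k')⁻¹ • x)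
          ∂lam ∂ν ∂(shellTime r ε)
      ≤ ∫⁻ t, (a * b : ℝ≥0∞) * ∫⁻ k : rotK, ∫⁻ k' : rotK,
          f (((k : PSL(2, ℝ)) * diagElt t * k')⁻¹ • x) ∂haarK ∂haarK ∂(shellTime r ε) := by
        refine lintegral_mono fun t => ?_
        refine (hbd a ν _ ha).trans ?_
        rw [mul_assoc]
        gcongr
        rw [← lintegral_const_mul']
        · exact lintegral_mono fun k => hbd b lam _ hb
        · exact ENNReal.coe_ne_top
    _ = (a * b : ℝ≥0∞) * ∫⁻ t, ∫⁻ k : rotK,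
          orbitAvg haarK invK f ((unip (horoTime t))⁻¹ • invK k • x) ∂haarK ∂(shellTime r ε) := by
        rw [← lintegral_const_mul' _ _ (by finiteness)]
        refine lintegral_congr fun t => ?_
        rw [lintegral_haarK_diagElt_eq t fun g => f (g⁻¹ • x)]
        simp only [orbitAvg, invK, smul_smul, mul_inv_rev, mul_assoc]
    _ = (a * b : ℝ≥0∞) * ∫⁻ k : rotK, ∫⁻ u,
          orbitAvg haarK invK f ((unip u)⁻¹ • invK k • x) ∂(horoShell r ε) ∂haarK := by
        rw [lintegral_lintegral_swap]
        · congr 1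
          refine lintegral_congr fun k => ?_
          rw [horoShell, lintegral_map _ continuous_horoTime.measurable]
          exact hKm.comp (measurable_unip_inv.smul measurable_const)
        · refine (hKm.comp ?_).aemeasurable
          exact (measurable_unip_inv.comp (continuous_horoTime.measurable.comp measurable_fst)).smul
            ((measurable_invK.comp measurable_snd).smul measurable_const)
    _ ≤ (a * b : ℝ≥0∞) * ∫⁻ k : rotK, shellConst ε *
          horoMax (horoTime ε) (orbitAvg haarK invK f) (invK k • x) ∂haarK := by
        gcongr with k
        exact lintegral_horoShell_smul_le hr hε hKm _
    _ = _ := by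
        rw [lintegral_const_mul' _ _ (by unfold shellConst; finiteness), ← mul_assoc]
        push_cast
        rfl

end Sector

/-! ### The maximal inequalities for sector averages -/

section SectorMax

/-- Averages over shells are lower semicontinuous in the radius, so their supremum may be taken
over rational radii. -/
theorem lintegral_shellTime_le_iSup_rat {ε : ℝ} (hε : 0 < ε) {w : ℝ → ℝ≥0∞} (hw : Measurable w)
    {r : ℝ} (hr : 0 < r) :
    ∫⁻ t, w t ∂(shellTime r ε) ≤ ⨆ q : {q : ℚ // 0 < q}, ∫⁻ t, w t ∂(shellTime (q : ℚ) ε) := by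
  set D : ℝ → ℝ := fun s => (horoTime (s + ε) ^ 2 - horoTime s ^ 2) / 2 with hD
  have hDc : Continuous D := by
    have := continuous_horoTime
    fun_prop
  have hDpos : ∀ s, 0 < s → 0 < D s := fun s hs => by
    have := horoTime_sq_lt hs.le hε
    simp only [hD]; linarith
  obtain ⟨q, hq, hqr⟩ : ∃ q : ℕ → ℚ, (∀ n, 0 < q n) ∧ Tendsto (fun n => (q n : ℝ)) atTop (𝓝 r) := by
    have h1 : ∀ n : ℕ, ∃ q : ℚ, r < q ∧ (q : ℝ) < r + 1 / (n + 1) := fun n =>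
      exists_rat_btwn (by have : (0 : ℝ) < 1 / (n + 1) := by positivity
                          linarith)
    choose q hq1 hq2 using h1
    refine ⟨q, fun n => by exact_mod_cast hr.trans (hq1 n), ?_⟩
    refine tendsto_of_tendsto_of_tendsto_of_le_of_le tendsto_const_nhds ?_ (fun n => (hq1 n).le)
      (fun n => (hq2 n).le)
    simpa using (tendsto_one_div_add_atTop_nhds_zero_nat (𝕜 := ℝ)).const_add r
  set v : ℝ → ℝ≥0∞ := fun t => ENNReal.ofReal (Real.sinh t) * w t with hv
  have hvm : Measurable v := (by fun_prop : Measurable fun t => ENNReal.ofReal (Real.sinh t)).mul hw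
  have heq : ∀ s, 0 < s → ∫⁻ t, w t ∂(shellTime s ε) =
      ∫⁻ t, (Icc s (s + ε)).indicator (fun t => ENNReal.ofReal (D s)⁻¹ * v t) t := by
    intro s hs
    rw [lintegral_shellTime _ _ hw, shellMass_eq hs.le hε.le, lintegral_indicator measurableSet_Icc,
      lintegral_const_mul _ hvm, ENNReal.ofReal_inv_of_pos (hDpos s hs)]
  -- Fatou's lemma on the open interval, where the indicators of the shells converge
  calc ∫⁻ t, w t ∂(shellTime r ε)
      = ∫⁻ t, (Ioo r (r + ε)).indicator (fun t => ENNReal.ofReal (D r)⁻¹ * v t) t := by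
        rw [heq r hr, lintegral_indicator measurableSet_Icc, lintegral_indicator measurableSet_Ioo]
        exact (setLIntegral_congr Ioo_ae_eq_Icc).symm
    _ ≤ ∫⁻ t, liminf (fun n => (Icc (q n : ℝ) (q n + ε)).indicator
          (fun t => ENNReal.ofReal (D (q n))⁻¹ * v t) t) atTop := by
        refine lintegral_mono fun t => ?_
        by_cases ht : t ∈ Ioo r (r + ε)
        · rw [indicator_of_mem ht]
          have hlim : Tendsto (fun n => ENNReal.ofReal (D (q n))⁻¹ * v t) atTop
              (𝓝 (ENNReal.ofReal (D r)⁻¹ * v t)) := by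
            refine ENNReal.Tendsto.mul_const ?_ (Or.inl ?_)
            · exact ENNReal.tendsto_ofReal
                (((hDc.tendsto r).comp hqr).inv₀ (hDpos r hr).ne')
            · exact (ENNReal.ofReal_pos.2 (inv_pos.2 (hDpos r hr))).ne'
          refine le_of_eq (Tendsto.liminf_eq (hlim.congr' ?_)).symm
          have h1 := hqr.eventually_lt_const ht.1
          have h2 := (hqr.add_const ε).eventually_const_lt ht.2
          filter_upwards [h1, h2] with n h3 h4
          rw [indicator_of_mem (show t ∈ Icc (q n : ℝ) (q n + ε) from ⟨h3.le, h4.le⟩)]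
        · rw [indicator_of_notMem ht]
          exact zero_le
    _ ≤ liminf (fun n => ∫⁻ t, (Icc (q n : ℝ) (q n + ε)).indicator
          (fun t => ENNReal.ofReal (D (q n))⁻¹ * v t) t) atTop :=
        lintegral_liminf_le fun n => (hvm.const_mul _).indicator measurableSet_Icc
    _ ≤ _ := by
        refine liminf_le_of_le (by isBoundedDefault) fun b hb => ?_
        obtain ⟨n, hn⟩ := hb.exists
        refine hn.trans ?_
        rw [← heq _ (by exact_mod_cast hq n)]
        exact le_iSup (fun q : {q : ℚ // 0 < q} => ∫⁻ t, w t ∂(shellTime (q : ℚ) ε)) ⟨q n, hq n⟩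

variable {X : Type u} [MeasurableSpace X] [MulAction PSL(2, ℝ) X] [MeasurableSMul₂ PSL(2, ℝ) X]

theorem measurable_maximalFun (ν lam : Measure rotK) [IsProbabilityMeasure ν]
    [IsProbabilityMeasure lam] {ε : ℝ} (hε : 0 < ε) {f : X → ℂ} (hf : Measurable f) :
    Measurable (maximalFun (sectorFamily ν lam ε) f) := by
  have hF : ∀ x, Measurable fun g : PSL(2, ℝ) => ‖f (g⁻¹ • x)‖ₑ := fun x =>
    (hf.comp (measurable_inv.smul measurable_const)).enorm
  set W : X → ℝ → ℝ≥0∞ := fun x t => ∫⁻ k : rotK, ∫⁻ k' : rotK,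
    ‖f (((k : PSL(2, ℝ)) * diagElt t * k')⁻¹ • x)‖ₑ ∂lam ∂ν with hW
  have hWm : Measurable fun q : X × ℝ => W q.1 q.2 := by
    refine Measurable.lintegral_prod_right' (ν := ν) (f := fun q : (X × ℝ) × rotK =>
      ∫⁻ k' : rotK, ‖f (((q.2 : PSL(2, ℝ)) * diagElt q.1.2 * k')⁻¹ • q.1.1)‖ₑ ∂lam) ?_
    refine Measurable.lintegral_prod_right' (ν := lam) (f := fun q : ((X × ℝ) × rotK) × rotK =>
      ‖f (((q.1.2 : PSL(2, ℝ)) * diagElt q.1.1.2 * q.2)⁻¹ • q.1.1.1)‖ₑ) ?_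
    refine (hf.comp (Measurable.smul ?_ (by fun_prop))).enorm
    have h1 := continuous_cartanElt.measurable
    have h2 : Measurable fun q : ((X × ℝ) × rotK) × rotK => (q.1.1.2, (q.1.2, q.2)) := by fun_prop
    exact (h1.comp h2).inv
  have heq : maximalFun (sectorFamily ν lam ε) f = fun x => ⨆ q : {q : ℚ // 0 < q},
      ∫⁻ t, W x t ∂(shellTime (q : ℚ) ε) := by
    funext x
    have h1 : ∀ r : ℝ, ∫⁻ g, ‖f (g⁻¹ • x)‖ₑ ∂(sectorFamily ν lam ε r) =
        ∫⁻ t, W x t ∂(shellTime r ε) := fun r => lintegral_sectorFamily ν lam ε r (hF x)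
    unfold maximalFun
    simp only [h1]
    refine le_antisymm (iSup_le fun r => ?_) (iSup_le fun q => ?_)
    · exact lintegral_shellTime_le_iSup_rat hε (hWm.comp measurable_prodMk_left) r.2
    · exact le_iSup (fun r : Ioi (0 : ℝ) => ∫⁻ t, W x t ∂(shellTime r ε))
        ⟨((q : ℚ) : ℝ), mem_Ioi.2 (by exact_mod_cast q.2)⟩
  rw [heq]
  exact Measurable.iSup fun q => hWm.lintegral_prod_right'

/-- Jensen's inequality for orbit averages. -/
theorem orbitAvg_rpow_le {Ω : Type*} [MeasurableSpace Ω] {ρ : Measure Ω} [IsProbabilityMeasure ρ]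
    {φ : Ω → PSL(2, ℝ)} (hφ : Measurable φ) {f : X → ℝ≥0∞} (hf : Measurable f) {p : ℝ}
    (hp : 1 ≤ p) (x : X) : orbitAvg ρ φ f x ^ p ≤ orbitAvg ρ φ (fun y => f y ^ p) x := by
  have hm : Measurable fun ω => f (φ ω • x) := hf.comp (hφ.smul measurable_const)
  have h := eLpNorm'_le_eLpNorm'_of_exponent_le (μ := ρ) one_pos hp hm.aestronglyMeasurable
  simp only [eLpNorm', enorm_eq_self, ENNReal.rpow_one, div_one] at h
  have h2 := ENNReal.rpow_le_rpow h (zero_le_one.trans hp)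
  rwa [← ENNReal.rpow_mul, one_div, inv_mul_cancel₀ (by linarith), ENNReal.rpow_one] at h2

variable {μ : Measure X} [IsProbabilityMeasure μ] [SMulInvariantMeasure PSL(2, ℝ) X μ]

/-- The operator dominating all sector averages. -/
def sectorMax (ε : ℝ) (f : X → ℝ≥0∞) : X → ℝ≥0∞ :=
  orbitAvg haarK invK (horoMax (horoTime ε) (orbitAvg haarK invK f))

theorem measurable_horoMax (h : ℝ) {f : X → ℝ≥0∞} (hf : Measurable f) :
    Measurable (horoMax h f) :=
  measurable_ergMax (measurable_const_smul _) (measurable_orbitAvg measurable_unip_inv hf)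

theorem measurable_sectorMax (ε : ℝ) {f : X → ℝ≥0∞} (hf : Measurable f) :
    Measurable (sectorMax ε f) :=
  measurable_orbitAvg measurable_invK
    (measurable_horoMax _ (measurable_orbitAvg measurable_invK hf))

theorem measure_lt_horoMax_le {h : ℝ} (hh : 0 < h) {f : X → ℝ} (hf : Measurable f) {c : ℝ}
    (hc : 0 < c) : μ {x | ENNReal.ofReal c < horoMax h (fun x => ENNReal.ofReal (f x)) x} ≤
      ENNReal.ofReal (2 / c) * ∫⁻ x in {x | c < 2 * f x}, ENNReal.ofReal (f x) ∂μ := by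
  have := isProbabilityMeasure_blockMeasure hh
  exact measure_lt_ergMax_orbitAvg_le measurable_unip_inv _ hf hc

/-- The weak type inequality also holds for the horocycle maximal function of the `K`-average of
`f`, because the block average of a `K`-average is a single orbit average. -/
theorem measure_lt_horoMax_orbitAvg_le {h : ℝ} (hh : 0 < h) {f : X → ℝ} (hf : Measurable f)
    {c : ℝ} (hc : 0 < c) : μ {x | ENNReal.ofReal c <
        horoMax h (orbitAvg haarK invK (fun x => ENNReal.ofReal (f x))) x} ≤
      ENNReal.ofReal (2 / c) * ∫⁻ x in {x | c < 2 * f x}, ENNReal.ofReal (f x) ∂μ := by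
  have := isProbabilityMeasure_blockMeasure hh
  have heq : orbitAvg (blockMeasure h) (fun u => (unip u)⁻¹)
      (orbitAvg haarK invK (fun x : X => ENNReal.ofReal (f x))) = _ :=
    funext fun x => orbitAvg_orbitAvg measurable_unip_inv measurable_invK
      (ENNReal.measurable_ofReal.comp hf) x
  unfold horoMax
  rw [heq]
  exact measure_lt_ergMax_orbitAvg_le ((measurable_invK.comp measurable_snd).mul
    (measurable_unip_inv.comp measurable_fst)) _ hf hc

theorem lintegral_horoMax_rpow_le {h : ℝ} (hh : 0 < h) {f : X → ℂ} (hf : Measurable f)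
    {p : ℝ} (hp : 1 < p) : ∫⁻ x, horoMax h (fun x => ‖f x‖ₑ) x ^ p ∂μ ≤
      ENNReal.ofReal (2 ^ p * p / (p - 1)) * ∫⁻ x, ‖f x‖ₑ ^ p ∂μ := by
  have hHm := measurable_horoMax h hf.enorm
  simp only [← ofReal_norm] at hHm
  have h := lintegral_rpow_le_of_weak_type hHm hf.norm (fun x => norm_nonneg _)
    (fun c hc => measure_lt_horoMax_le (μ := μ) hh hf.norm hc) hp
  simpa only [ofReal_norm] using h

theorem lintegral_sectorMax_rpow_le {ε : ℝ} (hε : 0 < ε) {f : X → ℂ} (hf : Measurable f)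
    {p : ℝ} (hp : 1 < p) : ∫⁻ x, sectorMax ε (fun x => ‖f x‖ₑ) x ^ p ∂μ ≤
      ENNReal.ofReal (2 ^ p * p / (p - 1)) * ∫⁻ x, ‖f x‖ₑ ^ p ∂μ := by
  have hfm : Measurable fun x => ‖f x‖ₑ := hf.enorm
  have hHm := measurable_horoMax (horoTime ε) (measurable_orbitAvg (ρ := haarK) measurable_invK hfm)
  calc ∫⁻ x, sectorMax ε (fun x => ‖f x‖ₑ) x ^ p ∂μ
      ≤ ∫⁻ x, orbitAvg haarK invK (fun y =>
          horoMax (horoTime ε) (orbitAvg haarK invK (fun x => ‖f x‖ₑ)) y ^ p) x ∂μ :=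
        lintegral_mono fun x => orbitAvg_rpow_le measurable_invK hHm hp.le x
    _ = ∫⁻ y, horoMax (horoTime ε) (orbitAvg haarK invK (fun x => ‖f x‖ₑ)) y ^ p ∂μ :=
        lintegral_orbitAvg measurable_invK (hHm.pow_const p)
    _ ≤ _ := by
        simp only [← ofReal_norm] at hHm
        have h := lintegral_rpow_le_of_weak_type hHm hf.norm (fun x => norm_nonneg _)
          (fun c hc => measure_lt_horoMax_orbitAvg_le (μ := μ) (horoTime_pos hε) hf.norm hc) hp
        simpa only [ofReal_norm] using h

theorem lintegral_sectorMax_le {ε : ℝ} (hε : 0 < ε) {f : X → ℂ} (hf : Measurable f) :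
    ∫⁻ x, sectorMax ε (fun x => ‖f x‖ₑ) x ∂μ ≤ 7 * (1 + logSize μ f) := by
  have hfe : (fun x => ‖f x‖ₑ) = fun x => ENNReal.ofReal ‖f x‖ :=
    funext fun x => (ofReal_norm _).symm
  have hfm : Measurable fun x => ‖f x‖ₑ := hf.enorm
  have hHm := measurable_horoMax (horoTime ε) (measurable_orbitAvg (ρ := haarK) measurable_invK hfm)
  unfold sectorMax
  rw [lintegral_orbitAvg measurable_invK hHm]
  rw [hfe] at hHm ⊢
  exact lintegral_le_of_weak_type hHm hf.norm (fun x => norm_nonneg _)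
    (fun c hc => measure_lt_horoMax_orbitAvg_le (μ := μ) (horoTime_pos hε) hf.norm hc)

theorem sectorMax_ae_eq_zero {ε : ℝ} (hε : 0 < ε) {f : X → ℂ} (hf : Measurable f)
    (h0 : f =ᵐ[μ] 0) : ∀ᵐ x ∂μ, sectorMax ε (fun x => ‖f x‖ₑ) x = 0 := by
  have h := lintegral_sectorMax_rpow_le (μ := μ) hε hf one_lt_two
  have h1 : ∫⁻ x, ‖f x‖ₑ ^ (2 : ℝ) ∂μ = 0 := by
    rw [lintegral_eq_zero_iff (hf.enorm.pow_const _)]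
    filter_upwards [h0] with x hx
    simp [hx]
  rw [h1, mul_zero, nonpos_iff_eq_zero, lintegral_eq_zero_iff
    ((measurable_sectorMax ε hf.enorm).pow_const _)] at h
  filter_upwards [h] with x hx
  simpa using hx

end SectorMax

/-! ### Almost everywhere convergence of horocycle averages -/

/-- Banach's principle: almost everywhere convergence passes to limits for which the approximation
errors are controlled, uniformly in the parameter, by functions of small integral. -/
theorem ae_tendsto_of_approx {X : Type*} [MeasurableSpace X] {μ : Measure X} {φ : ℝ → X → ℂ}
    {ψ : X → ℂ} {φ' : ℕ → ℝ → X → ℂ} {ψ' : ℕ → X → ℂ} {m d : ℕ → X → ℝ≥0∞}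
    (hm : ∀ n, AEMeasurable (m n) μ) (hd : ∀ n, AEMeasurable (d n) μ)
    (h1 : ∀ n, ∀ᵐ x ∂μ, Tendsto (fun r => φ' n r x) atTop (𝓝 (ψ' n x)))
    (h2 : ∀ n, ∀ᵐ x ∂μ, ∀ r : ℝ, 0 < r → edist (φ r x) (φ' n r x) ≤ m n x)
    (h3 : ∀ n, ∀ᵐ x ∂μ, edist (ψ' n x) (ψ x) ≤ d n x)
    (h4 : Tendsto (fun n => ∫⁻ x, m n x + d n x ∂μ) atTop (𝓝 0)) :
    ∀ᵐ x ∂μ, Tendsto (fun r => φ r x) atTop (𝓝 (ψ x)) := by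
  have hinf : ∀ᵐ x ∂μ, ⨅ n, (m n x + d n x) = 0 := by
    have h5 : ∫⁻ x, ⨅ n, (m n x + d n x) ∂μ = 0 := by
      refine nonpos_iff_eq_zero.1 (ge_of_tendsto' h4 fun n => ?_)
      exact lintegral_mono fun x => iInf_le _ n
    exact (lintegral_eq_zero_iff' (AEMeasurable.iInf fun n => (hm n).add (hd n))).1 h5
  filter_upwards [hinf, ae_all_iff.2 h1, ae_all_iff.2 h2, ae_all_iff.2 h3] with x hx hx1 hx2 hx3
  rw [EMetric.tendsto_nhds]
  intro δ hδ
  have hδ2 : 0 < δ / 2 := ENNReal.half_pos hδ.ne'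
  obtain ⟨n, hn⟩ := iInf_lt_iff.1 (hx.trans_lt hδ2)
  filter_upwards [EMetric.tendsto_nhds.1 (hx1 n) _ hδ2, eventually_gt_atTop 0] with r hr hr0
  calc edist (φ r x) (ψ x) ≤ edist (φ r x) (φ' n r x) + edist (φ' n r x) (ψ' n x)
        + edist (ψ' n x) (ψ x) := edist_triangle4 _ _ _ _
    _ ≤ m n x + edist (φ' n r x) (ψ' n x) + d n x := by gcongr <;> [exact hx2 n r hr0; exact hx3 n]
    _ = (m n x + d n x) + edist (φ' n r x) (ψ' n x) := by ring
    _ < δ / 2 + δ / 2 := ENNReal.add_lt_add hn hr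
    _ = δ := ENNReal.add_halves δ

section Horocycle

open DomMulAct

variable {X : Type u} [MeasurableSpace X] [MulAction PSL(2, ℝ) X] [MeasurableSMul₂ PSL(2, ℝ) X]
  {μ : Measure X} [IsProbabilityMeasure μ] [SMulInvariantMeasure PSL(2, ℝ) X μ]

theorem horoShell_absolutelyContinuous {r ε : ℝ} (hr : 0 ≤ r) (hε : 0 ≤ ε) :
    horoShell r ε ≪ volume := by
  rw [horoShell_eq hr hε]
  exact ((withDensity_absolutelyContinuous _ _).trans
    Measure.absolutelyContinuous_restrict).smul_left _

theorem ae_horoShell_of_ae {ε : ℝ} (hε : 0 ≤ ε) {p : X → Prop} (hp : ∀ᵐ x ∂μ, p x) :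
    ∀ᵐ x ∂μ, ∀ r, 0 < r → ∀ᵐ u ∂(horoShell r ε), p ((unip u)⁻¹ • x) := by
  filter_upwards [ae_ae_smul (volume : Measure ℝ) measurable_unip_inv hp] with x hx r hr
  exact (horoShell_absolutelyContinuous hr.le hε).ae_le hx

theorem lintegral_horoMax_le {ε : ℝ} (hε : 0 < ε) (w : Lp ℂ 2 μ) :
    ∫⁻ x, horoMax (horoTime ε) (fun x => ‖w x‖ₑ) x ∂μ ≤ 4 * ‖w‖ₑ := by
  have hw := (Lp.stronglyMeasurable w).measurable
  have h := lintegral_horoMax_rpow_le (μ := μ) (horoTime_pos hε) hw one_lt_two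
  have hm := measurable_horoMax (horoTime ε) hw.enorm
  have h1 := eLpNorm'_le_eLpNorm'_of_exponent_le (μ := μ) one_pos one_le_two
    hm.aestronglyMeasurable
  simp only [eLpNorm', enorm_eq_self, ENNReal.rpow_one, div_one] at h1
  refine h1.trans ((ENNReal.rpow_le_rpow h (by norm_num)).trans ?_)
  rw [Lp.enorm_def, eLpNorm_eq_lintegral_rpow_enorm_toReal two_ne_zero ENNReal.ofNat_ne_top,
    ENNReal.mul_rpow_of_nonneg _ _ (by norm_num)]
  simp only [ENNReal.toReal_ofNat]
  gcongr
  rw [ENNReal.ofReal_rpow_of_nonneg (by norm_num) (by norm_num)]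
  refine ENNReal.ofReal_le_of_le_toReal ?_
  simp only [ENNReal.toReal_ofNat]
  rw [← Real.sqrt_eq_rpow]
  refine Real.sqrt_le_iff.2 ⟨by norm_num, by norm_num⟩

theorem ae_integrable_horoShell {ε : ℝ} (hε : 0 < ε) (w : Lp ℂ 2 μ) :
    ∀ᵐ x ∂μ, ∀ r, 0 < r → Integrable (fun u => w ((unip u)⁻¹ • x)) (horoShell r ε) := by
  have hw := (Lp.stronglyMeasurable w).measurable
  have h := ae_lt_top (measurable_horoMax (horoTime ε) hw.enorm)
    ((lintegral_horoMax_le hε w).trans_lt (by finiteness)).ne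
  filter_upwards [h] with x hx r hr
  refine ⟨(hw.comp (measurable_unip_inv.smul measurable_const)).aestronglyMeasurable, ?_⟩
  refine (lintegral_horoShell_smul_le hr hε hw.enorm x).trans_lt ?_
  exact ENNReal.mul_lt_top (by simp [shellConst]) hx

/-- The square integrable functions whose horocycle averages over shells tend to zero almost
everywhere. -/
def horoNull (μ : Measure X) [IsProbabilityMeasure μ] [SMulInvariantMeasure PSL(2, ℝ) X μ]
    {ε : ℝ} (hε : 0 < ε) : Submodule ℂ (Lp ℂ 2 μ) where
  carrier := {w | ∀ᵐ x ∂μ,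
    Tendsto (fun r => ∫ u, w ((unip u)⁻¹ • x) ∂(horoShell r ε)) atTop (𝓝 0)}
  zero_mem' := by
    filter_upwards [ae_horoShell_of_ae hε.le (Lp.coeFn_zero ℂ 2 μ)] with x hx
    refine tendsto_const_nhds.congr' ?_
    filter_upwards [eventually_gt_atTop 0] with r hr
    rw [integral_congr_ae (hx r hr)]
    simp
  add_mem' := by
    intro v w hv hw
    filter_upwards [hv, hw, ae_horoShell_of_ae hε.le (Lp.coeFn_add v w),
      ae_integrable_horoShell hε v, ae_integrable_horoShell hε w] with x h1 h2 h3 h4 h5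
    have h6 := h1.add h2
    rw [add_zero] at h6
    refine h6.congr' ?_
    filter_upwards [eventually_gt_atTop 0] with r hr
    rw [integral_congr_ae (h3 r hr), ← integral_add (h4 r hr) (h5 r hr)]
    rfl
  smul_mem' := by
    intro c w hw
    filter_upwards [hw, ae_horoShell_of_ae hε.le (Lp.coeFn_smul c w)] with x h1 h2
    have h3 := h1.const_mul c
    rw [mul_zero] at h3
    refine h3.congr' ?_
    filter_upwards [eventually_gt_atTop 0] with r hr
    rw [integral_congr_ae (h2 r hr), ← integral_const_mul]
    rfl

/-- Closedness is the instance of Banach's principle given by the `L²` maximal inequality. -/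
theorem isClosed_horoNull {ε : ℝ} (hε : 0 < ε) :
    IsClosed (horoNull μ hε : Set (Lp ℂ 2 μ)) := by
  refine isClosed_of_closure_subset fun w hw => ?_
  obtain ⟨v, hv, hvw⟩ := mem_closure_iff_seq_limit.1 hw
  have hm : ∀ n, Measurable fun x => ‖(w - v n : Lp ℂ 2 μ) x‖ₑ := fun n =>
    (Lp.stronglyMeasurable _).measurable.enorm
  refine ae_tendsto_of_approx (φ' := fun n r x => ∫ u, v n ((unip u)⁻¹ • x) ∂(horoShell r ε))
    (ψ' := fun _ _ => 0) (d := fun _ _ => 0)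
    (m := fun n x => shellConst ε * horoMax (horoTime ε) (fun x => ‖(w - v n : Lp ℂ 2 μ) x‖ₑ) x)
    (fun n => ((measurable_horoMax _ (hm n)).const_mul _).aemeasurable)
    (fun n => aemeasurable_const) (fun n => hv n) (fun n => ?_) (fun n => by simp) ?_
  · filter_upwards [ae_integrable_horoShell hε w, ae_integrable_horoShell hε (v n),
      ae_horoShell_of_ae hε.le (Lp.coeFn_sub w (v n))] with x h1 h2 h3 r hr
    rw [edist_eq_enorm_sub, ← integral_sub (h1 r hr) (h2 r hr)]
    refine (enorm_integral_le_lintegral_enorm _).trans ?_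
    refine le_trans (le_of_eq ?_) (lintegral_horoShell_smul_le hr hε (hm n) x)
    refine lintegral_congr_ae ?_
    filter_upwards [h3 r hr] with u hu
    rw [hu]
    rfl
  · have hlim : Tendsto (fun n => shellConst ε * (4 * ‖w - v n‖ₑ)) atTop (𝓝 0) := by
      have h1 : Tendsto (fun n => ‖w - v n‖ₑ) atTop (𝓝 0) := by
        have := (tendsto_const_nhds (x := w)).sub hvw
        rw [sub_self] at this
        simpa [Function.comp_def] using (continuous_enorm.tendsto (0 : Lp ℂ 2 μ)).comp this
      have h2 := ENNReal.Tendsto.const_mul (a := shellConst ε)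
        (ENNReal.Tendsto.const_mul (a := 4) h1 (Or.inr (by simp))) (Or.inr (by simp [shellConst]))
      simpa using h2
    refine tendsto_of_tendsto_of_tendsto_of_le_of_le tendsto_const_nhds hlim
      (fun n => zero_le) fun n => ?_
    simp only [add_zero]
    rw [lintegral_const_mul _ (measurable_horoMax _ (hm n))]
    gcongr
    exact lintegral_horoMax_le hε _

theorem tendsto_integral_horoShell_coboundary {ε : ℝ} (hε : 0 < ε) {f : X → ℂ} (hf : Measurable f)
    {M : ℝ} (hM : ∀ x, ‖f x‖ ≤ M) (s : ℝ) (x : X) :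
    Tendsto (fun r => ∫ u, (f (unip s • (unip u)⁻¹ • x) - f ((unip u)⁻¹ • x)) ∂(horoShell r ε))
      atTop (𝓝 0) := by
  have h := (tendsto_integral_horoShell_sub_shift hε (h := fun u => f ((unip u)⁻¹ • x))
    (hf.comp (measurable_unip_inv.smul measurable_const)) (fun u => hM _) (-s)).neg
  rw [neg_zero] at h
  refine h.congr fun r => ?_
  rw [← integral_neg]
  congr 1
  funext u
  rw [neg_sub, smul_smul (unip s), unip_add, mul_inv_rev, unip_neg, inv_inv]

/-- Coboundaries of bounded functions have averages tending to zero by asymptotic translation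
invariance, and general coboundaries are limits of these. -/
theorem coboundary_mem_horoNull {ε : ℝ} (hε : 0 < ε) (s : ℝ) (z : Lp ℂ 2 μ) :
    mk (unip s) • z - z ∈ horoNull μ hε := by
  have hc : Continuous fun z : Lp ℂ 2 μ => mk (unip s) • z - z :=
    (isometry_smul (Lp ℂ 2 μ) (mk (unip s))).continuous.sub continuous_id
  refine Lp.induction ENNReal.ofNat_ne_top
    (motive := fun z : Lp ℂ 2 μ => mk (unip s) • z - z ∈ horoNull μ hε) ?_ ?_
    ((isClosed_horoNull hε).preimage hc) z
  · intro c A hA hμA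
    set v : Lp ℂ 2 μ := ((Lp.simpleFunc.indicatorConst 2 hA hμA.ne c : Lp.simpleFunc ℂ 2 μ) :
      Lp ℂ 2 μ) with hv
    set f : X → ℂ := A.indicator fun _ => c with hf
    have hvf : v =ᵐ[μ] f := by
      rw [hv, Lp.simpleFunc.coe_indicatorConst]
      exact indicatorConstLp_coeFn
    have hfm : Measurable f := measurable_const.indicator hA
    have h1 : ⇑(mk (unip s) • v - v) =ᵐ[μ] fun x => f (unip s • x) - f x := by
      have h2 : ∀ᵐ x ∂μ, v (unip s • x) = f (unip s • x) :=
        (measurePreserving_smul (unip s) μ).quasiMeasurePreserving.ae hvf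
      filter_upwards [Lp.coeFn_sub (mk (unip s) • v) v, smul_Lp_ae_eq (mk (unip s)) v, hvf, h2]
        with x h3 h4 h5 h6
      rw [h3, Pi.sub_apply, h4, h5]
      exact congrArg (· - f x) h6
    change ∀ᵐ x ∂μ, _
    filter_upwards [ae_horoShell_of_ae hε.le h1] with x hx
    refine (tendsto_integral_horoShell_coboundary hε hfm (M := ‖c‖)
      (fun x => norm_indicator_le_norm_self (fun _ => c) x) s x).congr' ?_
    filter_upwards [eventually_gt_atTop 0] with r hr
    exact (integral_congr_ae (hx r hr)).symm
  · intro f g hf hg _ h1 h2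
    have h3 := (horoNull μ hε).add_mem h1 h2
    rw [smul_Lp_add]
    convert h3 using 1
    abel

variable [StandardBorelSpace X]

/-- Horocycle averages of bounded functions over shells converge almost everywhere to the ergodic
mean of the whole group. -/
theorem ae_tendsto_integral_horoShell {ε : ℝ} (hε : 0 < ε) {f : X → ℂ} (hf : Measurable f)
    {M : ℝ} (hM : ∀ x, ‖f x‖ ≤ M) :
    ∀ᵐ x ∂μ, Tendsto (fun r => ∫ u, f ((unip u)⁻¹ • x) ∂(horoShell r ε)) atTop
      (𝓝 (ergodicMean PSL(2, ℝ) μ f x)) := by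
  have hle := invariantSigmaAlgebra_le PSL(2, ℝ) X
  have hf2 : MemLp f 2 μ := MemLp.of_bound hf.aestronglyMeasurable M (Eventually.of_forall hM)
  have hfi : Integrable f μ := hf2.integrable one_le_two
  set E := ergodicMean PSL(2, ℝ) μ f with hE
  have hE2 : MemLp E 2 μ := hf2.condExp one_le_two
  have hEinv : ∀ (g : PSL(2, ℝ)) (x : X), E (g • x) = E x :=
    apply_smul_of_measurable_invariant stronglyMeasurable_condExp.measurable
  set w : Lp ℂ 2 μ := (hf2.sub hE2).toLp with hw
  have hwf : w =ᵐ[μ] f - E := MemLp.coeFn_toLp _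
  have hw0 : ergodicMean PSL(2, ℝ) μ w =ᵐ[μ] 0 := by
    refine (condExp_congr_ae hwf).trans ((condExp_sub hfi integrable_condExp _).trans ?_)
    have h1 : μ[E | invariantSigmaAlgebra PSL(2, ℝ) X] =ᵐ[μ] E :=
      (condExp_condExp_of_le le_rfl hle)
    filter_upwards [h1] with x hx
    exact sub_eq_zero.2 hx.symm
  have hmem : w ∈ horoNull μ hε := by
    have h1 := mem_closure_span_coboundaries hw0
    refine Submodule.topologicalClosure_minimal _ (Submodule.span_le.2 ?_) (isClosed_horoNull hε) h1
    rintro _ ⟨s, z, rfl⟩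
    exact coboundary_mem_horoNull hε s z
  have hmem' : ∀ᵐ x ∂μ, Tendsto (fun r => ∫ u, w ((unip u)⁻¹ • x) ∂(horoShell r ε)) atTop (𝓝 0) :=
    hmem
  filter_upwards [hmem', ae_horoShell_of_ae hε.le hwf] with x hx hx2
  have h1 := hx.add_const (E x)
  rw [zero_add] at h1
  refine h1.congr' ?_
  filter_upwards [eventually_gt_atTop 0] with r hr
  have := isProbabilityMeasure_horoShell hr.le hε
  have hint : Integrable (fun u => f ((unip u)⁻¹ • x)) (horoShell r ε) :=
    Integrable.of_bound (hf.comp (measurable_unip_inv.smul measurable_const)).aestronglyMeasurable M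
      (Eventually.of_forall fun u => hM _)
  rw [integral_congr_ae (hx2 r hr)]
  simp only [Pi.sub_apply, hEinv]
  rw [integral_sub hint (integrable_const _), integral_const]
  simp

end Horocycle

/-! ### Almost everywhere convergence of sector averages of bounded functions -/

section Translation

open DomMulAct

instance fact_one_ne_top : Fact ((1 : ℝ≥0∞) ≠ ∞) := ⟨ENNReal.one_ne_top⟩

/-- An absolutely continuous measure on `K` moves continuously in total variation under
translations. -/
theorem exists_translation_modulus {ν : Measure rotK} [IsProbabilityMeasure ν] (hν : ν ≪ haarK) :
    ∃ ω : rotK → ℝ, Tendsto ω (𝓝 1) (𝓝 0) ∧ ∀ (a : rotK) (H : rotK → ℂ) (M : ℝ), Measurable H →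
      (∀ k, ‖H k‖ ≤ M) → ‖∫ k, H (a * k) ∂ν - ∫ k, H k ∂ν‖ ≤ M * ω a := by
  set q : rotK → ℝ := fun k => (ν.rnDeriv haarK k).toReal with hq
  have hqm : Measurable q := (Measure.measurable_rnDeriv _ _).ennreal_toReal
  have hqi : Integrable q haarK := Measure.integrable_toReal_rnDeriv
  have hqL : MemLp q 1 haarK := memLp_one_iff_integrable.2 hqi
  set Q : Lp ℝ 1 haarK := hqL.toLp with hQ
  refine ⟨fun a => ‖mk a⁻¹ • Q - Q‖, ?_, fun a H M hH hM => ?_⟩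
  · have h1 : Continuous fun a : rotK => ‖mk a⁻¹ • Q - Q‖ := by
      have h2 : Continuous fun a : rotK => (mk a⁻¹ : rotKᵈᵐᵃ) :=
        continuous_mk.comp continuous_inv
      exact ((h2.smul continuous_const).sub continuous_const).norm
    have h3 := h1.tendsto 1
    simpa using h3
  · have e1 : ∀ H : rotK → ℂ, ∫ k, H k ∂ν = ∫ k, q k • H k ∂haarK := fun H =>
      (integral_rnDeriv_smul hν).symm
    have e2 : ∫ k, H (a * k) ∂ν = ∫ k, q (a⁻¹ * k) • H k ∂haarK := by
      rw [e1, ← integral_mul_left_eq_self (fun k => q (a⁻¹ * k) • H k) a]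
      simp only [inv_mul_cancel_left]
    have hqi' : Integrable (fun k => q (a⁻¹ * k)) haarK := hqi.comp_mul_left a⁻¹
    have hb : ∀ {p : rotK → ℝ}, Integrable p haarK → Integrable (fun k => p k • H k) haarK := by
      intro p hp
      refine (hp.norm.const_mul M).mono' (hp.1.smul hH.aestronglyMeasurable)
        (Eventually.of_forall fun k => ?_)
      rw [norm_smul, mul_comm]
      gcongr
      exact hM k
    rw [e2, e1, ← integral_sub (hb hqi') (hb hqi)]
    have e3 : ‖mk a⁻¹ • Q - Q‖ = ∫ k, ‖q (a⁻¹ * k) - q k‖ ∂haarK := by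
      rw [L1.norm_eq_integral_norm]
      refine integral_congr_ae ?_
      have h1 : ∀ᵐ k ∂haarK, Q k = q k := hqL.coeFn_toLp
      have h2 : ∀ᵐ k ∂haarK, Q (a⁻¹ * k) = q (a⁻¹ * k) :=
        (measurePreserving_mul_left haarK a⁻¹).quasiMeasurePreserving.ae (p := fun k => Q k = q k) h1
      filter_upwards [Lp.coeFn_sub (mk a⁻¹ • Q) Q, smul_Lp_ae_eq (mk a⁻¹) Q, h1, h2]
        with k h3 h4 h5 h6
      rw [h3, Pi.sub_apply, h4, h5]
      exact congrArg (fun z => ‖z - q k‖) h6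
    beta_reduce
    rw [e3, ← integral_const_mul]
    refine norm_integral_le_of_norm_le ((hqi'.sub hqi).norm.const_mul M)
      (Eventually.of_forall fun k => ?_)
    rw [← sub_smul, norm_smul, mul_comm]
    gcongr
    exact hM k

end Translation

section ErgodicMean

variable {G : Type} [Group G] [MeasurableSpace G] {X : Type u} [MeasurableSpace X] [MulAction G X]
  [MeasurableSMul₂ G X] {μ : Measure X} [IsProbabilityMeasure μ] [SMulInvariantMeasure G X μ]

/-- Averaging over random group elements does not change the ergodic mean. -/
theorem ergodicMean_integral_smul {Ω : Type*} [MeasurableSpace Ω] {ρ : Measure Ω}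
    [IsProbabilityMeasure ρ] {φ : Ω → G} (hφ : Measurable φ) {f : X → ℂ} (hf : Measurable f)
    {M : ℝ} (hM : ∀ x, ‖f x‖ ≤ M) :
    ergodicMean G μ (fun x => ∫ ω, f (φ ω • x) ∂ρ) =ᵐ[μ] ergodicMean G μ f := by
  have hle := invariantSigmaAlgebra_le G X
  have hm : Measurable fun q : X × Ω => f (φ q.2 • q.1) :=
    hf.comp ((hφ.comp measurable_snd).smul measurable_fst)
  have hfi : Integrable f μ := Integrable.of_bound hf.aestronglyMeasurable M
    (Eventually.of_forall hM)
  have hA : Integrable (fun x => ∫ ω, f (φ ω • x) ∂ρ) μ := by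
    refine Integrable.of_bound ?_ M (Eventually.of_forall fun x => ?_)
    · exact (StronglyMeasurable.integral_prod_right (f := fun x ω => f (φ ω • x))
        hm.stronglyMeasurable).aestronglyMeasurable
    · refine (norm_integral_le_of_norm_le_const (Eventually.of_forall fun ω => hM _)).trans ?_
      simp
  symm
  refine ae_eq_condExp_of_forall_setIntegral_eq hle hA
    (fun s _ _ => integrable_condExp.integrableOn) (fun s hs _ => ?_)
    stronglyMeasurable_condExp.aestronglyMeasurable
  obtain ⟨hsm, hsinv⟩ := (measurableSet_invariantSigmaAlgebra G X).1 hs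
  have h1 : ∀ g : G, ∫ x in s, f (g • x) ∂μ = ∫ x in s, f x ∂μ := by
    intro g
    have h := (measurePreserving_smul g μ).setIntegral_preimage_emb
      (measurableEmbedding_const_smul g) f s
    rwa [hsinv g] at h
  have h2 : ∫ x in s, ∫ ω, f (φ ω • x) ∂ρ ∂μ = ∫ ω, ∫ x in s, f (φ ω • x) ∂μ ∂ρ := by
    refine integral_integral_swap ?_
    exact Integrable.of_bound hm.aestronglyMeasurable M (Eventually.of_forall fun q => hM _)
  rw [h2]
  simp only [h1, ergodicMean]
  rw [setIntegral_condExp hle hfi hs]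
  simp

end ErgodicMean

section Bounded

/-- The Cartan decomposition of the horocycle flow, solved for `a_t` with symmetric rotations. -/
theorem rotElt_mul_diagElt_mul_rotElt (t : ℝ) :
    (rotElt (cartanAngle t) : PSL(2, ℝ)) * diagElt t * (rotElt (cartanAngle t) : PSL(2, ℝ)) =
      unip (horoTime t) * (rotElt (Real.pi / 2) : PSL(2, ℝ)) := by
  have h : unip (horoTime t) = rot (cartanAngle t) * diagElt t *
    rot (cartanAngle t - Real.pi / 2) := unip_eq_rot_mul_diagElt_mul_rot t
  change rot _ * diagElt t * rot _ = _ * rot _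
  rw [h, mul_assoc _ _ (rot (Real.pi / 2)), ← rot_add, sub_add_cancel]

theorem measurable_cartan {X : Type u} [MeasurableSpace X] [MulAction PSL(2, ℝ) X]
    [MeasurableSMul₂ PSL(2, ℝ) X] {f : X → ℂ} (hf : Measurable f) (x : X) :
    Measurable fun q => f ((cartanElt q)⁻¹ • x) :=
  hf.comp (continuous_cartanElt.measurable.inv.smul measurable_const)

/-- The error made in replacing the Cartan element `a_t` by the horocycle element tends to zero
uniformly over functions bounded by a given constant. -/
theorem exists_cartan_modulus {ν lam : Measure rotK} [IsProbabilityMeasure ν]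
    [IsProbabilityMeasure lam] (hν : ν ≪ haarK) (hlam : lam ≪ haarK) :
    ∃ η : ℝ → ℝ, Tendsto η atTop (𝓝 0) ∧ ∀ (t : ℝ) (F : PSL(2, ℝ) → ℂ) (M : ℝ), Measurable F →
      (∀ g, ‖F g‖ ≤ M) →
      ‖∫ k : rotK, ∫ k' : rotK, F (k * diagElt t * k') ∂lam ∂ν -
        ∫ k : rotK, ∫ k' : rotK, F (k * unip (horoTime t) * (rotElt (Real.pi / 2) * k' : rotK))
          ∂lam ∂ν‖ ≤ M * η t := by
  -- `n_u k_{π/2} = k_φ a_t k_φ` with `φ → 0`, and small rotations hardly change `ν` and `lam`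
  obtain ⟨ω, hω, hω'⟩ := exists_translation_modulus hν
  obtain ⟨ω₂, hω₂, hω₂'⟩ := exists_translation_modulus hlam
  have hφ : Tendsto (fun t => rotElt (cartanAngle t)) atTop (𝓝 1) := by
    rw [← rotElt_zero]
    exact (continuous_rotElt.tendsto 0).comp tendsto_cartanAngle
  refine ⟨fun t => ω (rotElt (cartanAngle t)) + ω₂ (rotElt (cartanAngle t)), ?_, ?_⟩
  · simpa using (hω.comp hφ).add (hω₂.comp hφ)
  intro t F M hF hM
  set a := rotElt (cartanAngle t) with ha
  have hc := continuous_diagElt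
  have hm : Measurable fun q : rotK × rotK => F (q.1 * diagElt t * q.2) :=
    hF.comp (Continuous.measurable (by fun_prop))
  have hbd : ∀ w : rotK → ℂ, (∀ k, ‖w k‖ ≤ M) → ‖∫ k, w k ∂lam‖ ≤ M := fun w hw => by
    refine (norm_integral_le_of_norm_le_const (Eventually.of_forall hw)).trans ?_
    simp
  set H : rotK → ℂ := fun k => ∫ k' : rotK, F (k * diagElt t * k') ∂lam with hH
  have hHm : Measurable H := (StronglyMeasurable.integral_prod_right
    (f := fun k k' : rotK => F (k * diagElt t * k')) hm.stronglyMeasurable).measurable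
  have hHM : ∀ k, ‖H k‖ ≤ M := fun k => hbd _ fun k' => hM _
  have h1 : ‖∫ k, H (a * k) ∂ν - ∫ k, H k ∂ν‖ ≤ M * ω a := hω' a H M hHm hHM
  set H₂ : rotK → ℂ := fun k => ∫ k' : rotK, F (k * unip (horoTime t) *
    (rotElt (Real.pi / 2) * k' : rotK)) ∂lam with hH₂
  have hH₂m : Measurable H₂ := (StronglyMeasurable.integral_prod_right
    (f := fun k k' : rotK => F (k * unip (horoTime t) * (rotElt (Real.pi / 2) * k' : rotK)))
      (Measurable.stronglyMeasurable (hF.comp (Continuous.measurable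
        (by fun_prop))))).measurable
  have h2 : ∀ k, ‖H₂ k - H (a * k)‖ ≤ M * ω₂ a := by
    intro k
    have h3 := hω₂' a (fun k' : rotK => F ((a * k : rotK) * diagElt t * k')) M
      (hm.comp measurable_prodMk_left) (fun k' => hM _)
    refine le_trans (le_of_eq ?_) h3
    congr 2
    refine integral_congr_ae (Eventually.of_forall fun k' => ?_)
    have e1 := rotElt_mul_diagElt_mul_rotElt t
    rw [← ha] at e1
    simp only
    rw [rotK_mul_comm a k]
    simp only [Subgroup.coe_mul]
    rw [← mul_assoc _ _ (k' : PSL(2, ℝ)), mul_assoc _ (unip _), ← e1]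
    simp only [mul_assoc]
  have hi : ∀ w : rotK → ℂ, Measurable w → (∀ k, ‖w k‖ ≤ M) → Integrable w ν := fun w hw hwM =>
    Integrable.of_bound hw.aestronglyMeasurable M (Eventually.of_forall hwM)
  have h4 : ‖∫ k, H₂ k ∂ν - ∫ k, H (a * k) ∂ν‖ ≤ M * ω₂ a := by
    rw [← integral_sub (hi _ hH₂m fun k => hbd _ fun k' => hM _)
      (hi (fun k => H (a * k)) (hHm.comp (measurable_const_mul a)) fun k => hHM _)]
    refine (norm_integral_le_of_norm_le_const (Eventually.of_forall h2)).trans ?_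
    simp
  rw [mul_add, norm_sub_rev]
  refine (norm_sub_le_norm_sub_add_norm_sub _ (∫ k, H (a * k) ∂ν) _).trans ?_
  rw [add_comm]
  exact add_le_add h1 h4

variable {X : Type u} [MeasurableSpace X] [MulAction PSL(2, ℝ) X] [MeasurableSMul₂ PSL(2, ℝ) X]

theorem averagingOp_sectorFamily_eq {ν lam : Measure rotK} [IsProbabilityMeasure ν]
    [IsProbabilityMeasure lam] {ε r : ℝ} (hε : 0 < ε) (hr : 0 < r) {f : X → ℂ} (hf : Measurable f)
    {M : ℝ} (hM : ∀ x, ‖f x‖ ≤ M) (x : X) :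
    averagingOp (sectorFamily ν lam ε r) f x = ∫ t, ∫ k : rotK, ∫ k' : rotK,
      f (((k : PSL(2, ℝ)) * diagElt t * k')⁻¹ • x) ∂lam ∂ν ∂(shellTime r ε) := by
  have := isProbabilityMeasure_shellTime hr.le hε
  have hF : Measurable fun g : PSL(2, ℝ) => f (g⁻¹ • x) :=
    hf.comp (measurable_inv.smul measurable_const)
  have hFc := measurable_cartan hf x
  rw [averagingOp, sectorFamily_eq_map, integral_map continuous_cartanElt.measurable.aemeasurable
    hF.aestronglyMeasurable, integral_prod (fun q => f ((cartanElt q)⁻¹ • x))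
    (Integrable.of_bound hFc.aestronglyMeasurable M (Eventually.of_forall fun q => hM _))]
  refine integral_congr_ae (Eventually.of_forall fun t => ?_)
  exact integral_prod (fun q => f ((cartanElt (t, q))⁻¹ • x))
    (Integrable.of_bound (hFc.comp measurable_prodMk_left).aestronglyMeasurable M
      (Eventually.of_forall fun q => hM _))

variable [StandardBorelSpace X] {μ : Measure X} [IsProbabilityMeasure μ]
  [SMulInvariantMeasure PSL(2, ℝ) X μ]

/-- Sector averages of bounded functions converge almost everywhere. They are compared with
`ν`-averages of horocycle averages of `F`, the average of `f` over translates by the inverses of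
`k_{π/2} k'`, where `k'` has distribution `lam`; `F` has the same ergodic mean as `f`. -/
theorem ae_tendsto_averagingOp_of_bounded {ν lam : Measure rotK} [IsProbabilityMeasure ν]
    [IsProbabilityMeasure lam] (hν : ν ≪ haarK) (hlam : lam ≪ haarK) {ε : ℝ} (hε : 0 < ε)
    {f : X → ℂ} (hf : Measurable f) {M : ℝ} (hM : ∀ x, ‖f x‖ ≤ M) :
    ∀ᵐ x ∂μ, Tendsto (fun r => averagingOp (sectorFamily ν lam ε r) f x) atTop
      (𝓝 (ergodicMean PSL(2, ℝ) μ f x)) := by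
  set φ : rotK → PSL(2, ℝ) := fun k' => invK (rotElt (Real.pi / 2) * k') with hφ
  have hφm : Measurable φ := measurable_invK.comp (measurable_const_mul _)
  set F : X → ℂ := fun y => ∫ k', f (φ k' • y) ∂lam with hFdef
  have hFm : Measurable F := (StronglyMeasurable.integral_prod_right
    (f := fun y k' => f (φ k' • y)) (hf.comp ((hφm.comp measurable_snd).smul
      measurable_fst)).stronglyMeasurable).measurable
  have hFM : ∀ y, ‖F y‖ ≤ M := fun y => by
    refine (norm_integral_le_of_norm_le_const (Eventually.of_forall fun k' => hM _)).trans ?_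
    simp
  obtain ⟨η, hη, hη'⟩ := exists_cartan_modulus hν hlam
  have hconv : ∀ᵐ x ∂μ, Tendsto (fun r => ∫ u, F ((unip u)⁻¹ • x) ∂(horoShell r ε)) atTop
      (𝓝 (ergodicMean PSL(2, ℝ) μ f x)) := by
    filter_upwards [ae_tendsto_integral_horoShell (μ := μ) hε hFm hFM,
      ergodicMean_integral_smul (μ := μ) (ρ := lam) hφm hf hM] with x h1 h2
    rwa [← h2]
  have hEinv : ∀ (g : PSL(2, ℝ)) (x : X),
      ergodicMean PSL(2, ℝ) μ f (g • x) = ergodicMean PSL(2, ℝ) μ f x :=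
    apply_smul_of_measurable_invariant stronglyMeasurable_condExp.measurable
  filter_upwards [ae_ae_smul ν measurable_invK hconv] with x hx
  have hm : ∀ r, Measurable fun k : rotK => ∫ u, F ((unip u)⁻¹ • invK k • x) ∂(horoShell r ε) :=
    fun r => (StronglyMeasurable.integral_prod_right
      (f := fun (k : rotK) (u : ℝ) => F ((unip u)⁻¹ • invK k • x)) (hFm.comp
        ((measurable_unip_inv.comp measurable_snd).smul ((measurable_invK.comp measurable_fst).smul
          measurable_const))).stronglyMeasurable).measurable
  -- the main term: horocycle averages at the translates `k⁻¹ • x`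
  have hmain : Tendsto (fun r => ∫ k : rotK, ∫ u, F ((unip u)⁻¹ • invK k • x) ∂(horoShell r ε) ∂ν)
      atTop (𝓝 (ergodicMean PSL(2, ℝ) μ f x)) := by
    have h := tendsto_integral_filter_of_dominated_convergence (μ := ν) (l := atTop)
      (F := fun r k => ∫ u, F ((unip u)⁻¹ • invK k • x) ∂(horoShell r ε))
      (f := fun _ => ergodicMean PSL(2, ℝ) μ f x) (fun _ => M)
      (Eventually.of_forall fun r => (hm r).aestronglyMeasurable) ?_ (integrable_const _) ?_
    · simpa using h
    · filter_upwards [eventually_gt_atTop 0] with r hr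
      have := isProbabilityMeasure_horoShell hr.le hε
      refine Eventually.of_forall fun k => ?_
      refine (norm_integral_le_of_norm_le_const (Eventually.of_forall fun u => hFM _)).trans ?_
      simp
    · filter_upwards [hx] with k hk
      rwa [hEinv] at hk
  have hdiff : Tendsto (fun r => averagingOp (sectorFamily ν lam ε r) f x -
      ∫ k : rotK, ∫ u, F ((unip u)⁻¹ • invK k • x) ∂(horoShell r ε) ∂ν) atTop (𝓝 0) := by
    have hM0 : 0 ≤ M := (norm_nonneg _).trans (hM x)
    rw [Metric.tendsto_nhds]
    intro δ hδ
    have h1 : ∀ᶠ t in atTop, M * η t < δ / 2 := by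
      have h2 := hη.const_mul M
      rw [mul_zero] at h2
      exact h2.eventually_lt_const (half_pos hδ)
    obtain ⟨T, hT⟩ := eventually_atTop.1 h1
    filter_upwards [eventually_gt_atTop 0, eventually_ge_atTop T] with r hr hrT
    have := isProbabilityMeasure_shellTime hr.le hε
    have := isProbabilityMeasure_horoShell hr.le hε
    have hFx : Measurable fun g : PSL(2, ℝ) => f (g⁻¹ • x) :=
      hf.comp (measurable_inv.smul measurable_const)
    have hm2 : Measurable fun q : ℝ × rotK => F ((unip (horoTime q.1))⁻¹ • invK q.2 • x) :=
      hFm.comp ((measurable_unip_inv.comp (continuous_horoTime.measurable.comp measurable_fst)).smul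
        ((measurable_invK.comp measurable_snd).smul measurable_const))
    have e1 : ∫ k : rotK, ∫ u, F ((unip u)⁻¹ • invK k • x) ∂(horoShell r ε) ∂ν =
        ∫ t, ∫ k : rotK, F ((unip (horoTime t))⁻¹ • invK k • x) ∂ν ∂(shellTime r ε) := by
      have h3 : ∀ k : rotK, ∫ u, F ((unip u)⁻¹ • invK k • x) ∂(horoShell r ε) =
          ∫ t, F ((unip (horoTime t))⁻¹ • invK k • x) ∂(shellTime r ε) := fun k =>
        integral_map continuous_horoTime.measurable.aemeasurable
          (hFm.comp (measurable_unip_inv.smul measurable_const)).aestronglyMeasurable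
      simp only [h3]
      refine integral_integral_swap ?_
      exact Integrable.of_bound (hm2.comp measurable_swap).aestronglyMeasurable M
        (Eventually.of_forall fun q => hFM _)
    have e2 : ∀ (t : ℝ) (k : rotK), F ((unip (horoTime t))⁻¹ • invK k • x) =
        ∫ k' : rotK, f (((k : PSL(2, ℝ)) * unip (horoTime t) *
          (rotElt (Real.pi / 2) * k' : rotK))⁻¹ • x) ∂lam := by
      intro t k
      simp only [hFdef, hφ, invK, smul_smul, mul_inv_rev, mul_assoc]
    have hi1 : Integrable (fun t => ∫ k : rotK, ∫ k' : rotK,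
        f (((k : PSL(2, ℝ)) * diagElt t * k')⁻¹ • x) ∂lam ∂ν) (shellTime r ε) := by
      have hc := measurable_cartan hf x
      have hi := (Integrable.of_bound (μ := (shellTime r ε).prod (ν.prod lam))
        hc.aestronglyMeasurable M (Eventually.of_forall fun q => hM _)).integral_prod_left
      refine hi.congr (Eventually.of_forall fun t => ?_)
      exact integral_prod (fun q => f ((cartanElt (t, q))⁻¹ • x))
        (Integrable.of_bound (hc.comp measurable_prodMk_left).aestronglyMeasurable M
          (Eventually.of_forall fun q => hM _))
    have hi2 : Integrable (fun t => ∫ k : rotK, F ((unip (horoTime t))⁻¹ • invK k • x) ∂ν)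
        (shellTime r ε) :=
      (Integrable.of_bound (μ := (shellTime r ε).prod ν) hm2.aestronglyMeasurable M
        (Eventually.of_forall fun q => hFM _)).integral_prod_left
    rw [dist_zero_right, averagingOp_sectorFamily_eq hε hr hf hM, e1, ← integral_sub hi1 hi2]
    refine lt_of_le_of_lt (norm_integral_le_of_norm_le_const (C := δ / 2) ?_) ?_
    · filter_upwards [ae_shellTime_mem r ε] with t ht
      simp only [e2]
      exact (hη' t (fun g => f (g⁻¹ • x)) M hFx fun g => hM _).trans (hT t (hrT.trans ht.1)).le
    · simp only [probReal_univ, mul_one]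
      exact half_lt_self hδ
  simpa using hdiff.add hmain

end Bounded

/-! ### The sector averages form an averaging family -/

section AveragingFamily

theorem ae_prod_shellTime_mem {ν lam : Measure rotK} [SFinite ν] [SFinite lam] (r ε : ℝ) :
    ∀ᵐ q ∂((shellTime r ε).prod (ν.prod lam)), q.1 ∈ Icc r (r + ε) :=
  Measure.quasiMeasurePreserving_fst.ae (ae_shellTime_mem r ε)

theorem isCompact_cartan_shell (r ε : ℝ) :
    IsCompact (cartanElt '' (Icc r (r + ε) ×ˢ univ)) :=
  (isCompact_Icc.prod isCompact_univ).image continuous_cartanElt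

/-- The integral over a shell as a quotient of interval integrals, which are continuous in `r`. -/
theorem integral_shellTime {r ε : ℝ} (hr : 0 ≤ r) (hε : 0 < ε) (h : ℝ → ℝ) :
    ∫ t, h t ∂(shellTime r ε) = ((horoTime (r + ε) ^ 2 - horoTime r ^ 2) / 2)⁻¹ *
      ∫ t in r..(r + ε), Real.sinh t * h t := by
  have h1 := horoTime_sq_lt hr hε
  rw [shellTime, integral_smul_measure, shellMass_eq hr hε.le,
    integral_withDensity_eq_integral_toReal_smul (by fun_prop)
      (Eventually.of_forall fun _ => ENNReal.ofReal_lt_top), ENNReal.toReal_inv,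
    ENNReal.toReal_ofReal (by linarith), integral_Icc_eq_integral_Ioc,
    ← intervalIntegral.integral_of_le (by linarith), smul_eq_mul]
  congr 1
  refine intervalIntegral.integral_congr fun t ht => ?_
  rw [uIcc_of_le (by linarith)] at ht
  rw [ENNReal.toReal_ofReal (Real.sinh_nonneg_iff.2 (hr.trans ht.1)), smul_eq_mul]

theorem isAveragingFamily_sectorFamily {ν lam : Measure rotK} [IsProbabilityMeasure ν]
    [IsProbabilityMeasure lam] {ε : ℝ} (hε : 0 < ε) :
    IsAveragingFamily (sectorFamily ν lam ε) where
  isProbabilityMeasure r hr := isProbabilityMeasure_sectorFamily ν lam hr hε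
  compactSupport r hr := by
    refine ⟨closure (cartanElt '' (Icc r (r + ε) ×ˢ univ)), (isCompact_cartan_shell r ε).closure, ?_⟩
    rw [sectorFamily_eq_map, Measure.map_apply continuous_cartanElt.measurable
      isClosed_closure.measurableSet.compl]
    refine measure_mono_null (fun q hq => ?_) (ae_prod_shellTime_mem (ν := ν) (lam := lam) r ε)
    intro hq2
    exact hq (subset_closure (mem_image_of_mem _ ⟨hq2, mem_univ _⟩))
  continuous F hF := by
    set Φ : ℝ → ℝ := fun t => ∫ q, F (cartanElt (t, q)) ∂(ν.prod lam) with hΦ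
    have hFc : Continuous fun q => F (cartanElt q) := hF.comp continuous_cartanElt
    have hΦc : Continuous Φ := by
      have := continuous_parametric_integral_of_continuous (μ := ν.prod lam)
        (f := fun (t : ℝ) (q : rotK × rotK) => F (cartanElt (t, q))) hFc isCompact_univ
      simpa only [Measure.restrict_univ] using this
    have heq : ∀ r : ℝ, 0 < r → ∫ g, F g ∂(sectorFamily ν lam ε r) =
        ((horoTime (r + ε) ^ 2 - horoTime r ^ 2) / 2)⁻¹ *
          ((∫ t in (0 : ℝ)..(r + ε), Real.sinh t * Φ t) - ∫ t in (0 : ℝ)..r, Real.sinh t * Φ t) := by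
      intro r hr
      have := isProbabilityMeasure_shellTime hr.le hε
      obtain ⟨B, hB⟩ := ((isCompact_Icc (a := r) (b := r + ε)).prod
        (isCompact_univ (X := rotK × rotK))).exists_bound_of_continuousOn hFc.continuousOn
      have hint : Integrable (fun q => F (cartanElt q)) ((shellTime r ε).prod (ν.prod lam)) := by
        refine Integrable.of_bound hFc.aestronglyMeasurable B ?_
        filter_upwards [ae_prod_shellTime_mem (ν := ν) (lam := lam) r ε] with q hq
        exact hB q ⟨hq, mem_univ _⟩
      have hsc : Continuous fun t => Real.sinh t * Φ t := Real.continuous_sinh.mul hΦc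
      rw [sectorFamily_eq_map, integral_map continuous_cartanElt.measurable.aemeasurable
        hF.aestronglyMeasurable, integral_prod _ hint, integral_shellTime hr.le hε,
        intervalIntegral.integral_interval_sub_left (hsc.intervalIntegrable _ _)
          (hsc.intervalIntegrable _ _)]
    refine ContinuousOn.congr ?_ heq
    have hh := continuous_horoTime
    have hP : Continuous fun b => ∫ t in (0 : ℝ)..b, Real.sinh t * Φ t :=
      intervalIntegral.continuous_primitive (fun a b =>
        (Real.continuous_sinh.mul hΦc).intervalIntegrable a b) 0
    refine ContinuousOn.mul (ContinuousOn.inv₀ (by fun_prop) fun r hr => ?_)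
      (Continuous.continuousOn (by fun_prop))
    have := horoTime_sq_lt (le_of_lt (mem_Ioi.1 hr)) hε
    have h2 : 0 < (horoTime (r + ε) ^ 2 - horoTime r ^ 2) / 2 := by linarith
    exact h2.ne'

end AveragingFamily

/-! ### From the maximal inequality to mean and pointwise convergence -/

section Transfer

theorem lintegral_enorm_le_maximalFun {X : Type u} [MulAction PSL(2, ℝ) X]
    {τ : ℝ → Measure PSL(2, ℝ)} (f : X → ℂ) (x : X) {r : ℝ} (hr : 0 < r) :
    ∫⁻ g, ‖f (g⁻¹ • x)‖ₑ ∂(τ r) ≤ maximalFun τ f x :=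
  le_iSup (fun r : Ioi (0 : ℝ) => ∫⁻ g, ‖f (g⁻¹ • x)‖ₑ ∂(τ r)) ⟨r, hr⟩

theorem enorm_averagingOp_le_maximalFun {X : Type u} [MulAction PSL(2, ℝ) X]
    {τ : ℝ → Measure PSL(2, ℝ)} (f : X → ℂ) (x : X) {r : ℝ} (hr : 0 < r) :
    ‖averagingOp (τ r) f x‖ₑ ≤ maximalFun τ f x :=
  (enorm_integral_le_lintegral_enorm _).trans (lintegral_enorm_le_maximalFun f x hr)

/-- The measures `τ r`, `r > 0`, are probability measures whose averages on the action on `X` are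
dominated, pointwise and for every nonnegative function, by `C` times the operator `sectorMax ε`;
moreover the maximal functions of measurable functions are measurable. -/
structure IsDominated (X : Type u) [MeasurableSpace X] [MulAction PSL(2, ℝ) X]
    (τ : ℝ → Measure PSL(2, ℝ)) (ε : ℝ) (C : ℝ≥0) : Prop where
  isProbabilityMeasure : ∀ r, 0 < r → IsProbabilityMeasure (τ r)
  measurable_maximalFun : ∀ f : X → ℂ, Measurable f → Measurable (maximalFun τ f)
  le : ∀ f : X → ℝ≥0∞, Measurable f → ∀ x r, 0 < r →
    ∫⁻ g, f (g⁻¹ • x) ∂(τ r) ≤ C * sectorMax ε f x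

variable {X : Type u} [MeasurableSpace X] [MulAction PSL(2, ℝ) X]
  {μ : Measure X} {τ : ℝ → Measure PSL(2, ℝ)} {ε : ℝ} {C : ℝ≥0}

theorem IsDominated.maximalFun_le (hC : IsDominated X τ ε C) {f : X → ℂ} (hf : Measurable f)
    (x : X) : maximalFun τ f x ≤ C * sectorMax ε (fun x => ‖f x‖ₑ) x :=
  iSup_le fun r => hC.le _ hf.enorm x r r.2

theorem ergodicMean_congr {f f' : X → ℂ} (h : f =ᵐ[μ] f') :
    ergodicMean PSL(2, ℝ) μ f =ᵐ[μ] ergodicMean PSL(2, ℝ) μ f' :=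
  condExp_congr_ae h

variable [MeasurableSMul₂ PSL(2, ℝ) X]

theorem measurable_inv_smul (x : X) : Measurable fun g : PSL(2, ℝ) => g⁻¹ • x :=
  measurable_inv.smul measurable_const

theorem integrable_of_maximalFun_lt_top {f : X → ℂ} (hf : Measurable f) {x : X}
    (hx : maximalFun τ f x < ∞) {r : ℝ} (hr : 0 < r) :
    Integrable (fun g : PSL(2, ℝ) => f (g⁻¹ • x)) (τ r) :=
  ⟨(hf.comp (measurable_inv_smul x)).aestronglyMeasurable,
    (lintegral_enorm_le_maximalFun f x hr).trans_lt hx⟩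

theorem measurable_averagingOp {ρ : Measure PSL(2, ℝ)} [SFinite ρ] {f : X → ℂ}
    (hf : Measurable f) : Measurable (averagingOp ρ f) :=
  (StronglyMeasurable.integral_prod_right (f := fun (x : X) (g : PSL(2, ℝ)) => f (g⁻¹ • x))
    (hf.comp (measurable_snd.inv.smul measurable_fst)).stronglyMeasurable).measurable

variable [IsProbabilityMeasure μ] [SMulInvariantMeasure PSL(2, ℝ) X μ]

/-- A property that holds almost everywhere on `X` holds, for almost every `x`, almost everywhere
along the orbit of `x` for all measures of the family at once: the maximal inequality, applied to
the indicator of a null set, bounds uncountably many radii simultaneously. -/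
theorem IsDominated.ae_forall_ae_inv_smul (hC : IsDominated X τ ε C) (hε : 0 < ε)
    {p : X → Prop} (hp : ∀ᵐ x ∂μ, p x) :
    ∀ᵐ x ∂μ, ∀ r, 0 < r → ∀ᵐ g ∂(τ r), p (g⁻¹ • x) := by
  set Z := toMeasurable μ {x | ¬ p x} with hZ
  have hZm : MeasurableSet Z := measurableSet_toMeasurable _ _
  have hZ0 : μ Z = 0 := by rw [hZ, measure_toMeasurable]; exact hp
  set f : X → ℂ := Z.indicator 1 with hf
  have hfm : Measurable f := measurable_one.indicator hZm
  have h0 : f =ᵐ[μ] 0 := indicator_meas_zero hZ0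
  filter_upwards [sectorMax_ae_eq_zero hε hfm h0] with x hx r hr
  have h1 := hC.le _ hfm.enorm x r hr
  rw [hx, mul_zero, nonpos_iff_eq_zero] at h1
  filter_upwards [(lintegral_eq_zero_iff (μ := τ r) (f := fun g => ‖f (g⁻¹ • x)‖ₑ)
    (hfm.comp (measurable_inv_smul x)).enorm).1 h1] with g hg
  by_contra hpg
  have h2 : g⁻¹ • x ∈ Z := subset_toMeasurable _ _ hpg
  simp [hf, indicator_of_mem h2] at hg

theorem IsDominated.ae_eq_along_orbits (hC : IsDominated X τ ε C) (hε : 0 < ε)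
    {f f' : X → ℂ} (h : f =ᵐ[μ] f') :
    ∀ᵐ x ∂μ, ∀ r, 0 < r →
      (fun g : PSL(2, ℝ) => f (g⁻¹ • x)) =ᵐ[τ r] fun g => f' (g⁻¹ • x) :=
  hC.ae_forall_ae_inv_smul hε h

theorem IsDominated.maximalFun_congr (hC : IsDominated X τ ε C) (hε : 0 < ε)
    {f f' : X → ℂ} (h : f =ᵐ[μ] f') :
    maximalFun τ f =ᵐ[μ] maximalFun τ f' := by
  filter_upwards [hC.ae_eq_along_orbits hε h] with x hx
  refine iSup_congr fun r => lintegral_congr_ae ?_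
  filter_upwards [hx r r.2] with g hg
  rw [hg]

theorem IsDominated.averagingOp_congr (hC : IsDominated X τ ε C) (hε : 0 < ε)
    {f f' : X → ℂ} (h : f =ᵐ[μ] f') :
    ∀ᵐ x ∂μ, ∀ r, 0 < r → averagingOp (τ r) f x = averagingOp (τ r) f' x := by
  filter_upwards [hC.ae_eq_along_orbits hε h] with x hx r hr
  exact integral_congr_ae (hx r hr)

theorem IsDominated.convergesPointwise_congr (hC : IsDominated X τ ε C) (hε : 0 < ε)
    {f f' : X → ℂ} (h : f =ᵐ[μ] f')
    (hf : ConvergesPointwise τ μ f) : ConvergesPointwise τ μ f' := by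
  filter_upwards [hf, hC.ae_eq_along_orbits hε h, hC.averagingOp_congr hε h,
    ergodicMean_congr h] with x h1 h2 h3 h4
  refine ⟨fun r hr => (h1.1 r hr).congr (h2 r hr), ?_⟩
  rw [← h4]
  refine h1.2.congr' ?_
  filter_upwards [eventually_gt_atTop 0] with r hr
  exact h3 r hr

/-- Mean convergence follows from pointwise convergence and integrability of the maximal function
by dominated convergence. -/
theorem IsDominated.convergesInMean (hC : IsDominated X τ ε C) (hε : 0 < ε)
    {q : ℝ≥0∞} (hq : 1 ≤ q) (hq' : q ≠ ∞)
    {f : X → ℂ} (hf : MemLp f q μ) (hp : ConvergesPointwise τ μ f)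
    (hM : MemLp (maximalFun τ f) q μ) : ConvergesInMean τ μ q f := by
  have hq0 : q ≠ 0 := (zero_lt_one.trans_le hq).ne'
  have hqr : 0 < q.toReal := ENNReal.toReal_pos hq0 hq'
  have hmeas : ∀ r, 0 < r → AEStronglyMeasurable (averagingOp (τ r) f) μ := by
    intro r hr
    have := hC.isProbabilityMeasure r hr
    have hm : Measurable (hf.1.mk f) := hf.1.stronglyMeasurable_mk.measurable
    refine (measurable_averagingOp (ρ := τ r) hm).aestronglyMeasurable.congr ?_
    filter_upwards [hC.averagingOp_congr hε hf.1.ae_eq_mk] with x hx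
    exact (hx r hr).symm
  have hE : MemLp (ergodicMean PSL(2, ℝ) μ f) q μ := hf.condExp hq
  refine ⟨fun r hr => ⟨hmeas r hr, ?_⟩, ?_⟩
  · refine (eLpNorm_mono_enorm_ae (g := maximalFun τ f) (Eventually.of_forall fun x => ?_)).trans_lt
      hM.2
    rw [enorm_eq_self]
    exact enorm_averagingOp_le_maximalFun f x hr
  · have hlim : Tendsto (fun r : ℝ => ∫⁻ x, ‖averagingOp (τ r) f x -
        ergodicMean PSL(2, ℝ) μ f x‖ₑ ^ q.toReal ∂μ) atTop (𝓝 (∫⁻ _, 0 ∂μ)) := by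
      refine tendsto_lintegral_filter_of_dominated_convergence'
        (fun x => (maximalFun τ f x + ‖ergodicMean PSL(2, ℝ) μ f x‖ₑ) ^ q.toReal) ?_ ?_ ?_ ?_
      · filter_upwards [eventually_gt_atTop 0] with r hr
        exact ((hmeas r hr).sub hE.1).enorm.pow_const _
      · filter_upwards [eventually_gt_atTop 0] with r hr
        refine Eventually.of_forall fun x => ?_
        gcongr
        exact enorm_sub_le.trans (by gcongr; exact enorm_averagingOp_le_maximalFun f x hr)
      · refine (ENNReal.lintegral_rpow_add_lt_top_of_lintegral_rpow_lt_top hM.1.aemeasurable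
          ?_ ?_ ?_).ne
        · simpa using lintegral_rpow_enorm_lt_top_of_eLpNorm_lt_top hq0 hq' hM.2
        · exact lintegral_rpow_enorm_lt_top_of_eLpNorm_lt_top hq0 hq' hE.2
        · simpa using ENNReal.toReal_mono hq' hq
      · filter_upwards [hp] with x hx
        have h1 := (tendsto_sub_nhds_zero_iff.2 hx.2).enorm
        have h2 := h1.ennrpow_const q.toReal
        simpa [hqr] using h2
    have h3 := hlim.ennrpow_const (1 / q.toReal)
    simp only [lintegral_zero] at h3
    rw [ENNReal.zero_rpow_of_pos (by positivity)] at h3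
    refine h3.congr fun r => ?_
    rw [eLpNorm_eq_lintegral_rpow_enorm_toReal hq0 hq']
    rfl

end Transfer

/-! ### Functions in `L log L` -/

section LLogL

/-- The truncation of a function at height `n`. -/
def truncate {X : Type u} (f : X → ℂ) (n : ℕ) : X → ℂ := {x | ‖f x‖ ≤ n}.indicator f

theorem norm_truncate_le {X : Type u} (f : X → ℂ) (n : ℕ) (x : X) : ‖truncate f n x‖ ≤ n := by
  by_cases hx : x ∈ {x | ‖f x‖ ≤ n}
  · rw [truncate, indicator_of_mem hx]
    exact hx
  · rw [truncate, indicator_of_notMem hx, norm_zero]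
    positivity

theorem norm_sub_truncate_le {X : Type u} (f : X → ℂ) (n : ℕ) (x : X) :
    ‖f x - truncate f n x‖ ≤ ‖f x‖ := by
  by_cases hx : x ∈ {x | ‖f x‖ ≤ n}
  · rw [truncate, indicator_of_mem hx, sub_self, norm_zero]
    positivity
  · rw [truncate, indicator_of_notMem hx, sub_zero]

theorem eventually_truncate_eq {X : Type u} (f : X → ℂ) (x : X) :
    ∀ᶠ n in atTop, truncate f n x = f x := by
  filter_upwards [eventually_ge_atTop ⌈‖f x‖⌉₊] with n hn
  exact indicator_of_mem (show x ∈ {x | ‖f x‖ ≤ n} from Nat.ceil_le.1 hn) f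

variable {X : Type u} [MeasurableSpace X] {μ : Measure X}

theorem logSize_congr {f f' : X → ℂ} (h : f =ᵐ[μ] f') : logSize μ f = logSize μ f' := by
  refine lintegral_congr_ae ?_
  filter_upwards [h] with x hx
  rw [hx]

theorem mul_log_max_nonneg {a : ℝ} (ha : 0 ≤ a) : 0 ≤ a * Real.log (max a 1) :=
  mul_nonneg ha (Real.log_nonneg (le_max_right _ _))

/-- The bound by which functions in `L log L` are integrable; any constant above `e` would do. -/
theorem le_three_add_mul_log {a : ℝ} (ha : 0 ≤ a) : a ≤ 3 + a * Real.log (max a 1) := by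
  rcases le_total a 3 with h | h
  · linarith [mul_log_max_nonneg ha]
  · have h1 : 1 ≤ Real.log (max a 1) := by
      rw [Real.le_log_iff_exp_le (by positivity)]
      exact (Real.exp_one_lt_d9.le.trans (by norm_num)).trans (h.trans (le_max_left _ _))
    nlinarith

theorem log_max_mul_le {k : ℝ} (hk : 1 ≤ k) (a : ℝ) :
    Real.log (max (k * a) 1) ≤ Real.log k + Real.log (max a 1) := by
  rw [← Real.log_mul (by positivity) (by positivity)]
  refine Real.log_le_log (by positivity) (max_le ?_ ?_)
  · gcongr
    exact le_max_left _ _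
  · nlinarith [le_max_right a 1]

theorem measurable_mul_log_max {f : X → ℂ} (hf : Measurable f) :
    Measurable fun x => ENNReal.ofReal (‖f x‖ * Real.log (max ‖f x‖ 1)) := by
  fun_prop

theorem measurable_truncate {f : X → ℂ} (hf : Measurable f) (n : ℕ) : Measurable (truncate f n) :=
  hf.indicator (measurableSet_le hf.norm measurable_const)

theorem MeasureTheory.MemLp.memLLogL {f : X → ℂ} {p : ℝ≥0∞} (hp : 1 < p) (hp' : p ≠ ∞)
    (hf : MemLp f p μ) : MemLLogL μ f := by
  refine ⟨hf.1, ?_⟩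
  have hq : 1 < p.toReal := by
    rw [← ENNReal.toReal_one]
    exact (ENNReal.toReal_lt_toReal ENNReal.one_ne_top hp').2 hp
  set q := p.toReal with hqdef
  have h1 := lintegral_rpow_enorm_lt_top_of_eLpNorm_lt_top (zero_lt_one.trans hp).ne' hp' hf.2
  rw [← hqdef] at h1
  calc logSize μ f ≤ ∫⁻ x, ENNReal.ofReal (q - 1)⁻¹ * ‖f x‖ₑ ^ q ∂μ := by
        refine lintegral_mono fun x => ?_
        have ha : 0 ≤ ‖f x‖ := norm_nonneg _
        rw [← ofReal_norm, ENNReal.ofReal_rpow_of_nonneg ha (by linarith),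
          ← ENNReal.ofReal_mul (inv_nonneg.2 (by linarith))]
        refine ENNReal.ofReal_le_ofReal ?_
        rcases le_total ‖f x‖ 1 with h | h
        · rw [max_eq_right h, Real.log_one, mul_zero]
          have : 0 < q - 1 := by linarith
          positivity
        · rw [max_eq_left h]
          have h2 := Real.log_le_rpow_div ha (sub_pos.2 hq)
          calc ‖f x‖ * Real.log ‖f x‖ ≤ ‖f x‖ * (‖f x‖ ^ (q - 1) / (q - 1)) := by gcongr
            _ = (q - 1)⁻¹ * ‖f x‖ ^ q := by
              rw [show ‖f x‖ ^ q = ‖f x‖ * ‖f x‖ ^ (q - 1) by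
                rw [← Real.rpow_one_add' ha (by linarith)]; congr 1; ring]
              ring
    _ = ENNReal.ofReal (q - 1)⁻¹ * ∫⁻ x, ‖f x‖ₑ ^ q ∂μ :=
        lintegral_const_mul' _ _ ENNReal.ofReal_ne_top
    _ < ∞ := ENNReal.mul_lt_top ENNReal.ofReal_lt_top h1

variable [IsProbabilityMeasure μ]

theorem MemLLogL.integrable {f : X → ℂ} (hf : MemLLogL μ f) : Integrable f μ := by
  refine ⟨hf.1, ?_⟩
  calc ∫⁻ x, ‖f x‖ₑ ∂μ
      ≤ ∫⁻ x, 3 + ENNReal.ofReal (‖f x‖ * Real.log (max ‖f x‖ 1)) ∂μ := by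
        refine lintegral_mono fun x => ?_
        rw [← ofReal_norm, show (3 : ℝ≥0∞) = ENNReal.ofReal 3 by norm_num,
          ← ENNReal.ofReal_add (by norm_num) (mul_log_max_nonneg (norm_nonneg _))]
        exact ENNReal.ofReal_le_ofReal (le_three_add_mul_log (norm_nonneg _))
    _ = 3 + logSize μ f := by
        rw [lintegral_add_left measurable_const]
        simp [logSize]
    _ < ∞ := ENNReal.add_lt_top.2 ⟨by simp, hf.2⟩

theorem tendsto_eLpNorm_one_sub_truncate {f : X → ℂ} (hf : Measurable f) (hi : Integrable f μ) :
    Tendsto (fun n => eLpNorm (truncate f n - f) 1 μ) atTop (𝓝 0) := by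
  simp only [eLpNorm_one_eq_lintegral_enorm]
  have h := tendsto_lintegral_of_dominated_convergence (μ := μ)
    (F := fun n x => ‖(truncate f n - f) x‖ₑ) (f := fun _ => 0) (fun x => ‖f x‖ₑ)
    (fun n => ((measurable_truncate hf n).sub hf).enorm) (fun n => Eventually.of_forall fun x => ?_)
    hi.2.ne (Eventually.of_forall fun x => ?_)
  · simpa using h
  · change ‖truncate f n x - f x‖ₑ ≤ ‖f x‖ₑ
    rw [← ofReal_norm, ← ofReal_norm, norm_sub_rev]
    exact ENNReal.ofReal_le_ofReal (norm_sub_truncate_le f n x)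
  · refine tendsto_const_nhds.congr' ?_
    filter_upwards [eventually_truncate_eq f x] with n hn
    simp [hn]

theorem tendsto_logSize_smul_sub_truncate {f : X → ℂ} (hf : Measurable f)
    (hf' : MemLLogL μ f) {k : ℝ} (hk : 1 ≤ k) :
    Tendsto (fun n => logSize μ (fun x => (k : ℂ) * (f x - truncate f n x))) atTop (𝓝 0) := by
  have hk0 : 0 ≤ k := by linarith
  have hbound : ∫⁻ x, (ENNReal.ofReal (k * Real.log k) * ‖f x‖ₑ +
      ENNReal.ofReal k * ENNReal.ofReal (‖f x‖ * Real.log (max ‖f x‖ 1))) ∂μ ≠ ∞ := by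
    rw [lintegral_add_left (hf.enorm.const_mul _), lintegral_const_mul _ hf.enorm,
      lintegral_const_mul _ (measurable_mul_log_max hf)]
    exact ENNReal.add_ne_top.2 ⟨ENNReal.mul_ne_top ENNReal.ofReal_ne_top hf'.integrable.2.ne,
      ENNReal.mul_ne_top ENNReal.ofReal_ne_top hf'.2.ne⟩
  have h := tendsto_lintegral_of_dominated_convergence (μ := μ)
    (F := fun n x => ENNReal.ofReal (‖(k : ℂ) * (f x - truncate f n x)‖ *
      Real.log (max ‖(k : ℂ) * (f x - truncate f n x)‖ 1))) (f := fun _ => 0) _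
    (fun n => measurable_mul_log_max ((hf.sub (measurable_truncate hf n)).const_mul _))
    (fun n => Eventually.of_forall fun x => ?_) hbound (Eventually.of_forall fun x => ?_)
  · rw [lintegral_zero] at h
    exact h
  · rw [← ofReal_norm, ← ENNReal.ofReal_mul (mul_nonneg hk0 (Real.log_nonneg hk)),
      ← ENNReal.ofReal_mul hk0, ← ENNReal.ofReal_add
        (mul_nonneg (mul_nonneg hk0 (Real.log_nonneg hk)) (norm_nonneg _))
        (mul_nonneg hk0 (mul_log_max_nonneg (norm_nonneg _)))]
    refine ENNReal.ofReal_le_ofReal ?_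
    have h1 : ‖(k : ℂ) * (f x - truncate f n x)‖ ≤ k * ‖f x‖ := by
      rw [norm_mul, Complex.norm_real, Real.norm_of_nonneg hk0]
      gcongr
      exact norm_sub_truncate_le f n x
    calc _ ≤ (k * ‖f x‖) * Real.log (max (k * ‖f x‖) 1) := by
          have h2 : (0 : ℝ) < max ‖(k : ℂ) * (f x - truncate f n x)‖ 1 := by positivity
          have h3 : 0 ≤ Real.log (max ‖(k : ℂ) * (f x - truncate f n x)‖ 1) :=
            Real.log_nonneg (le_max_right _ _)
          gcongr
      _ ≤ (k * ‖f x‖) * (Real.log k + Real.log (max ‖f x‖ 1)) := by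
          gcongr
          exact log_max_mul_le hk _
      _ = _ := by ring
  · refine tendsto_const_nhds.congr' ?_
    filter_upwards [eventually_truncate_eq f x] with n hn
    simp [hn]

end LLogL

/-! ### Sector averages form a good averaging family -/

section Good

variable {X : Type u} [MeasurableSpace X] [MulAction PSL(2, ℝ) X] [MeasurableSMul₂ PSL(2, ℝ) X]
  {μ : Measure X} [IsProbabilityMeasure μ] [SMulInvariantMeasure PSL(2, ℝ) X μ]
  {τ : ℝ → Measure PSL(2, ℝ)} {ε : ℝ} {C : ℝ≥0}

theorem IsDominated.aemeasurable_maximalFun (hC : IsDominated X τ ε C) (hε : 0 < ε) {f : X → ℂ}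
    (hf : AEStronglyMeasurable f μ) : AEMeasurable (maximalFun τ f) μ :=
  (hC.measurable_maximalFun _ hf.stronglyMeasurable_mk.measurable).aemeasurable.congr
    (hC.maximalFun_congr hε hf.ae_eq_mk.symm)

theorem IsDominated.eLpNorm_maximalFun_le (hC : IsDominated X τ ε C) (hε : 0 < ε) {p : ℝ≥0∞}
    (hp : 1 < p) (hp' : p ≠ ∞) {f : X → ℂ} (hf : AEStronglyMeasurable f μ) :
    eLpNorm (maximalFun τ f) p μ ≤
      (C * (2 ^ p.toReal * p.toReal / (p.toReal - 1)).toNNReal ^ (1 / p.toReal) : ℝ≥0) *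
        eLpNorm f p μ := by
  have hq : 1 < p.toReal := by
    rw [← ENNReal.toReal_one]
    exact (ENNReal.toReal_lt_toReal ENNReal.one_ne_top hp').2 hp
  have hp0 : p ≠ 0 := (zero_lt_one.trans hp).ne'
  have hm : Measurable (hf.mk f) := hf.stronglyMeasurable_mk.measurable
  rw [eLpNorm_congr_ae (hC.maximalFun_congr hε hf.ae_eq_mk), eLpNorm_congr_ae hf.ae_eq_mk,
    eLpNorm_eq_lintegral_rpow_enorm_toReal hp0 hp', eLpNorm_eq_lintegral_rpow_enorm_toReal hp0 hp']
  simp only [enorm_eq_self]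
  set q := p.toReal with hqdef
  have hq0 : 0 ≤ 1 / q := by positivity
  calc (∫⁻ x, maximalFun τ (hf.mk f) x ^ q ∂μ) ^ (1 / q)
      ≤ (∫⁻ x, (C : ℝ≥0∞) ^ q * sectorMax ε (fun x => ‖hf.mk f x‖ₑ) x ^ q ∂μ) ^ (1 / q) := by
        gcongr with x
        rw [← ENNReal.mul_rpow_of_nonneg _ _ (by linarith)]
        gcongr
        exact hC.maximalFun_le hm x
    _ ≤ ((C : ℝ≥0∞) ^ q * (ENNReal.ofReal (2 ^ q * q / (q - 1)) *
          ∫⁻ x, ‖hf.mk f x‖ₑ ^ q ∂μ)) ^ (1 / q) := by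
        rw [lintegral_const_mul' _ _
          (ENNReal.rpow_ne_top_of_nonneg (by linarith) ENNReal.coe_ne_top)]
        gcongr
        exact lintegral_sectorMax_rpow_le hε hm hq
    _ = _ := by
        rw [ENNReal.mul_rpow_of_nonneg _ _ hq0, ENNReal.mul_rpow_of_nonneg _ _ hq0,
          ← ENNReal.rpow_mul, mul_one_div_cancel (by linarith), ENNReal.rpow_one, ENNReal.coe_mul,
          ENNReal.coe_rpow_of_nonneg _ hq0, mul_assoc]
        rfl

theorem IsDominated.lintegral_maximalFun_le (hC : IsDominated X τ ε C) (hε : 0 < ε) {f : X → ℂ}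
    (hf : AEStronglyMeasurable f μ) :
    ∫⁻ x, maximalFun τ f x ∂μ ≤ (C * 7 : ℝ≥0) * (1 + logSize μ f) := by
  have hm : Measurable (hf.mk f) := hf.stronglyMeasurable_mk.measurable
  rw [lintegral_congr_ae (hC.maximalFun_congr hε hf.ae_eq_mk), logSize_congr hf.ae_eq_mk]
  calc ∫⁻ x, maximalFun τ (hf.mk f) x ∂μ
      ≤ ∫⁻ x, C * sectorMax ε (fun x => ‖hf.mk f x‖ₑ) x ∂μ :=
        lintegral_mono fun x => hC.maximalFun_le hm x
    _ = C * ∫⁻ x, sectorMax ε (fun x => ‖hf.mk f x‖ₑ) x ∂μ :=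
        lintegral_const_mul' _ _ ENNReal.coe_ne_top
    _ ≤ C * (7 * (1 + logSize μ (hf.mk f))) := by
        gcongr
        exact lintegral_sectorMax_le hε hm
    _ = _ := by push_cast; ring

theorem maximalFun_const_mul {X : Type u} [MulAction PSL(2, ℝ) X] {τ : ℝ → Measure PSL(2, ℝ)}
    (k : ℂ) (f : X → ℂ) (x : X) :
    maximalFun τ (fun x => k * f x) x = ‖k‖ₑ * maximalFun τ f x := by
  simp only [maximalFun, enorm_mul, ENNReal.mul_iSup]
  exact iSup_congr fun r => lintegral_const_mul' _ _ enorm_ne_top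

/-- The maximal functions of the tails of a function in `L log L` tend to zero in `L¹`. The
constant term of the `L log L` inequality is made small by applying it to a large multiple of the
tail. -/
theorem IsDominated.tendsto_lintegral_maximalFun_sub_truncate (hC : IsDominated X τ ε C)
    (hε : 0 < ε) {f : X → ℂ} (hf : Measurable f) (hf' : MemLLogL μ f) :
    Tendsto (fun n => ∫⁻ x, maximalFun τ (fun x => f x - truncate f n x) x ∂μ) atTop (𝓝 0) := by
  rw [ENNReal.tendsto_nhds_zero]
  intro δ hδ
  -- `k` times the tail has small `logSize`, so `k` times the integral is at most `7 * C * (1 + 1)`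
  set D : ℝ≥0∞ := ((C * 7 : ℝ≥0) : ℝ≥0∞) * 2 with hD
  have hDt : D ≠ ∞ := by finiteness
  obtain ⟨k, hk0, hk⟩ : ∃ k : ℕ, 1 ≤ k ∧ D ≤ k * δ := by
    rcases eq_or_ne δ ∞ with rfl | hδt
    · exact ⟨1, le_rfl, by simp⟩
    obtain ⟨n, hn⟩ := ENNReal.exists_nat_gt (ENNReal.div_ne_top hDt hδ.ne')
    refine ⟨n + 1, by omega, ?_⟩
    rw [← ENNReal.div_le_iff hδ.ne' hδt]
    exact hn.le.trans (by push_cast; exact le_self_add)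
  have hk1 : (1 : ℝ) ≤ k := by exact_mod_cast hk0
  filter_upwards [ENNReal.tendsto_nhds_zero.1 (tendsto_logSize_smul_sub_truncate hf hf' hk1) 1
    one_pos] with n hn
  have hm := hf.sub (measurable_truncate hf n)
  have h1 := hC.lintegral_maximalFun_le (μ := μ) hε
    (f := fun x => ((k : ℝ) : ℂ) * (f x - truncate f n x)) (hm.const_mul _).aestronglyMeasurable
  simp only [maximalFun_const_mul] at h1
  rw [lintegral_const_mul' _ _ enorm_ne_top] at h1
  have h2 : ‖((k : ℝ) : ℂ)‖ₑ = (k : ℝ≥0∞) := by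
    rw [← ofReal_norm, Complex.norm_real, Real.norm_of_nonneg (by positivity),
      ENNReal.ofReal_natCast]
  rw [h2] at h1
  have hk2 : (k : ℝ≥0∞) ≠ 0 := by
    have : k ≠ 0 := by omega
    exact_mod_cast this
  refine (ENNReal.mul_le_mul_iff_right hk2 (ENNReal.natCast_ne_top k)).1 (h1.trans ?_)
  refine le_trans ?_ hk
  rw [hD, ← one_add_one_eq_two]
  gcongr

/-- Pointwise convergence for bounded functions extends to `L log L`, by truncation. -/
theorem IsDominated.convergesPointwise (hC : IsDominated X τ ε C) (hε : 0 < ε)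
    (hb : ∀ (f : X → ℂ) (M : ℝ), Measurable f → (∀ x, ‖f x‖ ≤ M) →
      ∀ᵐ x ∂μ, Tendsto (fun r : ℝ => averagingOp (τ r) f x) atTop
        (𝓝 (ergodicMean PSL(2, ℝ) μ f x))) {f : X → ℂ}
    (hf : MemLLogL μ f) : ConvergesPointwise τ μ f := by
  wlog hfm : Measurable f generalizing f
  · have h := hf.1.ae_eq_mk
    exact hC.convergesPointwise_congr hε h.symm
      (this ⟨hf.1.congr h, by rw [← logSize_congr h]; exact hf.2⟩
        hf.1.stronglyMeasurable_mk.measurable)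
  have hi := hf.integrable
  have hfin : ∀ᵐ x ∂μ, maximalFun τ f x < ∞ := by
    refine ae_lt_top (hC.measurable_maximalFun f hfm)
      ((hC.lintegral_maximalFun_le hε hf.1).trans_lt ?_).ne
    exact ENNReal.mul_lt_top ENNReal.coe_lt_top (ENNReal.add_lt_top.2 ⟨by simp, hf.2⟩)
  have hti : ∀ n, Integrable (truncate f n) μ := fun n =>
    Integrable.of_bound (measurable_truncate hfm n).aestronglyMeasurable n
      (Eventually.of_forall (norm_truncate_le f n))
  have hEm : ∀ h : X → ℂ, AEMeasurable (ergodicMean PSL(2, ℝ) μ h) μ := fun h =>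
    (stronglyMeasurable_condExp.mono (invariantSigmaAlgebra_le _ _)).measurable.aemeasurable
  have hlim : ∀ᵐ x ∂μ, Tendsto (fun r : ℝ => averagingOp (τ r) f x) atTop
      (𝓝 (ergodicMean PSL(2, ℝ) μ f x)) := by
    refine ae_tendsto_of_approx (φ' := fun n r x => averagingOp (τ r) (truncate f n) x)
      (ψ' := fun n => ergodicMean PSL(2, ℝ) μ (truncate f n))
      (m := fun n => maximalFun τ (fun x => f x - truncate f n x))
      (d := fun n x => edist (ergodicMean PSL(2, ℝ) μ (truncate f n) x)
        (ergodicMean PSL(2, ℝ) μ f x))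
      (fun n => (hC.measurable_maximalFun _ (hfm.sub (measurable_truncate hfm n))).aemeasurable)
      (fun n => (hEm _).edist (hEm _))
      (fun n => hb _ n (measurable_truncate hfm n) (norm_truncate_le f n))
      (fun n => ?_) (fun n => Eventually.of_forall fun x => le_rfl) ?_
    · filter_upwards [hfin] with x hx r hr
      have := hC.isProbabilityMeasure r hr
      have h1 := integrable_of_maximalFun_lt_top hfm hx hr
      have h2 : Integrable (fun g : PSL(2, ℝ) => truncate f n (g⁻¹ • x)) (τ r) :=
        Integrable.of_bound ((measurable_truncate hfm n).comp
          (measurable_inv_smul x)).aestronglyMeasurable n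
          (Eventually.of_forall fun g => norm_truncate_le f n _)
      rw [edist_eq_enorm_sub, averagingOp, averagingOp, ← integral_sub h1 h2]
      exact enorm_averagingOp_le_maximalFun (fun x => f x - truncate f n x) x hr
    · have h1 : Tendsto (fun n => ∫⁻ x, edist (ergodicMean PSL(2, ℝ) μ (truncate f n) x)
          (ergodicMean PSL(2, ℝ) μ f x) ∂μ) atTop (𝓝 0) := by
        refine tendsto_of_tendsto_of_tendsto_of_le_of_le tendsto_const_nhds
          (tendsto_eLpNorm_one_sub_truncate hfm hi) (fun n => zero_le) fun n => ?_
        refine le_trans (le_of_eq ?_)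
          (eLpNorm_condExp_le_eLpNorm (m := invariantSigmaAlgebra PSL(2, ℝ) X) _ le_rfl)
        rw [eLpNorm_one_eq_lintegral_enorm]
        refine lintegral_congr_ae ?_
        filter_upwards [condExp_sub (hti n) hi (invariantSigmaAlgebra PSL(2, ℝ) X)] with x hx
        rw [hx, edist_eq_enorm_sub]
        rfl
      have h2 := (hC.tendsto_lintegral_maximalFun_sub_truncate hε hfm hf).add h1
      rw [add_zero] at h2
      refine h2.congr fun n => (lintegral_add_left
        (hC.measurable_maximalFun _ (hfm.sub (measurable_truncate hfm n))) _).symm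
  filter_upwards [hfin, hlim] with x h1 h2
  exact ⟨fun r hr => integrable_of_maximalFun_lt_top hfm h1 hr, h2⟩

theorem IsDominated.convergesInMean_of_memLLogL (hC : IsDominated X τ ε C) (hε : 0 < ε)
    (hb : ∀ (f : X → ℂ) (M : ℝ), Measurable f → (∀ x, ‖f x‖ ≤ M) →
      ∀ᵐ x ∂μ, Tendsto (fun r : ℝ => averagingOp (τ r) f x) atTop
        (𝓝 (ergodicMean PSL(2, ℝ) μ f x)))
    {f : X → ℂ} (hf : MemLLogL μ f) : ConvergesInMean τ μ 1 f := by
  refine hC.convergesInMean hε le_rfl ENNReal.one_ne_top (memLp_one_iff_integrable.2 hf.integrable)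
    (hC.convergesPointwise hε hb hf)
    ⟨(hC.aemeasurable_maximalFun hε hf.1).aestronglyMeasurable, ?_⟩
  rw [eLpNorm_one_eq_lintegral_enorm]
  simp only [enorm_eq_self]
  exact (hC.lintegral_maximalFun_le hε hf.1).trans_lt
    (ENNReal.mul_lt_top ENNReal.coe_lt_top (ENNReal.add_lt_top.2 ⟨by simp, hf.2⟩))

theorem IsDominated.convergesInMean_of_memLp (hC : IsDominated X τ ε C) (hε : 0 < ε)
    (hb : ∀ (f : X → ℂ) (M : ℝ), Measurable f → (∀ x, ‖f x‖ ≤ M) →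
      ∀ᵐ x ∂μ, Tendsto (fun r : ℝ => averagingOp (τ r) f x) atTop
        (𝓝 (ergodicMean PSL(2, ℝ) μ f x))) {p : ℝ≥0∞}
    (hp : 1 < p) (hp' : p ≠ ∞) {f : X → ℂ} (hf : MemLp f p μ) : ConvergesInMean τ μ p f :=
  hC.convergesInMean hε hp.le hp' hf (hC.convergesPointwise hε hb (hf.memLLogL hp hp'))
    ⟨(hC.aemeasurable_maximalFun hε hf.1).aestronglyMeasurable,
      (hC.eLpNorm_maximalFun_le hε hp hp' hf.1).trans_lt
        (ENNReal.mul_lt_top ENNReal.coe_lt_top hf.2)⟩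

end Good

end

theorem mainTheorem7 (ν lam : Measure rotK) [IsProbabilityMeasure ν] [IsProbabilityMeasure lam]
    (hν : ν ≪ haarK) (hlam : lam ≪ haarK)
    (hν' : MemLp (ν.rnDeriv haarK) ∞ haarK) (hlam' : MemLp (lam.rnDeriv haarK) ∞ haarK)
    (ε : ℝ) (hε : 0 < ε) :
    IsGoodAveragingFamily.{u} (sectorFamily ν lam ε) := by
  obtain ⟨C, hC⟩ := exists_lintegral_sectorFamily_le.{u} hν hlam hν' hlam' hε
  have hdom : ∀ (X : Type u) [MeasurableSpace X] [MulAction PSL(2, ℝ) X]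
      [MeasurableSMul₂ PSL(2, ℝ) X], IsDominated X (sectorFamily ν lam ε) ε C := by
    intro X _ _ _
    exact ⟨fun r hr => isProbabilityMeasure_sectorFamily ν lam hr hε,
      fun f hf => measurable_maximalFun ν lam hε hf, hC X⟩
  refine ⟨isAveragingFamily_sectorFamily hε, fun p hp hp' => ⟨⟨C *
    (2 ^ p.toReal * p.toReal / (p.toReal - 1)).toNNReal ^ (1 / p.toReal), ?_⟩, ?_, ?_⟩,
    ⟨⟨C * 7, ?_⟩, ?_, ?_⟩⟩
  · intro X _ _ _ _ μ _ _ f hf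
    exact ⟨(hdom X).aemeasurable_maximalFun hε hf.1,
      (hdom X).eLpNorm_maximalFun_le hε hp hp'.ne hf.1⟩
  · intro X _ _ _ _ μ _ _ f hf
    exact (hdom X).convergesInMean_of_memLp hε
      (fun f M hf hM => ae_tendsto_averagingOp_of_bounded hν hlam hε hf hM) hp hp'.ne hf
  · intro X _ _ _ _ μ _ _ f hf
    exact (hdom X).convergesPointwise hε
      (fun f M hf hM => ae_tendsto_averagingOp_of_bounded hν hlam hε hf hM)
      (hf.memLLogL hp hp'.ne)
  · intro X _ _ _ _ μ _ _ f hf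
    exact ⟨(hdom X).aemeasurable_maximalFun hε hf.1, (hdom X).lintegral_maximalFun_le hε hf.1⟩
  · intro X _ _ _ _ μ _ _ f hf
    exact (hdom X).convergesInMean_of_memLLogL hε
      (fun f M hf hM => ae_tendsto_averagingOp_of_bounded hν hlam hε hf hM) hf
  · intro X _ _ _ _ μ _ _ f hf
    exact (hdom X).convergesPointwise hε
      (fun f M hf hM => ae_tendsto_averagingOp_of_bounded hν hlam hε hf hM) hf
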